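/- Let $\mathbb X^n$ be one of the Euclidean space $\mathbb E^n$, the unit sphere $\mathbb S^n\subset\mathbb E^{n+1}$, or the Lobachevsky space $\Lambda^n=\{x\in\mathbb E^{n,1}:(x,x)=-1,\ x_{n+1}>0\}$. A cross-polytope $P$ in $\mathbb X^n$ is given by points $a_1,\dots,a_n,b_1,\dots,b_n\in\mathbb X^n$ such that for each choice of $c_p\in\{a_p,b_p\}$ ($p=1,\dots,n$) the points $c_1,\dots,c_n$ are the vertices of a non-degenerate $(n-1)$-simplex, i.e. do not lie in a common $(n-2)$-plane of $\mathbb X^n$; these simplices are its facets. A flex is a continuous family $P(u)$, $u\in[0,1]$, of cross-polytopes all of whose faces remain congruent to themselves, and such that $P(u_1)$, $P(u_2)$ are not congruent whenever $u_1\neq u_2$ are sufficiently close. The flex is essential if for all but finitely many $u$ no dihedral angle of $P(u)$ is $0$ or $\pi$. Given $P$, let $\Delta=[a_1,\dots,a_n]$, let $\Delta_p$ be the facet spanned by $b_p$ and all $a_q$, $q\ne p$, and let $F_p$ be their common face. Let $m$ be a unit normal to the hyperplane of $\Delta$, and $\mathbf n_p$ the inner unit normal to $F_p$ in $\Delta$.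 Keep $\Delta$ fixed, and let $b_p(t_p)$, $t_p\in\mathbb{RP}^1=\mathbb R\cup\{\infty\}$, be the point obtained from $b_p$ by rotating $\Delta_p$ around $F_p$ so that the oriented dihedral angle $\varphi_p$ between $\Delta$ and $\Delta_p$ satisfies $\tan(\varphi_p/2)=t_p$; explicitly, $b_p(t_p)=b_p^0-\frac{2h_pt_p^2}{t_p^2+1}\mathbf n_p+\frac{2h_pt_p}{t_p^2+1}m$, where $b_p^0$ is the position for $\varphi_p=0$ and $h_p$ is the length (for $\mathbb S^n$ its sine, for $\Lambda^n$ its hyperbolic sine) of the altitude of $\Delta_p$ from $b_p$. Let $\Xi\subset(\mathbb{RP}^1)^n$ be the set of all $(t_1,\dots,t_n)$ such that $\mathrm{dist}(b_p(t_p),b_q(t_q))=\mathrm{dist}(b_p,b_q)$ for all $p\ne q$. A one-dimensional irreducible component $\Sigma$ of $\Xi$ (in the Zariski topology of the real points) is essential if no coordinate $t_p$ is identically $0$ or identically $\infty$ on $\Sigma$. It has type $(n_1,\dots,n_m)$ if $\{1,\dots,n\}$ is a disjoint union of non-empty sets $I_1,\dots,I_m$ with $|I_j|=n_j$ such that, for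 all $p,q$, the coordinates $t_p$ and $t_q$ are directly or inversely proportional on $\Sigma$ (i.e. $t_q=ct_p$ or $t_pt_q=c$ on $\Sigma$ for a constant $c\ne0$) if and only if $p,q$ lie in the same $I_j$. We call $P$ a flexible cross-polytope of type $(n_1,\dots,n_m)$ if $\Xi$ has an essential one-dimensional irreducible component $\Sigma$ of this type, and there is an essential flex starting at $P$, with $\Delta$ fixed, whose parameters $(t_1,\dots,t_n)$ stay in $\Sigma$. **Corollary.** For every $n\ge 3$, every partition $(n_1,\dots,n_m)$ of $n$, and each of the spaces $\mathbb X^n=\mathbb E^n,\mathbb S^n,\Lambda^n$, there is a flexible cross-polytope of type $(n_1,\dots,n_m)$ in $\mathbb X^n$. In particular, for every $n\ge 5$, each of $\mathbb E^n$, $\mathbb S^n$, $\Lambda^n$ contains a flexible polyhedron, namely a cross-polytope admitting an essential flex. -/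

import Mathlib

/-! ### The three spaces of constant curvature -/

/-- The three kinds of spaces `𝕏ⁿ`: Euclidean `𝔼ⁿ`, spherical `𝕊ⁿ`, Lobachevsky `Λⁿ`. -/
inductive SpaceForm where
  | euclidean
  | spherical
  | lobachevsky

namespace SpaceForm

/-- Dimension of the ambient vector space of `𝕏ⁿ`. -/
def ambientDim : SpaceForm → ℕ → ℕ
  | euclidean, n => n
  | spherical, n => n + 1
  | lobachevsky, n => n + 1

/-- The ambient vector space: `𝔼ⁿ`, `𝔼ⁿ⁺¹`, `𝔼ⁿ'¹` respectively. (In the third case only the vector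
space structure and the topology of `EuclideanSpace` are used, together with `form` below.) -/
abbrev V (X : SpaceForm) (n : ℕ) : Type := EuclideanSpace ℝ (Fin (X.ambientDim n))

/-- The scalar product of the ambient space: Euclidean, Euclidean, and
`x₀y₀ + ⋯ + xₙ₋₁yₙ₋₁ - xₙyₙ` respectively. -/
noncomputable def form : (X : SpaceForm) → {n : ℕ} → X.V n → X.V n → ℝ
  | euclidean, _, x, y => inner ℝ x y
  | spherical, _, x, y => inner ℝ x y
  | lobachevsky, n, x, y =>
      (∑ i : Fin n, x (Fin.castSucc i) * y (Fin.castSucc i)) - x (Fin.last n) * y (Fin.last n)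

/-- The points of `𝕏ⁿ`: all vectors; the unit sphere; the upper sheet of the hyperboloid
`(x, x) = -1`. -/
def points : (X : SpaceForm) → (n : ℕ) → Set (X.V n)
  | euclidean, _ => Set.univ
  | spherical, _ => Metric.sphere 0 1
  | lobachevsky, n => {x | form lobachevsky x x = -1 ∧ 0 < x (Fin.last n)}

/-- The intrinsic distance between two points of `𝕏ⁿ`. -/
noncomputable def distance : (X : SpaceForm) → {n : ℕ} → X.V n → X.V n → ℝ
  | euclidean, _, x, y => dist x y
  | spherical, _, x, y => Real.arccos (form spherical x y)
  | lobachevsky, _, x, y => Real.arcosh (-form lobachevsky x y)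

/-- Points of `𝕏ⁿ` in general position, i.e. vertices of a non-degenerate simplex. -/
def GeneralPosition {ι : Type} : (X : SpaceForm) → {n : ℕ} → (ι → X.V n) → Prop
  | euclidean, _, f => AffineIndependent ℝ f
  | spherical, _, f => LinearIndependent ℝ f
  | lobachevsky, _, f => LinearIndependent ℝ f

/-- The flat spanned by points of `𝕏ⁿ`: the affine hull for `𝔼ⁿ`; for `𝕊ⁿ` and `Λⁿ` the linear
hull (whose intersection with `𝕏ⁿ` is the totally geodesic subspace spanned by the points). -/
def flat {ι : Type} : (X : SpaceForm) → {n : ℕ} → (ι → X.V n) → Set (X.V n)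
  | euclidean, _, f => (affineSpan ℝ (Set.range f) : Set _)
  | spherical, _, f => (Submodule.span ℝ (Set.range f) : Set _)
  | lobachevsky, _, f => (Submodule.span ℝ (Set.range f) : Set _)

/-- The vector `v` is orthogonal to the flat spanned by the points `f i`. -/
def Orthogonal {ι : Type} : (X : SpaceForm) → {n : ℕ} → (ι → X.V n) → X.V n → Prop
  | euclidean, _, f, v => ∀ i j, form euclidean (f i - f j) v = 0
  | spherical, _, f, v => ∀ i, form spherical (f i) v = 0
  | lobachevsky, _, f, v => ∀ i, form lobachevsky (f i) v = 0

/-- Two indexed families of points are congruent: all pairwise distances agree. -/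
def Congruent {ι : Type} (X : SpaceForm) {n : ℕ} (f g : ι → X.V n) : Prop :=
  ∀ i j, X.distance (f i) (f j) = X.distance (g i) (g j)

/-- `ν` is the unit normal, tangent to the simplex with facet `f` and opposite vertex `x`, to that
facet, pointing inside the simplex (towards `x`). -/
def IsInnerNormal {ι : Type} (X : SpaceForm) {n : ℕ} (f : ι → X.V n) (x ν : X.V n) : Prop :=
  X.form ν ν = 1 ∧ X.Orthogonal f ν ∧ ∃ h : ℝ, 0 < h ∧ x - h • ν ∈ X.flat f

end SpaceForm

/-! ### Cross-polytopes and flexes -/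

/-- A `2n`-tuple of vertices `a₁, …, aₙ, b₁, …, bₙ`. -/
structure VertexTuple (X : SpaceForm) (n : ℕ) where
  a : Fin n → X.V n
  b : Fin n → X.V n

namespace VertexTuple

variable {X : SpaceForm} {n : ℕ}

/-- All `2n` vertices as one family. -/
def vertex (P : VertexTuple X n) : Fin n ⊕ Fin n → X.V n := Sum.elim P.a P.b

/-- The `n` vertices of a facet: for each `p`, the vertex `b_p` if `ε p` is true, else `a_p`. -/
def facet (P : VertexTuple X n) (ε : Fin n → Bool) (p : Fin n) : X.V n :=
  if ε p then P.b p else P.a p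

/-- The vertices lie in `𝕏ⁿ` and span a cross-polytope, i.e. all facets are non-degenerate. -/
def IsCrossPolytope (P : VertexTuple X n) : Prop :=
  (∀ i, P.vertex i ∈ X.points n) ∧ ∀ ε, X.GeneralPosition (P.facet ε)

/-- `θ` is the dihedral angle between the two facets `ε` and `ε'`, where `ε'` differs from `ε`
exactly in the `p`-th vertex, at their common `(n-2)`-dimensional face. -/
def IsDihedralAngle (P : VertexTuple X n) (ε : Fin n → Bool) (p : Fin n) (θ : ℝ) : Prop :=
  ∃ μ ν : X.V n,
    X.IsInnerNormal (fun q : {q : Fin n // q ≠ p} => P.facet ε q) (P.facet ε p) μ ∧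
    X.IsInnerNormal (fun q : {q : Fin n // q ≠ p} => P.facet ε q)
      (P.facet (Function.update ε p (!ε p)) p) ν ∧
    θ = Real.arccos (X.form μ ν)

/-- No dihedral angle is zero or straight. -/
def IsEssential (P : VertexTuple X n) : Prop :=
  ∀ ε p, ∃ θ, P.IsDihedralAngle ε p θ ∧ θ ≠ 0 ∧ θ ≠ Real.pi

/-- Congruence of cross-polytopes as figures: congruence of the vertices after some bijection of
the vertices that takes faces to faces (i.e. opposite vertices to opposite vertices). -/
def FigureCongruent (P Q : VertexTuple X n) : Prop :=
  ∃ σ : Equiv.Perm (Fin n ⊕ Fin n), (∀ i, σ i.swap = (σ i).swap) ∧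
    X.Congruent P.vertex (Q.vertex ∘ σ)

/-- A flex: a continuous family of cross-polytopes all of whose faces remain congruent to
themselves, while no two sufficiently close distinct members are congruent. -/
def IsFlex (P : unitInterval → VertexTuple X n) : Prop :=
  (∀ u, (P u).IsCrossPolytope) ∧
  (∀ i, Continuous fun u => (P u).vertex i) ∧
  (∀ u₁ u₂ ε, X.Congruent ((P u₁).facet ε) ((P u₂).facet ε)) ∧
  ∃ δ > 0, ∀ u₁ u₂, u₁ ≠ u₂ → dist u₁ u₂ < δ → ¬ (P u₁).FigureCongruent (P u₂)

/-- A flex whose members are essential for all but finitely many parameters. -/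
def IsEssentialFlex (P : unitInterval → VertexTuple X n) : Prop :=
  IsFlex P ∧ {u | ¬ (P u).IsEssential}.Finite

end VertexTuple

/-! ### Algebraic subsets of `(ℝP¹)ⁿ`, where `ℝP¹ = ℝ ∪ {∞}` -/

/-- Homogeneous coordinates `(x : y)` of a point of `ℝ ∪ {∞}`: `s = (s : 1)`, `∞ = (1 : 0)`. -/
def homCoord (t : OnePoint ℝ) : Fin 2 → ℝ := t.elim ![1, 0] fun s => ![s, 1]

/-- `f` is homogeneous of degree `d p` in the `p`-th pair of homogeneous coordinates, for all `p`. -/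
def IsMultihomogeneous {n : ℕ} (f : MvPolynomial (Fin n × Fin 2) ℝ) (d : Fin n → ℕ) : Prop :=
  f.IsWeightedHomogeneous (fun i : Fin n × Fin 2 => (Pi.single i.1 1 : Fin n → ℕ)) d

/-- Zariski closed subsets of `(ℝP¹)ⁿ`. -/
def IsAlgebraicSubset {n : ℕ} (Z : Set (Fin n → OnePoint ℝ)) : Prop :=
  ∃ S : Set (MvPolynomial (Fin n × Fin 2) ℝ), (∀ f ∈ S, ∃ d, IsMultihomogeneous f d) ∧
    Z = {t | ∀ f ∈ S, MvPolynomial.eval (fun i => homCoord (t i.1) i.2) f = 0}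

/-- Irreducible (non-empty) Zariski closed subsets of `(ℝP¹)ⁿ`. -/
def IsIrreducibleAlgebraic {n : ℕ} (Z : Set (Fin n → OnePoint ℝ)) : Prop :=
  IsAlgebraicSubset Z ∧ Z.Nonempty ∧
    ∀ Z₁ Z₂, IsAlgebraicSubset Z₁ → IsAlgebraicSubset Z₂ → Z ⊆ Z₁ ∪ Z₂ → Z ⊆ Z₁ ∨ Z ⊆ Z₂

/-- `C` is an irreducible component of `Y`: a maximal irreducible algebraic subset. -/
def IsIrreducibleComponent {n : ℕ} (Y C : Set (Fin n → OnePoint ℝ)) : Prop :=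
  Maximal (fun Z => IsIrreducibleAlgebraic Z ∧ Z ⊆ Y) C

/-- Krull dimension of a subset of `(ℝP¹)ⁿ` (in terms of chains of irreducible algebraic subsets). -/
noncomputable def algebraicDim {n : ℕ} (C : Set (Fin n → OnePoint ℝ)) : WithBot ℕ∞ :=
  Order.krullDim {Z : Set (Fin n → OnePoint ℝ) // IsIrreducibleAlgebraic Z ∧ Z ⊆ C}

/-- `C` is essential: no coordinate is identically `0` or identically `∞` on it. -/
def IsEssentialSubset {n : ℕ} (C : Set (Fin n → OnePoint ℝ)) : Prop :=
  ∀ p, (¬ ∀ t ∈ C, t p = ((0 : ℝ) : OnePoint ℝ)) ∧ ¬ ∀ t ∈ C, t p = OnePoint.infty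

/-- The coordinates `t_p`, `t_q` are directly (`t_q = c t_p`) or inversely (`t_p t_q = c`)
proportional on `C`, `c ≠ 0`, written in homogeneous coordinates. -/
def CoordProportional {n : ℕ} (C : Set (Fin n → OnePoint ℝ)) (p q : Fin n) : Prop :=
  ∃ c : ℝ, c ≠ 0 ∧
    ((∀ t ∈ C, homCoord (t q) 0 * homCoord (t p) 1 = c * (homCoord (t p) 0 * homCoord (t q) 1)) ∨
     (∀ t ∈ C, homCoord (t p) 0 * homCoord (t q) 0 = c * (homCoord (t p) 1 * homCoord (t q) 1)))

/-- `C` has type `π`: the indices split into blocks, of sizes given by `π`, such that two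
coordinates are proportional on `C` iff their indices are in the same block. -/
def HasType {n : ℕ} (C : Set (Fin n → OnePoint ℝ)) (π : n.Partition) : Prop :=
  ∃ I : Finpartition (Finset.univ : Finset (Fin n)),
    (∀ p q, CoordProportional C p q ↔ ∃ B ∈ I.parts, p ∈ B ∧ q ∈ B) ∧
    Multiset.map Finset.card I.parts.val = π.parts

/-! ### Butterflies and the configuration space -/

/-- The data describing the rotation of the facets `Δ_p = [b_p, a_q (q ≠ p)]` around the faces
`F_p = [a_q (q ≠ p)]` of the facet `Δ = [a₁, …, aₙ]`: `m` is a unit normal to the hyperplane of `Δ`,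
`nrm p` the inner unit normal to `F_p` in `Δ`, `b₀ p` the position of `b_p` for zero dihedral angle,
`h p` the length (or its sine, or its hyperbolic sine) of the altitude of `Δ_p` from `b_p`. Everything
is determined by the vertices, except for the sign of `m`. -/
structure Butterfly {X : SpaceForm} {n : ℕ} (P : VertexTuple X n) where
  m : X.V n
  nrm : Fin n → X.V n
  b₀ : Fin n → X.V n
  h : Fin n → ℝ
  m_unit : X.form m m = 1
  m_orthogonal : X.Orthogonal P.a m
  nrm_inner : ∀ p, X.IsInnerNormal (fun q : {q : Fin n // q ≠ p} => P.a q) (P.a p) (nrm p)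
  h_pos : ∀ p, 0 < h p
  b₀_mem : ∀ p, b₀ p - h p • nrm p ∈ X.flat (fun q : {q : Fin n // q ≠ p} => P.a q)
  b_eq : ∀ p, ∃ φ : ℝ,
    P.b p = b₀ p + (h p * (Real.cos φ - 1)) • nrm p + (h p * Real.sin φ) • m

namespace Butterfly

variable {X : SpaceForm} {n : ℕ} {P : VertexTuple X n}

/-- The position of the vertices when the dihedral angle `φ_p` between `Δ` and `Δ_p` satisfies
`tan (φ_p / 2) = t_p`: the point `a_p` is fixed and
`b_p(t_p) = b₀_p - 2 h_p t_p² / (t_p² + 1) n_p + 2 h_p t_p / (t_p² + 1) m`. -/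
noncomputable def position (B : Butterfly P) (t : Fin n → OnePoint ℝ) : VertexTuple X n where
  a := P.a
  b p := B.b₀ p
    - (2 * B.h p * homCoord (t p) 0 ^ 2 / (homCoord (t p) 0 ^ 2 + homCoord (t p) 1 ^ 2)) • B.nrm p
    + (2 * B.h p * (homCoord (t p) 0 * homCoord (t p) 1)
        / (homCoord (t p) 0 ^ 2 + homCoord (t p) 1 ^ 2)) • B.m

/-- The configuration space `Ξ(ℓ)`, `ℓ` being the set of edge lengths of `P`: those positions of the
butterfly for which all edges `[b_p b_q]` have the prescribed lengths. -/
def configSpace (B : Butterfly P) : Set (Fin n → OnePoint ℝ) :=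
  {t | ∀ p q, p ≠ q →
    X.distance ((B.position t).b p) ((B.position t).b q) = X.distance (P.b p) (P.b q)}

end Butterfly

/-- `P` is a flexible cross-polytope of type `π`: for `ℓ` the set of edge lengths of `P`, some essential
one-dimensional irreducible component `C` of `Ξ(ℓ)` has type `π`, and an essential flex starting at `P`
runs in `C`. -/
def IsFlexibleOfType {X : SpaceForm} {n : ℕ} (P : VertexTuple X n) (π : n.Partition) : Prop :=
  P.IsCrossPolytope ∧ ∃ (B : Butterfly P) (C : Set (Fin n → OnePoint ℝ)),
    IsIrreducibleComponent B.configSpace C ∧ algebraicDim C = 1 ∧ IsEssentialSubset C ∧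
    HasType C π ∧
    ∃ t : unitInterval → Fin n → OnePoint ℝ, (∀ u, t u ∈ C) ∧ B.position (t 0) = P ∧
      VertexTuple.IsEssentialFlex fun u => B.position (t u)

/-!
The positions of a butterfly are described by the tangents `t_p` of half its dihedral angles. In
these coordinates, each edge `[b_p b_q]` imposes one biquadratic relation between `t_p` and `t_q`
(`CurveData.bracket_tuple`), and the configuration space is the set of solutions of these relations
(`CurveData.configSpace_butterfly`).

*The curve.* The starting point is a rational curve `ξ_p = u_p s - y_p / s` with positive `u_p`,
`y_p`, where `t_p` is `ξ_p` or `1 / ξ_p`. The coordinates `ξ_p` and `ξ_q` are proportional if and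
only if `u_p / y_p = u_q / y_q`; this splits the indices into blocks
(`CurveData.coordProportional_curve_iff`). Any two coordinates satisfy a relation
`ξ_p ξ_q - m_qp ξ_p² - m_pq ξ_q² + e_pq = 0`, which is unique for different blocks and depends on a
free parameter within a block. Within a block the relation is a product of two linear ones; for
three blocks, a product of two trilinear forms vanishes as a consequence of the relations, since
each `ξ_p` determines `s` up to the involution `s ↦ -y_p / (u_p s)`. As only one factor vanishes on
the curve in each case, the curve is an irreducible component of the set of solutions
(`CurveData.isIrreducibleComponent_curve`).

*The butterfly.* The coefficients `m` and `e` determine the Gram matrix `G` of the normals of the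
faces `F_p` in `Δ` and the matrix `V` of the distances from the vertices `b_p` to these faces. Such
a butterfly (`Frame`) exists if certain quantities are positive (`Admissible`), and the sign of
`det G` decides whether it lies in `𝔼ⁿ`, `𝕊ⁿ` or `Λⁿ` (`Admissible.nonempty_frame`).

*The degeneration.* To meet these conditions, the indices are made the vertices of a tree: the
centre of each block is joined to its other members and to the centre of the next block. The numbers
`u_p`, `y_p` are taken to be monomials in a small `ε`, with exponents such that, for `ε → 0`, `V`
tends to the identity matrix and `G` to `1 - θ N`, where `N` is the normalized adjacency matrix of
the tree and `θ` a parameter (`BlockIndexing.gramOf_zero`, `BlockIndexing.vertOf_zero`). By the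
Perron–Frobenius property of `N`, the matrix `1 - N` is positive semidefinite, with kernel spanned
by a positive vector and with positive adjugate matrix. So the limit is admissible near `θ = 1`, and
the determinant changes its sign there. Admissibility being open, all three signs of `det G` occur
for small `ε > 0` (`BlockIndexing.exists_isGood`).

*The flex.* For `s → ∞` all dihedral angles at `Δ` tend to `0` or `π`. In the limit all facets are
non-degenerate, because for the degenerate matrices the distances of their vertices form an
involution (`limitMatrixOf_det_ne_zero`); hence they are non-degenerate for large `s`. The distances
between `a_p` and `b_p` vary strictly monotonically for large `s`, so that no two positions are
congruent; the cosine of each dihedral angle is a non-constant affine function of the bracket of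
some `a_p` and `b_p`, so that the angle is `0` or `π` at most twice
(`CurveData.eventually_not_figureCongruent`, `CurveData.exists_isDihedralAngle`).
-/

/-! ### The scalar product and the bracket -/

namespace SpaceForm

variable {X : SpaceForm} {n : ℕ}

theorem form_comm (x y : X.V n) : X.form x y = X.form y x := by
  cases X
  · exact real_inner_comm _ _
  · exact real_inner_comm _ _
  · simp only [form, mul_comm]

theorem form_add_left (x y z : X.V n) : X.form (x + y) z = X.form x z + X.form y z := by
  cases X
  · exact inner_add_left _ _ _
  · exact inner_add_left _ _ _
  · have h : ∀ i : Fin (n + 1), (x + y) i = x i + y i := fun _ => rfl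
    simp only [form, h, add_mul, Finset.sum_add_distrib]; ring

theorem form_smul_left (c : ℝ) (x z : X.V n) : X.form (c • x) z = c * X.form x z := by
  cases X
  · exact real_inner_smul_left _ _ _
  · exact real_inner_smul_left _ _ _
  · have h : ∀ i : Fin (n + 1), (c • x) i = c * x i := fun _ => rfl
    simp only [form, h, mul_assoc, ← Finset.mul_sum, mul_sub]

/-- The scalar product as a bilinear form in the sense of Mathlib. -/
noncomputable def bilin (X : SpaceForm) (n : ℕ) : X.V n →ₗ[ℝ] X.V n →ₗ[ℝ] ℝ :=
  LinearMap.mk₂ ℝ (fun x y => X.form x y) form_add_left form_smul_left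
    (fun x y z => by rw [form_comm, form_add_left, form_comm y, form_comm z])
    (fun c x y => by rw [form_comm, form_smul_left, form_comm y, smul_eq_mul])

theorem bilin_apply (x y : X.V n) : bilin X n x y = X.form x y := rfl

theorem form_add_right (x y z : X.V n) : X.form x (y + z) = X.form x y + X.form x z := by
  simp only [← bilin_apply, map_add]

theorem form_smul_right (c : ℝ) (x z : X.V n) : X.form x (c • z) = c * X.form x z := by
  simp only [← bilin_apply, map_smul, smul_eq_mul]

theorem form_sub_left (x y z : X.V n) : X.form (x - y) z = X.form x z - X.form y z := by
  simp only [← bilin_apply, map_sub, LinearMap.sub_apply]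

theorem form_sub_right (x y z : X.V n) : X.form x (y - z) = X.form x y - X.form x z := by
  simp only [← bilin_apply, map_sub]

theorem form_zero_left (x : X.V n) : X.form 0 x = 0 := by
  simp only [← bilin_apply, map_zero, LinearMap.zero_apply]

theorem form_sum_left {ι : Type*} (s : Finset ι) (w : ι → ℝ) (c : ι → X.V n) (z : X.V n) :
    X.form (∑ i ∈ s, w i • c i) z = ∑ i ∈ s, w i * X.form (c i) z := by
  simp only [← bilin_apply, map_sum, map_smul, LinearMap.sum_apply, LinearMap.smul_apply,
    smul_eq_mul]

theorem form_sum_right {ι : Type*} (s : Finset ι) (w : ι → ℝ) (c : ι → X.V n) (z : X.V n) :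
    X.form z (∑ i ∈ s, w i • c i) = ∑ i ∈ s, w i * X.form z (c i) := by
  simp only [← bilin_apply, map_sum, map_smul, smul_eq_mul]

theorem form_lobachevsky_eq (x y : lobachevsky.V n) :
    lobachevsky.form x y =
      (∑ i : Fin n, x (Fin.castSucc i) * y (Fin.castSucc i)) - x (Fin.last n) * y (Fin.last n) :=
  rfl

theorem sq_spatial_le (x y : lobachevsky.V n) :
    (∑ i : Fin n, x (Fin.castSucc i) * y (Fin.castSucc i)) ^ 2 ≤
      (∑ i : Fin n, x (Fin.castSucc i) ^ 2) * ∑ i : Fin n, y (Fin.castSucc i) ^ 2 :=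
  Finset.sum_mul_sq_le_sq_mul_sq _ _ _

theorem form_self_lobachevsky (x : lobachevsky.V n) :
    lobachevsky.form x x = (∑ i : Fin n, x (Fin.castSucc i) ^ 2) - x (Fin.last n) ^ 2 := by
  rw [form_lobachevsky_eq]; simp only [sq]

/-- Reversed Cauchy–Schwarz inequality on the upper sheet of the hyperboloid. -/
theorem form_le_neg_one {x y : lobachevsky.V n} (hx : x ∈ lobachevsky.points n)
    (hy : y ∈ lobachevsky.points n) : lobachevsky.form x y ≤ -1 := by
  obtain ⟨hx1, hx2⟩ := hx
  obtain ⟨hy1, hy2⟩ := hy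
  have h := sq_spatial_le x y
  rw [form_self_lobachevsky] at hx1 hy1
  rw [form_lobachevsky_eq]
  set S := ∑ i : Fin n, x (Fin.castSucc i) * y (Fin.castSucc i)
  set A := ∑ i : Fin n, x (Fin.castSucc i) ^ 2
  set B := ∑ i : Fin n, y (Fin.castSucc i) ^ 2
  set a := x (Fin.last n)
  set b := y (Fin.last n)
  have hA : A = a ^ 2 - 1 := by linarith
  have hB : B = b ^ 2 - 1 := by linarith
  rw [hA, hB] at h
  have hA0 : 0 ≤ a ^ 2 - 1 := hA ▸ Finset.sum_nonneg fun _ _ => sq_nonneg _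
  have hB0 : 0 ≤ b ^ 2 - 1 := hB ▸ Finset.sum_nonneg fun _ _ => sq_nonneg _
  have ha : 1 ≤ a := by nlinarith
  have hb : 1 ≤ b := by nlinarith
  have hab : 0 ≤ a * b - 1 := by nlinarith
  have : S ≤ a * b - 1 :=
    (le_abs_self S).trans (abs_le_of_sq_le_sq (by nlinarith [sq_nonneg (a - b)]) hab)
  linarith

/-- A vector of norm `-1` on the same side as a point of the upper sheet lies in the upper sheet. -/
theorem mem_points_of_form_neg {x y : lobachevsky.V n} (hx : x ∈ lobachevsky.points n)
    (hy : lobachevsky.form y y = -1) (hxy : lobachevsky.form x y < 0) :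
    y ∈ lobachevsky.points n := by
  refine ⟨hy, ?_⟩
  by_contra hlast
  have hne : y (Fin.last n) ≠ 0 := by
    intro h0
    rw [form_self_lobachevsky, h0] at hy
    have : 0 ≤ ∑ i : Fin n, y (Fin.castSucc i) ^ 2 := Finset.sum_nonneg fun _ _ => sq_nonneg _
    norm_num at hy
    linarith
  have hneg : -y ∈ lobachevsky.points n := by
    refine ⟨?_, ?_⟩
    · rw [← neg_one_smul ℝ y, form_smul_left, form_smul_right, hy]; norm_num
    · have : y (Fin.last n) < 0 := lt_of_le_of_ne (not_lt.mp hlast) hne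
      exact neg_pos.mpr this
  have := form_le_neg_one hx hneg
  rw [← neg_one_smul ℝ y, form_smul_right] at this
  linarith

/-- The orthogonal complement of a point of the hyperboloid is positive definite. -/
theorem form_self_pos_of_form_eq_zero {x v : lobachevsky.V n} (hx : x ∈ lobachevsky.points n)
    (hv : v ≠ 0) (hxv : lobachevsky.form x v = 0) : 0 < lobachevsky.form v v := by
  obtain ⟨hx1, hx2⟩ := hx
  have h := sq_spatial_le x v
  rw [form_self_lobachevsky] at hx1 ⊢
  rw [form_lobachevsky_eq] at hxv
  have hB0 : 0 ≤ ∑ i : Fin n, v (Fin.castSucc i) ^ 2 := Finset.sum_nonneg fun _ _ => sq_nonneg _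
  by_contra hcon
  have hS : (∑ i : Fin n, x (Fin.castSucc i) * v (Fin.castSucc i)) =
      x (Fin.last n) * v (Fin.last n) := by linarith
  rw [hS] at h
  have hA : (∑ i : Fin n, x (Fin.castSucc i) ^ 2) = x (Fin.last n) ^ 2 - 1 := by linarith
  rw [hA] at h
  have hA0 : 0 ≤ x (Fin.last n) ^ 2 - 1 := hA ▸ Finset.sum_nonneg fun _ _ => sq_nonneg _
  have hB : (∑ i : Fin n, v (Fin.castSucc i) ^ 2) = 0 := by nlinarith
  have hl : v (Fin.last n) = 0 := by
    rw [hB] at h hcon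
    have h2 : (x (Fin.last n) * v (Fin.last n)) ^ 2 = 0 :=
      le_antisymm (by linarith) (sq_nonneg _)
    rcases mul_eq_zero.mp (pow_eq_zero_iff (two_ne_zero)|>.mp h2) with h3 | h3
    · exact absurd h3 hx2.ne'
    · exact h3
  apply hv
  have hz := (Finset.sum_eq_zero_iff_of_nonneg fun _ _ => sq_nonneg _).mp hB
  refine PiLp.ext fun i => ?_
  refine Fin.lastCases ?_ (fun j => ?_) i
  · exact hl
  · exact pow_eq_zero_iff (two_ne_zero)|>.mp (hz j (Finset.mem_univ j))

/-- A substitute for the scalar product of two points that is invariant under all isometries: the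
scalar product itself for `𝕊ⁿ` and `Λⁿ`, and `-dist² / 2` for `𝔼ⁿ`. -/
noncomputable def bracket : (X : SpaceForm) → {n : ℕ} → X.V n → X.V n → ℝ
  | euclidean, _, x, y => -(dist x y ^ 2) / 2
  | spherical, _, x, y => form spherical x y
  | lobachevsky, _, x, y => form lobachevsky x y

theorem bracket_comm (x y : X.V n) : X.bracket x y = X.bracket y x := by
  cases X
  · simp only [bracket, dist_comm]
  · exact form_comm (X := spherical) _ _
  · exact form_comm (X := lobachevsky) _ _

theorem bracket_euclidean (x y : euclidean.V n) :
    euclidean.bracket x y = -(euclidean.form (x - y) (x - y)) / 2 := by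
  simp only [bracket, form, dist_eq_norm, real_inner_self_eq_norm_sq]

theorem bracket_self {x y : X.V n} (hx : x ∈ X.points n) (hy : y ∈ X.points n) :
    X.bracket x x = X.bracket y y := by
  cases X
  · simp [bracket]
  · simp only [bracket, form, real_inner_self_eq_norm_sq]
    simp only [points, mem_sphere_zero_iff_norm] at hx hy
    rw [hx, hy]
  · exact hx.1.trans hy.1.symm

/-- Distances determine brackets and vice versa. -/
theorem distance_eq_iff {x y x' y' : X.V n} (hx : x ∈ X.points n) (hy : y ∈ X.points n)
    (hx' : x' ∈ X.points n) (hy' : y' ∈ X.points n) :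
    X.distance x y = X.distance x' y' ↔ X.bracket x y = X.bracket x' y' := by
  cases X
  · simp only [distance, bracket]
    constructor
    · intro h; rw [h]
    · intro h
      have : dist x y ^ 2 = dist x' y' ^ 2 := by linarith
      exact (pow_left_inj₀ dist_nonneg dist_nonneg two_ne_zero).mp this
  · simp only [distance, bracket]
    simp only [points, mem_sphere_zero_iff_norm] at hx hy hx' hy'
    have key : ∀ a b : spherical.V n, ‖a‖ = 1 → ‖b‖ = 1 →
        form spherical a b ∈ Set.Icc (-1 : ℝ) 1 := by
      intro a b ha hb
      have := abs_real_inner_le_norm a b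
      rw [ha, hb, mul_one] at this
      exact abs_le.mp this
    exact Real.arccos_injOn.eq_iff (key _ _ hx hy) (key _ _ hx' hy')
  · simp only [distance, bracket]
    rw [Real.arcosh_injOn.eq_iff, neg_inj]
    · exact Set.mem_Ici.mpr (by linarith [form_le_neg_one hx hy])
    · exact Set.mem_Ici.mpr (by linarith [form_le_neg_one hx' hy'])

/-! ### Normals of facets as linear combinations of vertices -/

/-- Coefficients of the linear combinations of points of `𝕏ⁿ` that are tangent vectors: in the
Euclidean case their sum has to vanish. -/
def Balanced {ι : Type} [Fintype ι] : SpaceForm → (ι → ℝ) → Prop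
  | euclidean, w => ∑ i, w i = 0
  | spherical, _ => True
  | lobachevsky, _ => True

/-- Scalar products of tangent vectors can be computed from the distances between the points that
span them. -/
theorem form_sum_smul_sum_smul {ι : Type} [Fintype ι] {w w' : ι → ℝ} (hw : X.Balanced w)
    (hw' : X.Balanced w') (c c' : ι → X.V n) :
    X.form (∑ i, w i • c i) (∑ j, w' j • c' j) = ∑ i, ∑ j, w i * w' j * X.bracket (c i) (c' j) := by
  have expand : X.form (∑ i, w i • c i) (∑ j, w' j • c' j) =
      ∑ i, ∑ j, w i * w' j * X.form (c i) (c' j) := by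
    rw [form_sum_left]
    refine Finset.sum_congr rfl fun i _ => ?_
    rw [form_sum_right, Finset.mul_sum]
    exact Finset.sum_congr rfl fun j _ => by ring
  rw [expand]
  cases X
  · -- `-|x - y|² / 2 = (x, y) - |x|² / 2 - |y|² / 2`, and the last two terms cancel after summation
    have h : ∀ i j, w i * w' j * bracket euclidean (c i) (c' j) =
        w i * w' j * form euclidean (c i) (c' j)
          - (w i * form euclidean (c i) (c i) / 2) * w' j
          - w i * (w' j * form euclidean (c' j) (c' j) / 2) := by
      intro i j
      rw [bracket_euclidean]
      simp only [form_sub_left, form_sub_right]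
      rw [form_comm (c' j) (c i)]; ring
    simp only [h, Finset.sum_sub_distrib, ← Finset.mul_sum, ← Finset.sum_mul]
    simp only [Balanced] at hw hw'
    rw [hw, hw']; ring
  · rfl
  · rfl

/-- `w` are the coefficients of a unit vector `∑ i, w i • c i` that is orthogonal to all vertices
`c q`, `q ≠ p`, and lies on the side of `c p`. Everything is expressed through brackets, so that the
same coefficients serve for all simplices that are congruent to a given one. -/
structure IsNormalWeight (X : SpaceForm) {n k : ℕ} (c : Fin k → X.V n) (p : Fin k)
    (w : Fin k → ℝ) : Prop where
  balanced : X.Balanced w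
  pos : 0 < w p
  unit : ∑ i, ∑ j, w i * w j * X.bracket (c i) (c j) = 1
  orthogonal : ∀ v : Fin k → ℝ, X.Balanced v → v p = 0 →
    ∑ i, ∑ j, v i * w j * X.bracket (c i) (c j) = 0

theorem IsNormalWeight.congr {k : ℕ} {c c' : Fin k → X.V n} {p : Fin k} {w : Fin k → ℝ}
    (h : X.IsNormalWeight c p w) (hc : ∀ i j, X.bracket (c i) (c j) = X.bracket (c' i) (c' j)) :
    X.IsNormalWeight c' p w where
  balanced := h.balanced
  pos := h.pos
  unit := by simpa only [hc] using h.unit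
  orthogonal := by simpa only [hc] using h.orthogonal

/-- Coefficients of linear combinations of points that lie in the flat spanned by the points: in the
Euclidean case their sum has to be `1`. -/
def Normalized {ι : Type} [Fintype ι] : SpaceForm → (ι → ℝ) → Prop
  | euclidean, w => ∑ i, w i = 1
  | spherical, _ => True
  | lobachevsky, _ => True

theorem sum_smul_mem_flat {k : ℕ} {c : Fin k → X.V n} {p : Fin k} {v : Fin k → ℝ}
    (hv : X.Normalized v) (hvp : v p = 0) :
    ∑ i, v i • c i ∈ X.flat (fun q : {q : Fin k // q ≠ p} => c q) := by
  have hsub : ∀ {M : Type} [AddCommMonoid M] (g : Fin k → M), g p = 0 →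
      ∑ i, g i = ∑ i : {q : Fin k // q ≠ p}, g i := by
    intro M _ g hg
    rw [← Finset.sum_subtype (Finset.univ.erase p) (by simp) g]
    exact (Finset.sum_erase _ hg).symm
  rw [hsub _ (by rw [hvp, zero_smul])]
  have hlin : ∑ i : {q : Fin k // q ≠ p}, v i • c i ∈
      Submodule.span ℝ (Set.range fun q : {q : Fin k // q ≠ p} => c q) :=
    Submodule.sum_mem _ fun i _ => Submodule.smul_mem _ _ (Submodule.subset_span ⟨i, rfl⟩)
  cases X
  · have h1 : ∑ i : {q : Fin k // q ≠ p}, v i = 1 := by rw [← hsub v hvp]; exact hv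
    have := affineCombination_mem_affineSpan (k := ℝ) (s := Finset.univ)
      (w := fun i : {q : Fin k // q ≠ p} => v i) h1 (fun q : {q : Fin k // q ≠ p} => c q)
    rwa [Finset.affineCombination_eq_linear_combination _ _ _ h1] at this
  · exact hlin
  · exact hlin

theorem IsNormalWeight.isInnerNormal {k : ℕ} {c : Fin k → X.V n} {p : Fin k} {w : Fin k → ℝ}
    (h : X.IsNormalWeight c p w) :
    X.IsInnerNormal (fun q : {q : Fin k // q ≠ p} => c q) (c p) (∑ i, w i • c i) := by
  have horth : ∀ v : Fin k → ℝ, X.Balanced v → v p = 0 →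
      X.form (∑ i, v i • c i) (∑ i, w i • c i) = 0 := fun v hv hvp => by
    rw [form_sum_smul_sum_smul hv h.balanced]; exact h.orthogonal v hv hvp
  refine ⟨by rw [form_sum_smul_sum_smul h.balanced h.balanced]; exact h.unit, ?_, (w p)⁻¹,
    inv_pos.mpr h.pos, ?_⟩
  · have hs : ∀ q : Fin k, c q = ∑ i, (Pi.single q (1 : ℝ) : Fin k → ℝ) i • c i := fun q => by
      simp [Pi.single_apply]
    cases X
    · rintro ⟨q, hq⟩ ⟨r, hr⟩
      have := horth (Pi.single q 1 - Pi.single r 1) (by simp [Balanced])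
        (by simp [hq.symm, hr.symm])
      simpa only [Pi.sub_apply, sub_smul, Finset.sum_sub_distrib, ← hs] using this
    · rintro ⟨q, hq⟩
      have := horth (Pi.single q 1) trivial (by simp [hq.symm])
      rwa [← hs] at this
    · rintro ⟨q, hq⟩
      have := horth (Pi.single q 1) trivial (by simp [hq.symm])
      rwa [← hs] at this
  · have hsum : c p - (w p)⁻¹ • ∑ i, w i • c i =
        ∑ i, ((Pi.single p 1 - (w p)⁻¹ • w : Fin k → ℝ) i) • c i := by
      simp [Pi.single_apply, sub_smul, Finset.sum_sub_distrib, Finset.smul_sum, smul_smul]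
    rw [hsum]
    refine sum_smul_mem_flat ?_ (by simp [h.pos.ne'])
    have := h.balanced
    cases X
    · simp only [Balanced] at this
      simp [Normalized, Finset.sum_sub_distrib, ← Finset.mul_sum, this]
    · trivial
    · trivial

/-- Non-zero tangent vectors have positive squares. Only in `Λⁿ` is tangency needed. -/
theorem form_self_pos {x : X.V n} {v : X.V n} (hx : x ∈ X.points n) (hv : v ≠ 0)
    (hxv : X = lobachevsky → X.form x v = 0) : 0 < X.form v v := by
  cases X
  · exact real_inner_self_pos.mpr hv
  · exact real_inner_self_pos.mpr hv
  · exact form_self_pos_of_form_eq_zero hx hv (hxv rfl)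

/-- Every vertex of a non-degenerate simplex has a normal weight. -/
theorem exists_isNormalWeight {k : ℕ} {c : Fin k → X.V n} {p r₀ : Fin k} (hr₀ : r₀ ≠ p)
    (hpt : ∀ q, c q ∈ X.points n) (hgp : X.GeneralPosition c) :
    ∃ w, X.IsNormalWeight c p w := by
  -- a balanced combination of the vertices that is orthogonal to the facet opposite to `c p`: these
  -- are `k - 1` linear conditions on `k` coefficients
  obtain ⟨w, hw0, hwb, hworth⟩ : ∃ w : Fin k → ℝ, w ≠ 0 ∧ X.Balanced w ∧
      ∀ v : Fin k → ℝ, X.Balanced v → v p = 0 →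
        X.form (∑ i, v i • c i) (∑ i, w i • c i) = 0 := by
    have hcard : Module.finrank ℝ ({q : Fin k // q ≠ p} → ℝ) < Module.finrank ℝ (Fin k → ℝ) := by
      rw [Module.finrank_fintype_fun_eq_card, Module.finrank_fintype_fun_eq_card]
      exact Fintype.card_subtype_lt (x := p) (by simp)
    let comb : (Fin k → ℝ) →ₗ[ℝ] X.V n := Fintype.linearCombination ℝ c
    have hcomb : ∀ w, comb w = ∑ i, w i • c i := fun w => by
      simp [comb, Fintype.linearCombination_apply]
    let L₁ : (Fin k → ℝ) →ₗ[ℝ] ({q : Fin k // q ≠ p} → ℝ) :=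
      LinearMap.pi fun q => (bilin X n (c q)).comp comb
    let L₂ : (Fin k → ℝ) →ₗ[ℝ] ({q : Fin k // q ≠ p} → ℝ) :=
      LinearMap.pi fun q => if (q : Fin k) = r₀ then ∑ i, LinearMap.proj i
        else (bilin X n (c q - c r₀)).comp comb
    have hex : ∀ L : (Fin k → ℝ) →ₗ[ℝ] ({q : Fin k // q ≠ p} → ℝ),
        ∃ w : Fin k → ℝ, w ≠ 0 ∧ L w = 0 := by
      intro L
      have h := LinearMap.ker_ne_bot_of_finrank_lt (f := L) hcard
      obtain ⟨w, hw, hw0⟩ := Submodule.exists_mem_ne_zero_of_ne_bot h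
      exact ⟨w, hw0, hw⟩
    have hlin : ∀ w, L₁ w = 0 → ∀ v : Fin k → ℝ, v p = 0 →
        X.form (∑ i, v i • c i) (∑ i, w i • c i) = 0 := by
      intro w hw v hv
      rw [form_sum_left]
      refine Finset.sum_eq_zero fun i _ => ?_
      by_cases hi : i = p
      · rw [hi, hv, zero_mul]
      · have := congrFun hw ⟨i, hi⟩
        simp only [L₁, LinearMap.pi_apply, LinearMap.comp_apply, hcomb, bilin_apply,
          Pi.zero_apply] at this
        rw [this, mul_zero]
    cases X
    · obtain ⟨w, hw0, hw⟩ := hex L₂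
      have hsum : ∑ i, w i = 0 := by
        have := congrFun hw ⟨r₀, hr₀⟩
        simpa [L₂] using this
      refine ⟨w, hw0, hsum, fun v hvb hvp => ?_⟩
      have hvb' : ∑ i, v i = 0 := hvb
      have hv : ∑ i, v i • c i = ∑ i, v i • (c i - c r₀) := by
        simp only [smul_sub, Finset.sum_sub_distrib, ← Finset.sum_smul, hvb', zero_smul, sub_zero]
      rw [hv, form_sum_left]
      refine Finset.sum_eq_zero fun i _ => ?_
      by_cases hi : i = p
      · rw [hi, hvp, zero_mul]
      by_cases hi' : i = r₀
      · rw [hi', sub_self, form_zero_left, mul_zero]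
      · have := congrFun hw ⟨i, hi⟩
        simp only [L₂, LinearMap.pi_apply, if_neg hi', LinearMap.comp_apply, hcomb, bilin_apply,
          Pi.zero_apply] at this
        rw [this, mul_zero]
    · obtain ⟨w, hw0, hw⟩ := hex L₁
      exact ⟨w, hw0, trivial, fun v _ => hlin w hw v⟩
    · obtain ⟨w, hw0, hw⟩ := hex L₁
      exact ⟨w, hw0, trivial, fun v _ => hlin w hw v⟩
  have hindep : ∀ v : Fin k → ℝ, X.Balanced v → ∑ i, v i • c i = 0 → v = 0 := by
    intro v hvb hv
    cases X
    · have h := (affineIndependent_iff (k := ℝ) (p := c)).mp hgp Finset.univ v hvb hv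
      exact funext fun i => h i (Finset.mem_univ i)
    · exact funext (Fintype.linearIndependent_iff.mp hgp v hv)
    · exact funext (Fintype.linearIndependent_iff.mp hgp v hv)
  have hμ0 : ∑ i, w i • c i ≠ 0 := fun h => hw0 (hindep w hwb h)
  have hpos : 0 < X.form (∑ i, w i • c i) (∑ i, w i • c i) := by
    refine form_self_pos (hpt r₀) hμ0 fun hX => ?_
    subst hX
    have := hworth (Pi.single r₀ 1) trivial (by simp [hr₀.symm])
    simpa [Pi.single_apply] using this
  have hwp : w p ≠ 0 := fun h => hpos.ne' (hworth w hwb h)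
  set N := X.form (∑ i, w i • c i) (∑ i, w i • c i)
  -- the sign is chosen such that the coefficient of `c p` becomes positive
  set a : ℝ := SignType.sign (w p) * (Real.sqrt N)⁻¹ with ha
  have hs2 : ((SignType.sign (w p) : ℝ)) ^ 2 = 1 := by
    rcases lt_or_gt_of_ne hwp with h | h
    · simp [sign_neg h]
    · simp [sign_pos h]
  have hbal : X.Balanced (a • w) := by
    cases X
    · simp only [Balanced] at hwb ⊢
      simp [← Finset.mul_sum, hwb]
    · trivial
    · trivial
  have hsm : ∑ i, (a • w) i • c i = a • ∑ i, w i • c i := by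
    simp [Finset.smul_sum, smul_smul]
  refine ⟨a • w, hbal, ?_, ?_, ?_⟩
  · have : (a • w) p = |w p| * (Real.sqrt N)⁻¹ := by
      rw [Pi.smul_apply, smul_eq_mul, ha, ← sign_mul_self (w p)]; ring
    rw [this]
    have := abs_pos.mpr hwp
    have := Real.sqrt_pos.mpr hpos
    positivity
  · rw [← form_sum_smul_sum_smul hbal hbal, hsm, form_smul_left, form_smul_right]
    have h1 : a * (a * N) = (SignType.sign (w p) : ℝ) ^ 2 * (N * ((Real.sqrt N)⁻¹) ^ 2) := by
      rw [ha]; ring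
    rw [h1, hs2, inv_pow, Real.sq_sqrt hpos.le, mul_inv_cancel₀ hpos.ne', one_mul]
  · intro v hvb hvp
    rw [← form_sum_smul_sum_smul hvb hbal, hsm, form_smul_right, hworth v hvb hvp, mul_zero]

/-- Unit vectors tangent to `𝕏ⁿ` at one of its points satisfy the Cauchy–Schwarz inequality. -/
theorem abs_form_le_one {x μ ν : X.V n} (hx : x ∈ X.points n) (hμ : X.form μ μ = 1)
    (hν : X.form ν ν = 1) (hxμ : X = lobachevsky → X.form x μ = 0)
    (hxν : X = lobachevsky → X.form x ν = 0) : |X.form μ ν| ≤ 1 := by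
  have key : ∀ s : ℝ, s ^ 2 = 1 → 0 ≤ 2 + 2 * s * X.form μ ν := by
    intro s hs
    have hexp : X.form (μ + s • ν) (μ + s • ν) = 2 + 2 * s * X.form μ ν := by
      simp only [form_add_left, form_add_right, form_smul_left, form_smul_right, hμ, hν]
      rw [form_comm ν μ]; linear_combination hs
    rw [← hexp]
    by_cases h0 : μ + s • ν = 0
    · rw [h0, form_zero_left]
    · refine (form_self_pos hx h0 fun hX => ?_).le
      rw [form_add_right, form_smul_right, hxμ hX, hxν hX]; ring
  have h1 := key 1 (by norm_num)
  have h2 := key (-1) (by norm_num)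
  exact abs_le.mpr ⟨by linarith, by linarith⟩

end SpaceForm

/-! ### Algebraic subsets of `(ℝP¹)ⁿ` -/

/-- The point of `ℝ ∪ {∞}` with homogeneous coordinates `(x : y)`. -/
noncomputable def projPoint (x y : ℝ) : OnePoint ℝ :=
  open Classical in if y = 0 then OnePoint.infty else ((x / y : ℝ) : OnePoint ℝ)

theorem homCoord_infty : homCoord OnePoint.infty = ![1, 0] := rfl

theorem homCoord_coe (s : ℝ) : homCoord (s : OnePoint ℝ) = ![s, 1] := rfl

theorem homCoord_sq_pos (t : OnePoint ℝ) : 0 < homCoord t 0 ^ 2 + homCoord t 1 ^ 2 := by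
  induction t using OnePoint.rec with
  | infty => simp [homCoord_infty]
  | coe s => simp only [homCoord_coe, Matrix.cons_val_zero, Matrix.cons_val_one]; positivity

/-- Points of `ℝ ∪ {∞}` are determined by the ratio of their homogeneous coordinates. -/
theorem eq_of_homCoord {t t' : OnePoint ℝ}
    (h : homCoord t 0 * homCoord t' 1 = homCoord t 1 * homCoord t' 0) : t = t' := by
  induction t using OnePoint.rec with
  | infty =>
    induction t' using OnePoint.rec with
    | infty => rfl
    | coe s' => simp [homCoord_infty, homCoord_coe] at h
  | coe s =>
    induction t' using OnePoint.rec with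
    | infty => simp [homCoord_infty, homCoord_coe] at h
    | coe s' => simpa [homCoord_coe] using h

theorem exists_homCoord_projPoint {x y : ℝ} (h : x ≠ 0 ∨ y ≠ 0) :
    ∃ c : ℝ, c ≠ 0 ∧ x = c * homCoord (projPoint x y) 0 ∧ y = c * homCoord (projPoint x y) 1 := by
  by_cases hy : y = 0
  · refine ⟨x, h.resolve_right (not_not.mpr hy), ?_, ?_⟩ <;>
      simp [projPoint, hy, homCoord_infty]
  · refine ⟨y, hy, ?_, ?_⟩ <;> simp [projPoint, hy, homCoord_coe]
    field_simp

section Algebraic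

variable {n : ℕ}

theorem isAlgebraicSubset_iInter {ι : Sort*} {Z : ι → Set (Fin n → OnePoint ℝ)}
    (h : ∀ i, IsAlgebraicSubset (Z i)) : IsAlgebraicSubset (⋂ i, Z i) := by
  choose S hS hZ using h
  refine ⟨⋃ i, S i, fun f hf => ?_, ?_⟩
  · obtain ⟨i, hi⟩ := Set.mem_iUnion.mp hf
    exact hS i f hi
  · ext t
    simp only [hZ, Set.mem_iInter, Set.mem_ofPred_eq, Set.mem_iUnion]
    exact ⟨fun h f ⟨i, hi⟩ => h i f hi, fun h i f hi => h f ⟨i, hi⟩⟩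

theorem isAlgebraicSubset_inter {Z Z' : Set (Fin n → OnePoint ℝ)}
    (h : IsAlgebraicSubset Z) (h' : IsAlgebraicSubset Z') : IsAlgebraicSubset (Z ∩ Z') := by
  rw [Set.inter_eq_iInter]
  exact isAlgebraicSubset_iInter fun b => by cases b <;> assumption

theorem IsMultihomogeneous.isAlgebraicSubset {f : MvPolynomial (Fin n × Fin 2) ℝ} {d : Fin n → ℕ}
    (hf : IsMultihomogeneous f d) :
    IsAlgebraicSubset {t | MvPolynomial.eval (fun i => homCoord (t i.1) i.2) f = 0} :=
  ⟨{f}, fun _ hg => ⟨d, hg ▸ hf⟩, by simp⟩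

theorem isMultihomogeneous_X (p : Fin n) (j : Fin 2) :
    IsMultihomogeneous (MvPolynomial.X (p, j)) (Pi.single p 1) :=
  MvPolynomial.isWeightedHomogeneous_X _ _ _

theorem IsMultihomogeneous.mul {f g : MvPolynomial (Fin n × Fin 2) ℝ} {d e : Fin n → ℕ}
    (hf : IsMultihomogeneous f d) (hg : IsMultihomogeneous g e) :
    IsMultihomogeneous (f * g) (d + e) :=
  MvPolynomial.IsWeightedHomogeneous.mul hf hg

theorem IsMultihomogeneous.add {f g : MvPolynomial (Fin n × Fin 2) ℝ} {d : Fin n → ℕ}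
    (hf : IsMultihomogeneous f d) (hg : IsMultihomogeneous g d) : IsMultihomogeneous (f + g) d :=
  MvPolynomial.IsWeightedHomogeneous.add hf hg

theorem IsMultihomogeneous.C_mul {f : MvPolynomial (Fin n × Fin 2) ℝ} {d : Fin n → ℕ} (c : ℝ)
    (hf : IsMultihomogeneous f d) : IsMultihomogeneous (MvPolynomial.C c * f) d := by
  have := (MvPolynomial.isWeightedHomogeneous_C (R := ℝ)
    (fun i : Fin n × Fin 2 => (Pi.single i.1 1 : Fin n → ℕ)) c).mul hf
  rwa [zero_add] at this

theorem IsMultihomogeneous.sum {ι : Type*} [Fintype ι] {f : ι → MvPolynomial (Fin n × Fin 2) ℝ}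
    {d : Fin n → ℕ} (hf : ∀ i, IsMultihomogeneous (f i) d) : IsMultihomogeneous (∑ i, f i) d :=
  MvPolynomial.IsWeightedHomogeneous.sum _ _ _ fun i _ => hf i

/-- Homogeneous coordinates of `t` (if `b` is false) or of `1 / t` (if `b` is true). -/
def xiCoord (b : Bool) (t : OnePoint ℝ) (j : Fin 2) : ℝ := homCoord t (if b then Fin.rev j else j)

theorem xiCoord_false (t : OnePoint ℝ) (j : Fin 2) : xiCoord false t j = homCoord t j := rfl

theorem xiCoord_true_zero (t : OnePoint ℝ) : xiCoord true t 0 = homCoord t 1 := rfl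

theorem xiCoord_true_one (t : OnePoint ℝ) : xiCoord true t 1 = homCoord t 0 := rfl

/-- The zero set of a form of degree one in each of two pairs of coordinates. -/
theorem isAlgebraicSubset_bilinear (χ : Fin n → Bool) (p q : Fin n) (a : Fin 2 → Fin 2 → ℝ) :
    IsAlgebraicSubset {t : Fin n → OnePoint ℝ |
      ∑ i, ∑ j, a i j * (xiCoord (χ p) (t p) i * xiCoord (χ q) (t q) j) = 0} := by
  have h := IsMultihomogeneous.sum fun i =>
      IsMultihomogeneous.sum fun j =>
        ((isMultihomogeneous_X p (if χ p then Fin.rev i else i)).mul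
          (isMultihomogeneous_X q (if χ q then Fin.rev j else j))).C_mul (a i j)
  convert! h.isAlgebraicSubset using 3
  simp [xiCoord]

/-- The zero set of a form of degree one in each of three pairs of coordinates. -/
theorem isAlgebraicSubset_trilinear (χ : Fin n → Bool) (p q r : Fin n)
    (a : Fin 2 → Fin 2 → Fin 2 → ℝ) :
    IsAlgebraicSubset {t : Fin n → OnePoint ℝ | ∑ i, ∑ j, ∑ k, a i j k *
      (xiCoord (χ p) (t p) i * xiCoord (χ q) (t q) j * xiCoord (χ r) (t r) k) = 0} := by
  have h := IsMultihomogeneous.sum fun i =>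
      IsMultihomogeneous.sum fun j =>
        IsMultihomogeneous.sum fun k =>
          (((isMultihomogeneous_X p (if χ p then Fin.rev i else i)).mul
            (isMultihomogeneous_X q (if χ q then Fin.rev j else j))).mul
            (isMultihomogeneous_X r (if χ r then Fin.rev k else k))).C_mul (a i j k)
  convert! h.isAlgebraicSubset using 3
  simp [xiCoord]

/-- The zero set of a form of degree two in each of two pairs of coordinates. -/
theorem isAlgebraicSubset_biquadratic (χ : Fin n → Bool) (p q : Fin n)
    (a : Fin 2 → Fin 2 → Fin 2 → Fin 2 → ℝ) :
    IsAlgebraicSubset {t : Fin n → OnePoint ℝ | ∑ i, ∑ j, ∑ k, ∑ l, a i j k l *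
      (xiCoord (χ p) (t p) i * xiCoord (χ p) (t p) j *
        (xiCoord (χ q) (t q) k * xiCoord (χ q) (t q) l)) = 0} := by
  have h := IsMultihomogeneous.sum fun i =>
      IsMultihomogeneous.sum fun j =>
        IsMultihomogeneous.sum fun k =>
          IsMultihomogeneous.sum fun l =>
            (((isMultihomogeneous_X p (if χ p then Fin.rev i else i)).mul
              (isMultihomogeneous_X p (if χ p then Fin.rev j else j))).mul
              ((isMultihomogeneous_X q (if χ q then Fin.rev k else k)).mul
              (isMultihomogeneous_X q (if χ q then Fin.rev l else l)))).C_mul (a i j k l)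
  convert! h.isAlgebraicSubset using 3
  simp [xiCoord]

theorem isAlgebraicSubset_singleton (t₀ : Fin n → OnePoint ℝ) :
    IsAlgebraicSubset {t₀} := by
  have h : IsAlgebraicSubset (⋂ p : Fin n, {t : Fin n → OnePoint ℝ |
      MvPolynomial.eval (fun i => homCoord (t i.1) i.2)
        (MvPolynomial.C (homCoord (t₀ p) 1) * MvPolynomial.X (p, 0) +
          MvPolynomial.C (-homCoord (t₀ p) 0) * MvPolynomial.X (p, 1)) = 0}) :=
    isAlgebraicSubset_iInter fun p => IsMultihomogeneous.isAlgebraicSubset (d := Pi.single p 1)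
      (((isMultihomogeneous_X p 0).C_mul _).add ((isMultihomogeneous_X p 1).C_mul _))
  convert h using 1
  ext t
  simp only [Set.mem_singleton_iff, Set.mem_iInter, Set.mem_ofPred_eq, map_add, map_mul,
    MvPolynomial.eval_C, MvPolynomial.eval_X]
  constructor
  · rintro rfl p
    ring
  · intro h
    exact funext fun p => eq_of_homCoord (by linear_combination h p)

/-- Rescaling the pairs of homogeneous coordinates multiplies the value of a multihomogeneous
polynomial by a monomial in the scaling factors. -/
theorem IsMultihomogeneous.eval_mul {f : MvPolynomial (Fin n × Fin 2) ℝ} {d : Fin n → ℕ}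
    (hf : IsMultihomogeneous f d) (c : Fin n → ℝ) (x : Fin n × Fin 2 → ℝ) :
    MvPolynomial.eval (fun i => c i.1 * x i) f =
      (∏ p, c p ^ d p) * MvPolynomial.eval x f := by
  rw [MvPolynomial.eval_eq, MvPolynomial.eval_eq, Finset.mul_sum]
  refine Finset.sum_congr rfl fun m hm => ?_
  have hw := hf (MvPolynomial.mem_support_iff.mp hm)
  have hd : ∀ p, d p = m (p, 0) + m (p, 1) := by
    intro p
    rw [← hw, Finsupp.weight_apply, Finsupp.sum_fintype _ _ (by simp), Finset.sum_apply,
      Fintype.sum_prod_type]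
    simp [Pi.single_apply, Fin.sum_univ_two]
  have hprod : ∀ g : Fin n × Fin 2 → ℝ, ∏ i ∈ m.support, g i ^ m i = ∏ i, g i ^ m i := fun g =>
    Finset.prod_subset (Finset.subset_univ _) fun i _ hi => by
      rw [Finsupp.notMem_support_iff.mp hi, pow_zero]
  rw [hprod, hprod]
  simp only [mul_pow, Finset.prod_mul_distrib]
  have : ∏ i : Fin n × Fin 2, c i.1 ^ m i = ∏ p, c p ^ d p := by
    rw [Fintype.prod_prod_type]
    exact Finset.prod_congr rfl fun p _ => by rw [Fin.prod_univ_two, hd, pow_add]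
  rw [this]; ring

/-- An algebraic set that does not contain a rationally parametrized curve meets it in finitely many
points. -/
theorem IsAlgebraicSubset.range_subset_or_finite {γ : ℝ → Fin n → OnePoint ℝ}
    (P : Fin n × Fin 2 → Polynomial ℝ)
    (hγ : ∀ s p, ∃ c : ℝ, c ≠ 0 ∧ ∀ j, (P (p, j)).eval s = c * homCoord (γ s p) j)
    {Z : Set (Fin n → OnePoint ℝ)} (hZ : IsAlgebraicSubset Z) :
    Set.range γ ⊆ Z ∨ (Set.range γ ∩ Z).Finite := by
  obtain ⟨S, hS, rfl⟩ := hZ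
  have key : ∀ f ∈ S, ∀ s, MvPolynomial.eval (fun i => homCoord (γ s i.1) i.2) f = 0 ↔
      (MvPolynomial.aeval P f).eval s = 0 := by
    intro f hf s
    obtain ⟨d, hd⟩ := hS f hf
    choose c hc0 hc using hγ s
    have h1 : (MvPolynomial.aeval P f).eval s = MvPolynomial.eval (fun i => (P i).eval s) f := by
      rw [← Polynomial.coe_evalRingHom, MvPolynomial.map_aeval]
      have : (Polynomial.evalRingHom s).comp (algebraMap ℝ (Polynomial ℝ)) = RingHom.id ℝ := by
        ext; simp
      rw [this]
      rfl
    have h2 : (fun i : Fin n × Fin 2 => (P i).eval s) =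
        fun i => c i.1 * homCoord (γ s i.1) i.2 := funext fun i => hc i.1 i.2
    rw [h1, h2, hd.eval_mul c fun i => homCoord (γ s i.1) i.2, mul_eq_zero]
    have : ∏ p, c p ^ d p ≠ 0 := Finset.prod_ne_zero_iff.mpr fun p _ => pow_ne_zero _ (hc0 p)
    simp [this]
  by_cases hall : ∀ f ∈ S, MvPolynomial.aeval P f = 0
  · left
    rintro _ ⟨s, rfl⟩ f hf
    rw [key f hf s, hall f hf, Polynomial.eval_zero]
  · right
    push Not at hall
    obtain ⟨f, hf, hne⟩ := hall
    refine Set.Finite.subset ((Polynomial.finite_setOfPred_isRoot hne).image γ) ?_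
    rintro _ ⟨⟨s, rfl⟩, hs⟩
    exact ⟨s, (key f hf s).mp (hs f hf), rfl⟩

/-- An infinite algebraic set all of whose proper algebraic subsets are finite is an irreducible
curve. -/
theorem isIrreducibleAlgebraic_of_subset_or_finite {C : Set (Fin n → OnePoint ℝ)}
    (hC : IsAlgebraicSubset C) (hinf : C.Infinite)
    (h : ∀ Z, IsAlgebraicSubset Z → C ⊆ Z ∨ (C ∩ Z).Finite) : IsIrreducibleAlgebraic C := by
  refine ⟨hC, hinf.nonempty, fun Z₁ Z₂ h₁ h₂ hsub => ?_⟩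
  rcases h Z₁ h₁ with h1 | h1
  · exact Or.inl h1
  rcases h Z₂ h₂ with h2 | h2
  · exact Or.inr h2
  refine absurd ((h1.union h2).subset ?_) hinf
  intro t ht
  exact (hsub ht).imp (fun h => ⟨ht, h⟩) fun h => ⟨ht, h⟩

theorem isAlgebraicSubset_union {Z Z' : Set (Fin n → OnePoint ℝ)}
    (h : IsAlgebraicSubset Z) (h' : IsAlgebraicSubset Z') : IsAlgebraicSubset (Z ∪ Z') := by
  obtain ⟨S, hS, rfl⟩ := h
  obtain ⟨S', hS', rfl⟩ := h'
  refine ⟨Set.image2 (· * ·) S S', ?_, ?_⟩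
  · rintro _ ⟨f, hf, g, hg, rfl⟩
    obtain ⟨d, hd⟩ := hS f hf
    obtain ⟨e, he⟩ := hS' g hg
    exact ⟨d + e, hd.mul he⟩
  · ext t
    simp only [Set.mem_union, Set.mem_ofPred_eq, Set.forall_mem_image2, map_mul, mul_eq_zero]
    constructor
    · rintro (h | h) f hf g hg
      · exact Or.inl (h f hf)
      · exact Or.inr (h g hg)
    · intro h
      by_contra! hcon
      obtain ⟨⟨f, hf, hf0⟩, g, hg, hg0⟩ := hcon
      exact (h f hf g hg).elim hf0 hg0

theorem isAlgebraicSubset_of_finite {F : Set (Fin n → OnePoint ℝ)} (hF : F.Finite) :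
    IsAlgebraicSubset F := by
  induction F, hF using Set.Finite.induction_on with
  | empty => exact ⟨{1}, fun f hf => ⟨0, hf ▸ MvPolynomial.isWeightedHomogeneous_one _ _⟩, by simp⟩
  | insert _ _ ih => exact isAlgebraicSubset_union (isAlgebraicSubset_singleton _) ih

/-- A finite irreducible set is a point. -/
theorem IsIrreducibleAlgebraic.eq_singleton {Z : Set (Fin n → OnePoint ℝ)}
    (hZ : IsIrreducibleAlgebraic Z) (hfin : Z.Finite) : ∃ t, Z = {t} := by
  obtain ⟨t, ht⟩ := hZ.2.1
  refine ⟨t, Set.Subset.antisymm ?_ (Set.singleton_subset_iff.mpr ht)⟩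
  have hsub : Z ⊆ {t} ∪ Z \ {t} := fun s hs => by
    by_cases h : s = t
    · exact Or.inl h
    · exact Or.inr ⟨hs, h⟩
  rcases hZ.2.2 _ _ (isAlgebraicSubset_singleton t)
    (isAlgebraicSubset_of_finite (hfin.subset Set.sdiff_subset)) hsub with h | h
  · exact h
  · exact absurd rfl (h ht).2

theorem isIrreducibleAlgebraic_singleton (t : Fin n → OnePoint ℝ) :
    IsIrreducibleAlgebraic {t} :=
  ⟨isAlgebraicSubset_singleton t, Set.singleton_nonempty t, fun Z₁ Z₂ _ _ h => by
    simpa only [Set.singleton_subset_iff, Set.mem_union] using h rfl⟩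

/-- An irreducible curve in the sense of `isIrreducibleAlgebraic_of_subset_or_finite` is
one-dimensional: its irreducible subsets are its points and the curve itself. -/
theorem algebraicDim_eq_one {C : Set (Fin n → OnePoint ℝ)}
    (hC : IsAlgebraicSubset C) (hinf : C.Infinite)
    (h : ∀ Z, IsAlgebraicSubset Z → C ⊆ Z ∨ (C ∩ Z).Finite) : algebraicDim C = 1 := by
  have hirr := isIrreducibleAlgebraic_of_subset_or_finite hC hinf h
  refine le_antisymm (Order.krullDim_le_one_iff.mpr ?_) (Order.one_le_krullDim_iff.mpr ?_)
  · rintro ⟨Z, hZ, hZC⟩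
    rcases h Z hZ.1 with h1 | h1
    · right
      rintro ⟨Z', hZ', hZC'⟩ _
      exact hZC'.trans h1
    · left
      rw [Set.inter_eq_right.mpr hZC] at h1
      obtain ⟨t, rfl⟩ := hZ.eq_singleton h1
      rintro ⟨Z', hZ', hZC'⟩ (hle : Z' ⊆ {t})
      obtain ⟨s, hs⟩ := hZ'.2.1
      exact Set.singleton_subset_iff.mpr ((hle hs : s = t) ▸ hs)
  · obtain ⟨t, ht⟩ := hinf.nonempty
    refine ⟨⟨{t}, isIrreducibleAlgebraic_singleton t, Set.singleton_subset_iff.mpr ht⟩,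
      ⟨C, hirr, subset_rfl⟩, Set.singleton_subset_iff.mpr ht, fun hle => ?_⟩
    exact hinf ((Set.finite_singleton t).subset hle)

end Algebraic

/-! ### The rational curve -/

/-- The data of a rational curve in `(ℝP¹)ⁿ`, parametrized by `ξ_p = u_p s - y_p / s`, together with
the coefficients of biquadratic relations `ξ_p ξ_q - m_qp ξ_p² - m_pq ξ_q² + e_pq = 0` that hold on
it. The coordinate `t_p` is `ξ_p` or, if `χ p` is true, `1 / ξ_p`; the blocks of proportional
coordinates are the fibres of `J`. Between different blocks the relation is determined by the curve;
within a block one of the numbers `m_pq`, `m_qp` is free, up to the condition `m_within_ne` that the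
two linear factors of the relation are not proportional. -/
structure CurveData (n : ℕ) where
  J : Fin n → ℕ
  χ : Fin n → Bool
  u : Fin n → ℝ
  y : Fin n → ℝ
  m : Fin n → Fin n → ℝ
  e : Fin n → Fin n → ℝ
  u_pos : ∀ p, 0 < u p
  y_pos : ∀ p, 0 < y p
  J_eq_iff : ∀ p q, J p = J q ↔ u p * y q = u q * y p
  m_between : ∀ p q, J p ≠ J q → m p q * (u p * y q + u q * y p) = u p * y p
  e_between : ∀ p q, J p ≠ J q →
    e p q * (u p * y q + u q * y p) = (u p * y q - u q * y p) ^ 2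
  m_within : ∀ p q, p ≠ q → J p = J q → m q p * u p ^ 2 + m p q * u q ^ 2 = u p * u q
  m_within_ne : ∀ p q, p ≠ q → J p = J q → m p q * u q ^ 2 ≠ m q p * u p ^ 2
  e_within : ∀ p q, p ≠ q → J p = J q → e p q = 0

namespace CurveData

variable {n : ℕ} (D : CurveData n)

/-- The first homogeneous coordinate of `ξ_p`. -/
def x₀ (t : Fin n → OnePoint ℝ) (p : Fin n) : ℝ := xiCoord (D.χ p) (t p) 0

/-- The second homogeneous coordinate of `ξ_p`. -/
def x₁ (t : Fin n → OnePoint ℝ) (p : Fin n) : ℝ := xiCoord (D.χ p) (t p) 1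

/-- The biquadratic relation between `ξ_p` and `ξ_q`, in homogeneous coordinates. -/
def rel (t : Fin n → OnePoint ℝ) (p q : Fin n) : ℝ :=
  D.x₀ t p * D.x₁ t p * (D.x₀ t q * D.x₁ t q) - D.m q p * (D.x₀ t p ^ 2 * D.x₁ t q ^ 2)
    - D.m p q * (D.x₁ t p ^ 2 * D.x₀ t q ^ 2) + D.e p q * (D.x₁ t p ^ 2 * D.x₁ t q ^ 2)

/-- The linear relation between proportional coordinates. -/
def lin (t : Fin n → OnePoint ℝ) (p q : Fin n) : ℝ :=
  D.u p * (D.x₁ t p * D.x₀ t q) - D.u q * (D.x₀ t p * D.x₁ t q)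

/-- The form of degree `(1, 1, 1)` that expresses `ξ_r` as the linear combination
`(a (ξ_p y_q - ξ_q y_p) - b (ξ_p u_q - ξ_q u_p)) / c` of `ξ_p` and `ξ_q`. -/
def trip (a b c : ℝ) (t : Fin n → OnePoint ℝ) (p q r : Fin n) : ℝ :=
  c * (D.x₁ t p * D.x₁ t q * D.x₀ t r)
    - a * (D.y q * (D.x₀ t p * D.x₁ t q * D.x₁ t r) - D.y p * (D.x₁ t p * D.x₀ t q * D.x₁ t r))
    + b * (D.u q * (D.x₀ t p * D.x₁ t q * D.x₁ t r) - D.u p * (D.x₁ t p * D.x₀ t q * D.x₁ t r))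

/-- The linear relation between three coordinates on the curve. -/
def tripOn (t : Fin n → OnePoint ℝ) (p q r : Fin n) : ℝ :=
  D.trip (D.u r) (D.y r) (D.u p * D.y q - D.u q * D.y p) t p q r

/-- The linear relation between three coordinates on the image of the curve under the involution
`s ↦ -y_p / (u_p s)` in the coordinate `ξ_r` only; `ξ_p` is invariant under this involution. -/
def tripOff (t : Fin n → OnePoint ℝ) (p q r : Fin n) : ℝ :=
  D.trip (D.y r * D.u p ^ 2) (D.u r * D.y p ^ 2)
    (D.u p * D.y p * (D.u p * D.y q - D.u q * D.y p)) t p q r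

/-- The set of all solutions of the biquadratic relations. -/
def relSet : Set (Fin n → OnePoint ℝ) := {t | ∀ p q, p ≠ q → D.rel t p q = 0}

/-- The parametrization of the curve; the parameter `s = ∞` would give the same point as `s = 0`. -/
noncomputable def param (s : ℝ) (p : Fin n) : OnePoint ℝ :=
  if D.χ p then projPoint s (D.u p * s ^ 2 - D.y p) else projPoint (D.u p * s ^ 2 - D.y p) s

/-- The curve itself. -/
def curve : Set (Fin n → OnePoint ℝ) := Set.range D.param

theorem x_ne_zero (t : Fin n → OnePoint ℝ) (p : Fin n) : D.x₀ t p ≠ 0 ∨ D.x₁ t p ≠ 0 := by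
  have := homCoord_sq_pos (t p)
  by_contra! h
  obtain ⟨h0, h1⟩ := h
  unfold x₀ at h0
  unfold x₁ at h1
  cases hχ : D.χ p <;> rw [hχ] at h0 h1
  · rw [xiCoord_false] at h0 h1
    rw [h0, h1] at this; norm_num at this
  · rw [xiCoord_true_zero] at h0
    rw [xiCoord_true_one] at h1
    rw [h0, h1] at this; norm_num at this

theorem eq_of_x {t t' : Fin n → OnePoint ℝ}
    (h : ∀ p, D.x₀ t p * D.x₁ t' p = D.x₁ t p * D.x₀ t' p) : t = t' := by
  funext p
  have := h p
  unfold x₀ x₁ at this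
  apply eq_of_homCoord
  cases hχ : D.χ p <;> rw [hχ] at this
  · exact this
  · simp only [xiCoord_true_zero, xiCoord_true_one] at this
    linarith

theorem exists_param (s : ℝ) (p : Fin n) : ∃ c : ℝ, c ≠ 0 ∧
    D.u p * s ^ 2 - D.y p = c * D.x₀ (D.param s) p ∧ s = c * D.x₁ (D.param s) p := by
  have hne : D.u p * s ^ 2 - D.y p ≠ 0 ∨ s ≠ 0 := by
    by_contra! h
    obtain ⟨h1, h2⟩ := h
    rw [h2] at h1
    have := D.y_pos p
    norm_num at h1
    linarith
  cases hχ : D.χ p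
  · simpa [x₀, x₁, param, hχ, xiCoord_false] using exists_homCoord_projPoint hne
  · obtain ⟨c, h0, h1, h2⟩ := exists_homCoord_projPoint hne.symm
    exact ⟨c, h0, by simpa [x₀, param, hχ, xiCoord_true_zero] using h2,
      by simpa [x₁, param, hχ, xiCoord_true_one] using h1⟩

theorem between_pos (p q : Fin n) : 0 < D.u p * D.y q + D.u q * D.y p := by
  have := D.u_pos p; have := D.y_pos p; have := D.u_pos q; have := D.y_pos q
  positivity

theorem m_between_pos {p q : Fin n} (h : D.J p ≠ D.J q) : 0 < D.m p q := by
  have h1 := D.m_between p q h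
  have h2 := mul_pos (D.u_pos p) (D.y_pos p)
  rw [← h1] at h2
  exact pos_of_mul_pos_left h2 (D.between_pos p q).le

/-- The relation between coordinates of different blocks, without denominators. -/
theorem rel_between {p q : Fin n} (h : D.J p ≠ D.J q) (t : Fin n → OnePoint ℝ) :
    (D.u p * D.y q + D.u q * D.y p) * D.rel t p q =
      (D.u p * D.y q + D.u q * D.y p) * (D.x₀ t p * D.x₁ t p * (D.x₀ t q * D.x₁ t q))
        - D.u q * D.y q * (D.x₀ t p ^ 2 * D.x₁ t q ^ 2)
        - D.u p * D.y p * (D.x₁ t p ^ 2 * D.x₀ t q ^ 2)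
        + (D.u p * D.y q - D.u q * D.y p) ^ 2 * (D.x₁ t p ^ 2 * D.x₁ t q ^ 2) := by
  have h1 := D.m_between p q h
  have h2 := D.m_between q p h.symm
  have h3 := D.e_between p q h
  unfold rel
  linear_combination (-(D.x₀ t p ^ 2 * D.x₁ t q ^ 2)) * h2 - (D.x₁ t p ^ 2 * D.x₀ t q ^ 2) * h1
    + (D.x₁ t p ^ 2 * D.x₁ t q ^ 2) * h3

/-- Within a block the relation is a product of two linear ones. -/
theorem rel_within {p q : Fin n} (hpq : p ≠ q) (h : D.J p = D.J q) (t : Fin n → OnePoint ℝ) :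
    D.u p * D.u q * D.rel t p q = D.lin t p q * (D.m q p * D.u p * (D.x₀ t p * D.x₁ t q) -
        D.m p q * D.u q * (D.x₁ t p * D.x₀ t q)) := by
  have h1 := D.m_within p q hpq h
  unfold rel lin
  rw [D.e_within p q hpq h]
  linear_combination (-(D.x₀ t p * D.x₁ t p * D.x₀ t q * D.x₁ t q)) * h1

/-- For coordinates of three blocks, two of the relations leave two possibilities for the third
coordinate. -/
theorem tripOn_mul_tripOff {p q r : Fin n} (hpq : D.J p ≠ D.J q) (hpr : D.J p ≠ D.J r)
    (t : Fin n → OnePoint ℝ) :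
    D.tripOn t p q r * D.tripOff t p q r =
      -(D.u p * D.y q - D.u q * D.y p) ^ 2 * D.x₁ t q ^ 2 *
          ((D.u p * D.y r + D.u r * D.y p) * D.rel t p r) +
        (D.u p * D.y r - D.u r * D.y p) ^ 2 * D.x₁ t r ^ 2 *
          ((D.u p * D.y q + D.u q * D.y p) * D.rel t p q) := by
  rw [rel_between D hpq, rel_between D hpr]
  unfold tripOn tripOff trip
  ring

theorem isAlgebraicSubset_lin_comb (p q : Fin n) (a b : ℝ) : IsAlgebraicSubset
    {t | a * (D.x₁ t p * D.x₀ t q) + b * (D.x₀ t p * D.x₁ t q) = 0} := by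
  convert isAlgebraicSubset_bilinear D.χ p q ![![0, b], ![a, 0]] using 3 with t
  simp [Fin.sum_univ_two, x₀, x₁, add_comm]

theorem isAlgebraicSubset_trip (a b c : ℝ) (p q r : Fin n) : IsAlgebraicSubset
    {t | D.trip a b c t p q r = 0} := by
  convert isAlgebraicSubset_trilinear D.χ p q r
    ![![![0, 0], ![0, -a * D.y q + b * D.u q]], ![![0, a * D.y p - b * D.u p], ![c, 0]]]
    using 3 with t
  simp [Fin.sum_univ_two, x₀, x₁, trip]
  ring_nf

theorem isAlgebraicSubset_rel (p q : Fin n) : IsAlgebraicSubset {t | D.rel t p q = 0} := by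
  convert isAlgebraicSubset_biquadratic D.χ p q
    ![![![![0, 0], ![0, -D.m q p]], ![![0, 1], ![0, 0]]],
      ![![![0, 0], ![0, 0]], ![![-D.m p q, 0], ![0, D.e p q]]]] using 3 with t
  simp [Fin.sum_univ_two, x₀, x₁, rel]
  ring_nf

theorem lin_param (s : ℝ) {p q : Fin n} (h : D.J p = D.J q) : D.lin (D.param s) p q = 0 := by
  obtain ⟨c, hc, h1, h2⟩ := D.exists_param s p
  obtain ⟨c', hc', h1', h2'⟩ := D.exists_param s q
  have hJ := (D.J_eq_iff p q).mp h
  have : c * c' * D.lin (D.param s) p q = 0 := by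
    unfold lin
    linear_combination (-s * D.u p) * h1' + (c' * D.u q * D.x₁ (D.param s) q) * h1 -
      (c' * D.u p * D.x₀ (D.param s) q) * h2
      + (D.u q * (D.u p * s ^ 2 - D.y p)) * h2' - s * hJ
  simpa [hc, hc'] using this

theorem tripOn_param (s : ℝ) (p q r : Fin n) : D.tripOn (D.param s) p q r = 0 := by
  obtain ⟨c, hc, h1, h2⟩ := D.exists_param s p
  obtain ⟨c', hc', h1', h2'⟩ := D.exists_param s q
  obtain ⟨c'', hc'', h1'', h2''⟩ := D.exists_param s r
  have : c * c' * c'' * D.tripOn (D.param s) p q r =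
      (D.u p * D.y q - D.u q * D.y p) * ((c * D.x₁ (D.param s) p) * (c' * D.x₁ (D.param s) q) *
        (c'' * D.x₀ (D.param s) r))
    - D.u r * (D.y q * ((c * D.x₀ (D.param s) p) * (c' * D.x₁ (D.param s) q) *
        (c'' * D.x₁ (D.param s) r)) - D.y p * ((c * D.x₁ (D.param s) p) *
        (c' * D.x₀ (D.param s) q) * (c'' * D.x₁ (D.param s) r)))
    + D.y r * (D.u q * ((c * D.x₀ (D.param s) p) * (c' * D.x₁ (D.param s) q) *
        (c'' * D.x₁ (D.param s) r)) - D.u p * ((c * D.x₁ (D.param s) p) *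
        (c' * D.x₀ (D.param s) q) * (c'' * D.x₁ (D.param s) r))) := by
    unfold tripOn trip; ring
  rw [← h1, ← h2, ← h1', ← h2', ← h1'', ← h2''] at this
  have h0 : c * c' * c'' * D.tripOn (D.param s) p q r = 0 := by rw [this]; ring
  simpa [hc, hc', hc''] using h0

theorem rel_param (s : ℝ) {p q : Fin n} (hpq : p ≠ q) : D.rel (D.param s) p q = 0 := by
  by_cases h : D.J p = D.J q
  · have := D.rel_within hpq h (D.param s)
    rw [D.lin_param s h, zero_mul] at this
    simpa [(D.u_pos p).ne', (D.u_pos q).ne'] using this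
  · obtain ⟨c, hc, h1, h2⟩ := D.exists_param s p
    obtain ⟨c', hc', h1', h2'⟩ := D.exists_param s q
    have hP := (D.between_pos p q).ne'
    have h0 := D.rel_between h (D.param s)
    have : (c * c') ^ 2 * ((D.u p * D.y q + D.u q * D.y p) * D.rel (D.param s) p q) =
        (D.u p * D.y q + D.u q * D.y p) * ((c * D.x₀ (D.param s) p) * (c * D.x₁ (D.param s) p) *
          ((c' * D.x₀ (D.param s) q) * (c' * D.x₁ (D.param s) q)))
        - D.u q * D.y q * ((c * D.x₀ (D.param s) p) ^ 2 * (c' * D.x₁ (D.param s) q) ^ 2)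
        - D.u p * D.y p * ((c * D.x₁ (D.param s) p) ^ 2 * (c' * D.x₀ (D.param s) q) ^ 2)
        + (D.u p * D.y q - D.u q * D.y p) ^ 2 *
          ((c * D.x₁ (D.param s) p) ^ 2 * (c' * D.x₁ (D.param s) q) ^ 2) := by
      rw [h0]; ring
    rw [← h1, ← h2, ← h1', ← h2'] at this
    have h3 : (c * c') ^ 2 * ((D.u p * D.y q + D.u q * D.y p) * D.rel (D.param s) p q) = 0 := by
      rw [this]; ring
    simpa [hc, hc', hP] using h3

/-- The equations of the curve. The biquadratic relations alone have further solutions, which are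
excluded by the linear relations within each block and by the trilinear ones between three blocks.
-/
theorem mem_curve_iff (hn : 0 < n) (t : Fin n → OnePoint ℝ) : t ∈ D.curve ↔
    (∀ p q, D.J p = D.J q → D.lin t p q = 0) ∧ (∀ p q, p ≠ q → D.rel t p q = 0) ∧
      ∀ p q r, D.J p ≠ D.J q → D.J p ≠ D.J r → D.J q ≠ D.J r → D.tripOn t p q r = 0 := by
  constructor
  · rintro ⟨s, rfl⟩
    exact ⟨fun p q h => D.lin_param s h, fun p q h => D.rel_param s h,
      fun p q r _ _ _ => D.tripOn_param s p q r⟩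
  rintro ⟨hlin, hrel, htrip⟩
  -- it is enough to find the parameter
  suffices h : ∃ s : ℝ, ∀ p, D.x₀ t p * s = (D.u p * s ^ 2 - D.y p) * D.x₁ t p by
    obtain ⟨s, hs⟩ := h
    refine ⟨s, D.eq_of_x fun p => ?_⟩
    obtain ⟨c, hc, h1, h2⟩ := D.exists_param s p
    have h3 := hs p
    rw [h1] at h3
    nth_rewrite 1 [h2] at h3
    apply mul_left_cancel₀ hc
    linear_combination -h3
  by_cases hinf : ∃ p, D.x₁ t p = 0
  · -- if one coordinate is infinite then all are, and the parameter is `0`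
    obtain ⟨p, hp⟩ := hinf
    have hp0 : D.x₀ t p ≠ 0 := (D.x_ne_zero t p).resolve_right (not_not.mpr hp)
    refine ⟨0, fun q => ?_⟩
    have : D.x₁ t q = 0 := by
      by_cases hpq : D.J p = D.J q
      · have := hlin p q hpq
        unfold lin at this
        rw [hp] at this
        simpa [(D.u_pos q).ne', hp0] using this
      · have hne : p ≠ q := fun h => hpq (h ▸ rfl)
        have := hrel p q hne
        unfold rel at this
        rw [hp] at this
        simpa [(D.m_between_pos (Ne.symm hpq)).ne', hp0] using this
    rw [this]; ring
  push Not at hinf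
  -- now all coordinates are finite
  obtain ⟨ξ, hξ⟩ : ∃ ξ : Fin n → ℝ, ∀ p, D.x₀ t p = ξ p * D.x₁ t p :=
    ⟨fun p => D.x₀ t p / D.x₁ t p, fun p => (div_mul_cancel₀ _ (hinf p)).symm⟩
  suffices h : ∃ s : ℝ, ∀ p, ξ p * s = D.u p * s ^ 2 - D.y p by
    obtain ⟨s, hs⟩ := h
    exact ⟨s, fun p => by rw [hξ, ← hs]; ring⟩
  have hlin' : ∀ p q, D.J p = D.J q → D.u p * ξ q = D.u q * ξ p := by
    intro p q h
    have h1 := hlin p q h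
    unfold lin at h1
    rw [hξ, hξ] at h1
    apply mul_left_cancel₀ (mul_ne_zero (hinf p) (hinf q))
    linear_combination h1
  have hlin'' : ∀ p q s, D.J p = D.J q → ξ p * s = D.u p * s ^ 2 - D.y p →
      ξ q * s = D.u q * s ^ 2 - D.y q := by
    intro p q s h hs
    apply mul_left_cancel₀ (D.u_pos p).ne'
    linear_combination s * hlin' p q h + D.u q * hs + (D.J_eq_iff p q).mp h
  let p : Fin n := ⟨0, hn⟩
  by_cases hall : ∀ q, D.J p = D.J q
  · -- a single block: the parameter is a root of a quadratic equation with positive discriminant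
    have hdisc : 0 ≤ ξ p ^ 2 + 4 * D.u p * D.y p := by
      have := D.u_pos p; have := D.y_pos p; positivity
    refine ⟨(ξ p + Real.sqrt (ξ p ^ 2 + 4 * D.u p * D.y p)) / (2 * D.u p), fun q =>
      hlin'' p q _ (hall q) ?_⟩
    have hu := (D.u_pos p).ne'
    have h2 := Real.sq_sqrt hdisc
    set S := Real.sqrt (ξ p ^ 2 + 4 * D.u p * D.y p)
    field_simp
    linear_combination -h2
  · -- two coordinates of different blocks determine `s` and `1 / s`
    push Not at hall
    obtain ⟨q, hpq⟩ := hall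
    have hd : D.u p * D.y q - D.u q * D.y p ≠ 0 := fun h =>
      hpq ((D.J_eq_iff p q).mpr (by linarith))
    set d := D.u p * D.y q - D.u q * D.y p with hd_def
    set A := ξ p * D.y q - ξ q * D.y p with hA
    set B := ξ p * D.u q - ξ q * D.u p with hB
    have hAB : A * B = d ^ 2 := by
      have h1 := D.rel_between hpq t
      rw [hrel p q fun h => hpq (h ▸ rfl), hξ, hξ] at h1
      have h2 : (D.x₁ t p ^ 2 * D.x₁ t q ^ 2) ≠ 0 := by simp [hinf]
      apply mul_left_cancel₀ h2
      linear_combination h1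
    have hB0 : B ≠ 0 := by
      intro h
      rw [h, mul_zero] at hAB
      exact hd (pow_eq_zero_iff (two_ne_zero)|>.mp hAB.symm)
    have hother : ∀ r, D.J p ≠ D.J r → D.J q ≠ D.J r → d * ξ r = D.u r * A - D.y r * B := by
      intro r h1 h2
      have h3 := htrip p q r hpq h1 h2
      unfold tripOn trip at h3
      rw [hξ, hξ, hξ] at h3
      apply mul_left_cancel₀ (mul_ne_zero (mul_ne_zero (hinf p) (hinf q)) (hinf r))
      linear_combination h3
    have hp : d * ξ p = D.u p * A - D.y p * B := by rw [hA, hB, hd_def]; ring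
    have hq : d * ξ q = D.u q * A - D.y q * B := by rw [hA, hB, hd_def]; ring
    have hfin : ∀ r, d * ξ r = D.u r * A - D.y r * B →
        ξ r * (d / B) = D.u r * (d / B) ^ 2 - D.y r := by
      intro r hr
      field_simp
      linear_combination B * hr + D.u r * hAB
    refine ⟨d / B, fun r => ?_⟩
    by_cases h1 : D.J p = D.J r
    · exact hlin'' p r _ h1 (hfin p hp)
    by_cases h2 : D.J q = D.J r
    · exact hlin'' q r _ h2 (hfin q hq)
    · exact hfin r (hother r h1 h2)

theorem isAlgebraicSubset_curve (hn : 0 < n) : IsAlgebraicSubset D.curve := by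
  have : D.curve = (⋂ (p : Fin n) (q : Fin n) (_ : D.J p = D.J q), {t | D.lin t p q = 0}) ∩
      ((⋂ (p : Fin n) (q : Fin n) (_ : p ≠ q), {t | D.rel t p q = 0}) ∩
      ⋂ (p : Fin n) (q : Fin n) (r : Fin n) (_ : D.J p ≠ D.J q) (_ : D.J p ≠ D.J r)
        (_ : D.J q ≠ D.J r), {t | D.tripOn t p q r = 0}) := by
    ext t
    rw [D.mem_curve_iff hn]
    simp only [Set.mem_inter_iff, Set.mem_iInter, Set.mem_ofPred_eq]
  rw [this]
  refine isAlgebraicSubset_inter ?_ (isAlgebraicSubset_inter ?_ ?_)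
  · refine isAlgebraicSubset_iInter fun p => isAlgebraicSubset_iInter fun q =>
      isAlgebraicSubset_iInter fun _ => ?_
    convert D.isAlgebraicSubset_lin_comb p q (D.u p) (-D.u q) using 3
    unfold lin; ring_nf
  · exact isAlgebraicSubset_iInter fun p => isAlgebraicSubset_iInter fun q =>
      isAlgebraicSubset_iInter fun _ => D.isAlgebraicSubset_rel p q
  · exact isAlgebraicSubset_iInter fun p => isAlgebraicSubset_iInter fun q =>
      isAlgebraicSubset_iInter fun r => isAlgebraicSubset_iInter fun _ =>
      isAlgebraicSubset_iInter fun _ => isAlgebraicSubset_iInter fun _ =>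
        D.isAlgebraicSubset_trip _ _ _ p q r

theorem curve_infinite (hn : 0 < n) : D.curve.Infinite := by
  let p : Fin n := ⟨0, hn⟩
  have hinj : Set.InjOn D.param (Set.Ioi 0) := by
    intro s hs s' hs' h
    obtain ⟨c, hc, h1, h2⟩ := D.exists_param s p
    obtain ⟨c', hc', h1', h2'⟩ := D.exists_param s' p
    rw [← h] at h1' h2'
    simp only [Set.mem_Ioi] at hs hs'
    have h3 : (D.u p * s ^ 2 - D.y p) * s' = (D.u p * s' ^ 2 - D.y p) * s := by
      rw [h1, h1', h2]; nth_rewrite 1 [h2']; ring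
    have h4 : (s - s') * (D.u p * s * s' + D.y p) = 0 := by linear_combination h3
    have := D.u_pos p; have := D.y_pos p
    have h5 : D.u p * s * s' + D.y p ≠ 0 := by positivity
    linarith [(mul_eq_zero.mp h4).resolve_right h5]
  exact ((Set.Ioi_infinite (0 : ℝ)).image hinj).mono (Set.image_subset_range _ _)

/-- The curve is one-dimensional and irreducible: its proper algebraic subsets are finite. -/
theorem curve_subset_or_finite {Z : Set (Fin n → OnePoint ℝ)} (hZ : IsAlgebraicSubset Z) :
    D.curve ⊆ Z ∨ (D.curve ∩ Z).Finite := by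
  open Polynomial in
  refine hZ.range_subset_or_finite (P := fun i =>
    if xor (D.χ i.1) (i.2 = 0) then C (D.u i.1) * X ^ 2 - C (D.y i.1) else X) ?_
  intro s p
  obtain ⟨c, hc, h1, h2⟩ := D.exists_param s p
  refine ⟨c, hc, ?_⟩
  unfold x₀ at h1
  unfold x₁ at h2
  cases hχ : D.χ p
  · rw [hχ, xiCoord_false] at h1 h2
    intro j
    fin_cases j
    · simpa [hχ] using h1
    · simpa [hχ] using h2
  · rw [hχ] at h1 h2
    rw [xiCoord_true_zero] at h1
    rw [xiCoord_true_one] at h2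
    intro j
    fin_cases j
    · simpa [hχ] using h2
    · simpa [hχ] using h1

theorem curve_subset_relSet : D.curve ⊆ D.relSet := by
  rintro _ ⟨s, rfl⟩ p q h
  exact D.rel_param s h

/-- The curve is an irreducible component of the set of solutions of the biquadratic relations: by
`rel_within` and `tripOn_mul_tripOff`, each of its equations divides, modulo the relations, into two
factors, of which the second one does not vanish on the curve. -/
theorem isIrreducibleComponent_curve (hn : 0 < n) :
    IsIrreducibleComponent D.relSet D.curve := by
  have hirr := isIrreducibleAlgebraic_of_subset_or_finite (D.isAlgebraicSubset_curve hn)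
    (D.curve_infinite hn) fun Z hZ => D.curve_subset_or_finite hZ
  refine ⟨⟨hirr, D.curve_subset_relSet⟩, ?_⟩
  rintro Z ⟨hZ, hZrel⟩ (hCZ : D.curve ⊆ Z) t ht
  have hone : D.param 1 ∈ Z := hCZ ⟨1, rfl⟩
  rw [D.mem_curve_iff hn]
  refine ⟨fun p q hJ => ?_, fun p q hpq => hZrel ht p q hpq, fun p q r hpq hpr hqr => ?_⟩
  · by_cases hpq : p = q
    · subst hpq; unfold lin; ring
    have halg₁ := D.isAlgebraicSubset_lin_comb p q (D.u p) (-D.u q)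
    have halg₂ := D.isAlgebraicSubset_lin_comb p q (-(D.m p q * D.u q)) (D.m q p * D.u p)
    have hcover : ∀ t ∈ Z, D.u p * (D.x₁ t p * D.x₀ t q) + -D.u q * (D.x₀ t p * D.x₁ t q) = 0 ∨
        -(D.m p q * D.u q) * (D.x₁ t p * D.x₀ t q) + D.m q p * D.u p * (D.x₀ t p * D.x₁ t q) = 0 := by
      intro t ht
      have h0 := D.rel_within hpq hJ t
      rw [hZrel ht p q hpq, mul_zero] at h0
      refine (mul_eq_zero.mp h0.symm).imp (fun h => ?_) fun h => ?_
      · unfold lin at h; linarith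
      · linarith
    rcases hZ.2.2 _ _ halg₁ halg₂ hcover with h | h
    · have := h ht
      rw [Set.mem_ofPred_eq] at this
      unfold lin; linarith
    · exfalso
      have key : ∀ s : ℝ, s * (D.m q p * D.u p * (D.u p * s ^ 2 - D.y p) -
          D.m p q * D.u q * (D.u q * s ^ 2 - D.y q)) = 0 := by
        intro s
        obtain ⟨c, hc, h1, h2⟩ := D.exists_param s p
        obtain ⟨c', hc', h1', h2'⟩ := D.exists_param s q
        have h0 := h (hCZ ⟨s, rfl⟩)
        rw [Set.mem_ofPred_eq] at h0
        linear_combination c * c' * h0 + D.m q p * D.u p * s * h1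
          + D.m q p * D.u p * c * D.x₀ (D.param s) p * h2' - D.m p q * D.u q * s * h1'
          - D.m p q * D.u q * c' * D.x₀ (D.param s) q * h2
      -- the two coefficients of this polynomial in `s` are found from its values at `1` and `2`
      have k1 := key 1
      have k2 := key 2
      exact D.m_within_ne p q hpq hJ (by linarith)
  · have hcover : ∀ t ∈ Z, D.tripOn t p q r = 0 ∨ D.tripOff t p q r = 0 := by
      intro t ht
      have h0 := D.tripOn_mul_tripOff hpq hpr t
      rw [hZrel ht p q fun h => hpq (h ▸ rfl), hZrel ht p r fun h => hpr (h ▸ rfl)] at h0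
      simp only [mul_zero, add_zero] at h0
      exact mul_eq_zero.mp h0
    rcases hZ.2.2 _ _ (D.isAlgebraicSubset_trip _ _ _ p q r)
      (D.isAlgebraicSubset_trip _ _ _ p q r) hcover with h | h
    · exact h ht
    · -- at the parameter `1` the second form is a product of three non-zero factors
      exfalso
      have h0 := h hone
      rw [Set.mem_ofPred_eq] at h0
      obtain ⟨c, hc, h1, h2⟩ := D.exists_param 1 p
      obtain ⟨c', hc', h1', h2'⟩ := D.exists_param 1 q
      obtain ⟨c'', hc'', h1'', h2''⟩ := D.exists_param 1 r
      have h3 : (D.u p * D.y q - D.u q * D.y p) *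
          ((D.u r * D.y p - D.u p * D.y r) * (D.u p + D.y p)) = 0 := by
        have h4 : c * c' * c'' * D.trip (D.y r * D.u p ^ 2) (D.u r * D.y p ^ 2)
            (D.u p * D.y p * (D.u p * D.y q - D.u q * D.y p)) (D.param 1) p q r =
            D.u p * D.y p * (D.u p * D.y q - D.u q * D.y p) * ((c * D.x₁ (D.param 1) p) *
              (c' * D.x₁ (D.param 1) q) * (c'' * D.x₀ (D.param 1) r))
            - D.y r * D.u p ^ 2 * (D.y q * ((c * D.x₀ (D.param 1) p) *
              (c' * D.x₁ (D.param 1) q) * (c'' * D.x₁ (D.param 1) r)) -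
              D.y p * ((c * D.x₁ (D.param 1) p) *
              (c' * D.x₀ (D.param 1) q) * (c'' * D.x₁ (D.param 1) r)))
            + D.u r * D.y p ^ 2 * (D.u q * ((c * D.x₀ (D.param 1) p) *
              (c' * D.x₁ (D.param 1) q) * (c'' * D.x₁ (D.param 1) r)) -
              D.u p * ((c * D.x₁ (D.param 1) p) *
              (c' * D.x₀ (D.param 1) q) * (c'' * D.x₁ (D.param 1) r))) := by
          unfold trip; ring
        rw [h0, mul_zero, ← h1, ← h2, ← h1', ← h2', ← h1'', ← h2''] at h4
        linear_combination -h4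
      have hup := D.u_pos p
      have hyp := D.y_pos p
      rcases mul_eq_zero.mp h3 with h4 | h4
      · exact hpq ((D.J_eq_iff p q).mpr (by linarith))
      rcases mul_eq_zero.mp h4 with h5 | h5
      · exact hpr ((D.J_eq_iff p r).mpr (by linarith))
      · linarith

/-- Each coordinate `ξ_p` takes the values `∞` (at the parameter `0`) and `0`, and others. -/
theorem isEssentialSubset_curve : IsEssentialSubset D.curve := by
  intro p
  have h0 : D.x₁ (D.param 0) p = 0 := by
    obtain ⟨c, hc, -, h2⟩ := D.exists_param 0 p
    exact (mul_eq_zero.mp h2.symm).resolve_left hc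
  have h0' := (D.x_ne_zero (D.param 0) p).resolve_right (not_not.mpr h0)
  have h1 : D.x₁ (D.param 1) p ≠ 0 := by
    obtain ⟨c, hc, -, h2⟩ := D.exists_param 1 p
    intro h
    rw [h, mul_zero] at h2
    exact one_ne_zero h2
  -- a root of `u s² = y`
  have h2 : D.x₀ (D.param (Real.sqrt (D.y p / D.u p))) p = 0 := by
    obtain ⟨c, hc, h2, -⟩ := D.exists_param (Real.sqrt (D.y p / D.u p)) p
    have hu := D.u_pos p; have hy := D.y_pos p
    rw [Real.sq_sqrt (by positivity)] at h2
    have h3 : D.u p * (D.y p / D.u p) - D.y p = 0 := by field_simp; ring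
    exact (mul_eq_zero.mp (h2.symm.trans h3)).resolve_left hc
  have h2' := (D.x_ne_zero (D.param (Real.sqrt (D.y p / D.u p))) p).resolve_left (not_not.mpr h2)
  unfold x₀ at h0' h2
  unfold x₁ at h0 h1 h2'
  constructor
  · intro hall
    cases hχ : D.χ p <;> rw [hχ] at h0 h0' h1 h2 h2'
    · rw [hall _ ⟨0, rfl⟩, xiCoord_false, homCoord_coe] at h0'
      exact h0' rfl
    · rw [hall _ ⟨1, rfl⟩, xiCoord_true_one, homCoord_coe] at h1
      exact h1 rfl
  · intro hall
    cases hχ : D.χ p <;> rw [hχ] at h0 h0' h1 h2 h2'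
    · rw [hall _ ⟨1, rfl⟩, xiCoord_false, homCoord_infty] at h1
      exact h1 rfl
    · rw [hall _ ⟨0, rfl⟩, xiCoord_true_zero, homCoord_infty] at h0'
      exact h0' rfl

/-- Coordinates are proportional on the curve if and only if they belong to the same block: `ξ_p`
and `ξ_q` are directly proportional if and only if `u_p / y_p = u_q / y_q`, and never inversely. -/
theorem coordProportional_curve_iff (p q : Fin n) :
    CoordProportional D.curve p q ↔ D.J p = D.J q := by
  have hup := D.u_pos p; have hyp := D.y_pos p; have huq := D.u_pos q; have hyq := D.y_pos q
  -- the two kinds of proportionality, in terms of the coordinates `ξ`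
  have direct : ∀ a b : ℝ, a ≠ 0 → (∀ t ∈ D.curve,
      a * (D.x₀ t q * D.x₁ t p) = b * (D.x₀ t p * D.x₁ t q)) → D.J p = D.J q := by
    intro a b ha h
    have key : ∀ s : ℝ, s * (a * (D.u q * s ^ 2 - D.y q) - b * (D.u p * s ^ 2 - D.y p)) = 0 := by
      intro s
      obtain ⟨c, hc, h1, h2⟩ := D.exists_param s p
      obtain ⟨c', hc', h1', h2'⟩ := D.exists_param s q
      have h0 := h _ ⟨s, rfl⟩
      linear_combination c * c' * h0 + a * s * h1' + a * c' * D.x₀ (D.param s) q * h2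
        - b * s * h1 - b * c * D.x₀ (D.param s) p * h2'
    -- the two coefficients of this polynomial in `s` are found from its values at `1` and `2`
    have k1 := key 1
    have k2 := key 2
    have e1 : a * D.u q = b * D.u p := by linarith
    have e2 : a * D.y q = b * D.y p := by linarith
    rw [D.J_eq_iff]
    apply mul_left_cancel₀ ha
    linear_combination D.u p * e2 - D.y p * e1
  -- for `s = 0` both coordinates `ξ` are infinite, so that their product is not constant
  have inverse : ∀ a b : ℝ, a ≠ 0 → ¬ ∀ t ∈ D.curve,
      a * (D.x₀ t p * D.x₀ t q) = b * (D.x₁ t p * D.x₁ t q) := by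
    intro a b ha h
    obtain ⟨c, hc, h1, h2⟩ := D.exists_param 0 p
    obtain ⟨c', hc', h1', h2'⟩ := D.exists_param 0 q
    have h0 := h _ ⟨0, rfl⟩
    have : a * (D.y p * D.y q) = 0 := by
      linear_combination c * c' * h0 - a * D.y q * h1 + a * c * D.x₀ (D.param 0) p * h1'
        - b * c' * D.x₁ (D.param 0) q * h2
    have := (mul_eq_zero.mp this).resolve_left ha
    have : 0 < D.y p * D.y q := by positivity
    linarith
  constructor
  · rintro ⟨c, hc, h | h⟩
    · cases hp : D.χ p <;> cases hq : D.χ q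
      · exact direct 1 c one_ne_zero fun t ht => by
          simpa [x₀, x₁, hp, hq, xiCoord_false, xiCoord_true_zero, xiCoord_true_one] using h t ht
      · refine (inverse c 1 hc fun t ht => ?_).elim
        have := h t ht
        simp [x₀, x₁, hp, hq, xiCoord_false, xiCoord_true_zero, xiCoord_true_one]
        linarith
      · refine (inverse 1 c one_ne_zero fun t ht => ?_).elim
        have := h t ht
        simp [x₀, x₁, hp, hq, xiCoord_false, xiCoord_true_zero, xiCoord_true_one]
        linarith
      · refine direct c 1 hc fun t ht => ?_
        have := h t ht
        simp [x₀, x₁, hp, hq, xiCoord_true_zero, xiCoord_true_one]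
        linarith
    · cases hp : D.χ p <;> cases hq : D.χ q
      · refine (inverse 1 c one_ne_zero fun t ht => ?_).elim
        have := h t ht
        simp [x₀, x₁, hp, hq, xiCoord_false]
        linarith
      · refine direct c 1 hc fun t ht => ?_
        have := h t ht
        simp [x₀, x₁, hp, hq, xiCoord_false, xiCoord_true_zero, xiCoord_true_one]
        linarith
      · refine direct 1 c one_ne_zero fun t ht => ?_
        have := h t ht
        simp [x₀, x₁, hp, hq, xiCoord_false, xiCoord_true_zero, xiCoord_true_one]
        linarith
      · refine (inverse c 1 hc fun t ht => ?_).elim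
        have := h t ht
        simp [x₀, x₁, hp, hq, xiCoord_true_zero, xiCoord_true_one]
        linarith
  · intro hJ
    have hlin : ∀ t ∈ D.curve, D.lin t p q = 0 := by
      rintro _ ⟨s, rfl⟩
      exact D.lin_param s hJ
    simp only [lin, x₀, x₁] at hlin
    have h1 : D.u q / D.u p ≠ 0 := by positivity
    have h2 : D.u p / D.u q ≠ 0 := by positivity
    cases hp : D.χ p <;> cases hq : D.χ q <;>
      simp only [hp, hq, xiCoord_false, xiCoord_true_zero, xiCoord_true_one] at hlin
    · refine ⟨_, h1, Or.inl fun t ht => ?_⟩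
      field_simp; linear_combination hlin t ht
    · refine ⟨_, h2, Or.inr fun t ht => ?_⟩
      field_simp; linear_combination -hlin t ht
    · refine ⟨_, h1, Or.inr fun t ht => ?_⟩
      field_simp; linear_combination hlin t ht
    · refine ⟨_, h2, Or.inl fun t ht => ?_⟩
      field_simp; linear_combination -hlin t ht

end CurveData

/-! ### Frames: butterflies with prescribed angles -/

open Matrix in
/-- A butterfly in `𝕏ⁿ`, described by the Gram matrix `G` of the normals `n_p` of the faces `F_p` in
the facet `Δ` and by the matrix `V` of the numbers `d_q(b_p) / h_p`, where `d_q(b_p)` is the signed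
distance (or its sine, or its hyperbolic sine) from `b_p` to the face `F_q`, for zero dihedral
angles.

The first fields are those of `Butterfly`, together with the vertices `a_p`, their altitudes `H` and
the brackets `S` for zero dihedral angles: `S p q` for `b_p` and `b_q`, and `S p p` for `a_p` and
`b_p`. The fields from `a_mem` on express everything that the flex depends on through `G` and `V`,
where `c` and `d` are the cosine and the sine of a dihedral angle. -/
structure Frame (X : SpaceForm) {n : ℕ} (G V : Matrix (Fin n) (Fin n) ℝ) where
  a : Fin n → X.V n
  nrm : Fin n → X.V n
  b₀ : Fin n → X.V n
  m : X.V n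
  h : Fin n → ℝ
  H : Fin n → ℝ
  S : Fin n → Fin n → ℝ
  m_unit : X.form m m = 1
  m_orthogonal : X.Orthogonal a m
  nrm_inner : ∀ p, X.IsInnerNormal (fun q : {q : Fin n // q ≠ p} => a q) (a p) (nrm p)
  h_pos : ∀ p, 0 < h p
  H_pos : ∀ p, 0 < H p
  b₀_mem : ∀ p, b₀ p - h p • nrm p ∈ X.flat (fun q : {q : Fin n // q ≠ p} => a q)
  a_mem : ∀ p, a p ∈ X.points n
  pos_mem : ∀ p c d, c ^ 2 + d ^ 2 = 1 →
    b₀ p + (h p * (c - 1)) • nrm p + (h p * d) • m ∈ X.points n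
  bracket_pos : ∀ p q c d c' d', p ≠ q → c ^ 2 + d ^ 2 = 1 → c' ^ 2 + d' ^ 2 = 1 →
    X.bracket (b₀ p + (h p * (c - 1)) • nrm p + (h p * d) • m)
      (b₀ q + (h q * (c' - 1)) • nrm q + (h q * d') • m) =
    S p q + h p * h q *
      ((c - 1) * V q p + (c' - 1) * V p q + (c - 1) * (c' - 1) * G p q + d * d')
  bracket_a_pos : ∀ p c d, c ^ 2 + d ^ 2 = 1 →
    X.bracket (a p) (b₀ p + (h p * (c - 1)) • nrm p + (h p * d) • m) = S p p + H p * h p * (c - 1)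
  bracket_a_pos_ne : ∀ p q c d, p ≠ q → c ^ 2 + d ^ 2 = 1 →
    X.bracket (a q) (b₀ p + (h p * (c - 1)) • nrm p + (h p * d) • m) = X.bracket (a q) (b₀ p)
  generalPosition : ∀ (ε : Fin n → Bool) (c d : Fin n → ℝ),
    (Matrix.of fun p q => if ε p then V p q + (c p - 1) * G p q else (1 : Matrix _ _ ℝ) p q).det ≠ 0 →
    X.GeneralPosition fun p =>
      if ε p then b₀ p + (h p * (c p - 1)) • nrm p + (h p * d p) • m else a p

open SpaceForm Matrix in
/-- The vectors of a frame, with all relations between them in terms of the scalar product. The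
vector `o` is only needed in the Euclidean case: the signed distance from `x` to `F_q` is
`(n_q, x) + o_q`. The numbers `α` are the altitudes of the vertices `a_p`. -/
theorem nonempty_frame_of_vectors {X : SpaceForm} {n : ℕ} {G V : Matrix (Fin n) (Fin n) ℝ}
    (hn : 2 ≤ n) (hGs : ∀ p q, G p q = G q p) (hG1 : ∀ p, G p p = 1) (hV1 : ∀ p, V p p = 1)
    (a nrm b₀ : Fin n → X.V n) (m : X.V n) (α h o : Fin n → ℝ)
    (hα : ∀ p, 0 < α p) (hh : ∀ p, 0 < h p) (ho : X ≠ euclidean → o = 0)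
    (hm : X.form m m = 1) (hmn : ∀ p, X.form m (nrm p) = 0)
    (hnn : ∀ p q, X.form (nrm p) (nrm q) = G p q)
    (hma : ∀ p, X.form m (a p) = 0) (hmb : ∀ p, X.form m (b₀ p) = 0)
    (hna : ∀ p q, X.form (nrm q) (a p) + o q = if p = q then α p else 0)
    (hnb : ∀ p q, X.form (nrm q) (b₀ p) + o q = h p * V p q)
    (hnrm : ∀ p, nrm p = ∑ q, (G p q / α q) • a q)
    (hnrm' : ∀ p, X.Balanced fun q => G p q / α q)
    (hb₀ : ∀ p, b₀ p = ∑ q, (h p * V p q / α q) • a q)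
    (hb₀' : ∀ p, X.Normalized fun q => h p * V p q / α q)
    (hap : ∀ p, a p ∈ X.points n) (hbp : ∀ p, b₀ p ∈ X.points n) : Nonempty (Frame X G V) := by
  have hsing : ∀ p : Fin n, a p = ∑ q, (Pi.single p 1 : Fin n → ℝ) q • a q := fun p => by
    simp [Pi.single_apply]
  have horth : ∀ p, X.Orthogonal (fun q : {q : Fin n // q ≠ p} => a q) (nrm p) := by
    intro p
    have h0 : ∀ q, q ≠ p → X.form (nrm p) (a q) + o p = 0 := fun q hq => by
      rw [hna, if_neg hq]
    cases X
    · rintro ⟨q, hq⟩ ⟨r, hr⟩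
      have h1 := h0 q hq
      have h2 := h0 r hr
      show euclidean.form (a q - a r) (nrm p) = 0
      rw [form_sub_left, form_comm, form_comm (a r)]; linarith
    · rintro ⟨q, hq⟩
      have h1 := h0 q hq
      rw [ho (by simp), Pi.zero_apply, add_zero] at h1
      show spherical.form (a q) (nrm p) = 0
      rw [form_comm]; exact h1
    · rintro ⟨q, hq⟩
      have h1 := h0 q hq
      rw [ho (by simp), Pi.zero_apply, add_zero] at h1
      show lobachevsky.form (a q) (nrm p) = 0
      rw [form_comm]; exact h1
  have hflat_a : ∀ p, a p - α p • nrm p ∈ X.flat (fun q : {q : Fin n // q ≠ p} => a q) := by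
    intro p
    have : a p - α p • nrm p =
        ∑ q, ((Pi.single p 1 : Fin n → ℝ) q - α p * (G p q / α q)) • a q := by
      simp only [sub_smul, Finset.sum_sub_distrib, ← hsing, mul_smul, ← Finset.smul_sum, ← hnrm]
    rw [this]
    refine sum_smul_mem_flat ?_ ?_
    · have hb := hnrm' p
      cases X
      · simp only [SpaceForm.Balanced] at hb
        simp [Normalized, Finset.sum_sub_distrib, ← Finset.mul_sum, hb]
      · trivial
      · trivial
    · rw [hG1, Pi.single_eq_same, mul_one_div_cancel (hα p).ne', sub_self]
  have hflat_b : ∀ p, b₀ p - h p • nrm p ∈ X.flat (fun q : {q : Fin n // q ≠ p} => a q) := by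
    intro p
    have : b₀ p - h p • nrm p = ∑ q, (h p * V p q / α q - h p * (G p q / α q)) • a q := by
      simp only [sub_smul, Finset.sum_sub_distrib, ← hb₀, mul_smul, ← Finset.smul_sum, ← hnrm]
    rw [this]
    refine sum_smul_mem_flat ?_ ?_
    · have hb := hnrm' p
      have hb' := hb₀' p
      cases X
      · simp only [SpaceForm.Balanced] at hb
        simp only [Normalized] at hb' ⊢
        simp [Finset.sum_sub_distrib, ← Finset.mul_sum, hb, hb']
      · trivial
      · trivial
    · rw [hG1, hV1]; ring
  have hnm : ∀ p, X.form (nrm p) m = 0 := fun p => by rw [form_comm, hmn]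
  have ham : ∀ p, X.form (a p) m = 0 := fun p => by rw [form_comm, hma]
  have hbm : ∀ p, X.form (b₀ p) m = 0 := fun p => by rw [form_comm, hmb]
  have hna' : ∀ p q, X.form (a p) (nrm q) = (if p = q then α p else 0) - o q := fun p q => by
    rw [form_comm, ← hna]; ring
  have hnb' : ∀ p q, X.form (b₀ p) (nrm q) = h p * V p q - o q := fun p q => by
    rw [form_comm, ← hnb]; ring
  have hself : ∀ p c d, c ^ 2 + d ^ 2 = 1 → X ≠ euclidean →
      X.form (b₀ p + (h p * (c - 1)) • nrm p + (h p * d) • m)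
        (b₀ p + (h p * (c - 1)) • nrm p + (h p * d) • m) = X.form (b₀ p) (b₀ p) := by
    intro p c d hcd hX
    simp only [form_add_left, form_add_right, form_smul_left, form_smul_right, hm, hmn, hnm, hmb,
      hbm, hnn, hG1, hnb', form_comm (nrm p) (b₀ p), hV1, ho hX, Pi.zero_apply]
    linear_combination h p ^ 2 * hcd
  have hcross : ∀ p q c d, p ≠ q → X ≠ euclidean →
      X.form (a q) (b₀ p + (h p * (c - 1)) • nrm p + (h p * d) • m) = X.form (a q) (b₀ p) := by
    intro p q c d hpq hX
    simp only [form_add_right, form_smul_right, ham, hna', ho hX, Pi.zero_apply, if_neg hpq.symm]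
    ring
  have hpoints : ∀ p c d, c ^ 2 + d ^ 2 = 1 →
      b₀ p + (h p * (c - 1)) • nrm p + (h p * d) • m ∈ X.points n := by
    intro p c d hcd
    cases X
    · trivial
    · have h1 := hself p c d hcd (by simp)
      have h2 := hbp p
      simp only [points, mem_sphere_zero_iff_norm] at h2 ⊢
      simp only [form, real_inner_self_eq_norm_sq] at h1
      rw [h2] at h1
      exact (pow_left_inj₀ (norm_nonneg _) zero_le_one two_ne_zero).mp h1
    · -- pairing with another vertex of `Δ` shows that the rotated vertex stays on the upper sheet
      obtain ⟨q, hq⟩ : ∃ q : Fin n, p ≠ q := by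
        by_cases hp : p = ⟨0, by omega⟩
        · exact ⟨⟨1, by omega⟩, by rw [hp]; simp⟩
        · exact ⟨_, hp⟩
      refine mem_points_of_form_neg (hap q) ((hself p c d hcd (by simp)).trans (hbp p).1) ?_
      rw [hcross p q c d hq (by simp)]
      linarith [form_le_neg_one (hap q) (hbp p)]
  refine ⟨{
    a := a, nrm := nrm, b₀ := b₀, m := m, h := h, H := α
    S := fun p q => if p = q then X.bracket (a p) (b₀ p) else X.bracket (b₀ p) (b₀ q)
    m_unit := hm
    m_orthogonal := ?_
    nrm_inner := fun p => ⟨(hnn p p).trans (hG1 p), horth p, α p, hα p, hflat_a p⟩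
    h_pos := hh
    H_pos := hα
    b₀_mem := hflat_b
    a_mem := hap
    pos_mem := hpoints
    bracket_pos := ?_
    bracket_a_pos := ?_
    bracket_a_pos_ne := ?_
    generalPosition := ?_ }⟩
  · cases X
    · intro p q
      rw [form_sub_left, ham, ham, sub_zero]
    · exact ham
    · exact ham
  · intro p q c d c' d' hpq hcd hcd'
    rw [if_neg hpq]
    have hlin : X ≠ euclidean → X.form (b₀ p + (h p * (c - 1)) • nrm p + (h p * d) • m)
      (b₀ q + (h q * (c' - 1)) • nrm q + (h q * d') • m) = X.form (b₀ p) (b₀ q) + h p * h q *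
      ((c - 1) * V q p + (c' - 1) * V p q + (c - 1) * (c' - 1) * G p q + d * d') := by
      intro hX
      simp only [form_add_left, form_add_right, form_smul_left, form_smul_right, hm, hmn, hnm, hmb,
        hbm, hnn, hnb', form_comm (nrm p) (b₀ q), ho hX, Pi.zero_apply]
      ring
    cases X
    · rw [bracket_euclidean, bracket_euclidean]
      simp only [form_sub_left, form_sub_right, form_add_left, form_add_right, form_smul_left,
        form_smul_right, hm, hmn, hnm, hmb, hbm, hnn, hG1, hV1, hnb', form_comm (nrm _) (b₀ _),
        hGs q p, form_comm (b₀ q) (b₀ p)]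
      linear_combination (-h p ^ 2 / 2) * hcd - (h q ^ 2 / 2) * hcd'
    · exact hlin (by simp)
    · exact hlin (by simp)
  · intro p c d hcd
    rw [if_pos rfl]
    have hlin : X ≠ euclidean → X.form (a p) (b₀ p + (h p * (c - 1)) • nrm p + (h p * d) • m) =
        X.form (a p) (b₀ p) + α p * h p * (c - 1) := by
      intro hX
      simp only [form_add_right, form_smul_right, ham, hna', ho hX, Pi.zero_apply, if_pos]
      ring
    cases X
    · rw [bracket_euclidean, bracket_euclidean]
      simp only [form_sub_left, form_sub_right, form_add_left, form_add_right, form_smul_left,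
        form_smul_right, hm, hmn, hnm, hmb, hbm, hnn, hG1, hV1, hnb', form_comm (nrm _) (b₀ _),
        form_comm (nrm _) (a _), hna', hma, ham, if_pos]
      linear_combination (-h p ^ 2 / 2) * hcd
    · exact hlin (by simp)
    · exact hlin (by simp)
  · intro p q c d hpq hcd
    cases X
    · rw [bracket_euclidean, bracket_euclidean]
      simp only [form_sub_left, form_sub_right, form_add_left, form_add_right, form_smul_left,
        form_smul_right, hm, hmn, hnm, hmb, hbm, hnn, hG1, hV1, hnb', form_comm (nrm _) (b₀ _),
        form_comm (nrm _) (a _), hna', hma, ham, if_neg hpq.symm]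
      linear_combination (-h p ^ 2 / 2) * hcd
    · exact hcross p q c d hpq (by simp)
    · exact hcross p q c d hpq (by simp)
  · intro ε c d hdet
    generalize hv : (fun p => if ε p then b₀ p + (h p * (c p - 1)) • nrm p + (h p * d p) • m
      else a p) = v
    have hpair : ∀ p q, X.form (v p) (nrm q) = (if ε p then h p else α p) *
        (if ε p then V p q + (c p - 1) * G p q else (1 : Matrix _ _ ℝ) p q) - o q := by
      intro p q
      rw [← hv]
      by_cases hε : ε p
      · simp only [if_pos hε, form_add_left, form_smul_left, hmn, hnn, hnb']; ring
      · simp only [if_neg hε, hna', Matrix.one_apply]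
        split_ifs <;> ring
    -- pairing a linear relation with the normals gives a linear relation between the rows
    have key : ∀ w : Fin n → ℝ, X.Balanced w → ∑ p, w p • v p = 0 → w = 0 := by
      intro w hw hsum
      have hbal : ∀ q, ∑ p, w p * o q = 0 := by
        intro q
        cases X
        · rw [← Finset.sum_mul, hw, zero_mul]
        · rw [ho (by simp)]; simp
        · rw [ho (by simp)]; simp
      have hzero := Matrix.eq_zero_of_vecMul_eq_zero hdet
        (v := fun p => w p * if ε p then h p else α p) (by
          ext q
          have h0 := congrArg (fun x => X.form x (nrm q)) hsum
          simp only [form_zero_left] at h0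
          rw [form_sum_left] at h0
          simp only [hpair, mul_sub, Finset.sum_sub_distrib, hbal, sub_zero] at h0
          simpa only [Matrix.vecMul, dotProduct, mul_assoc, Matrix.of_apply,
            Pi.zero_apply] using h0)
      funext p
      have h1 := congrFun hzero p
      refine (mul_eq_zero.mp h1).resolve_right ?_
      split_ifs
      · exact (hh p).ne'
      · exact (hα p).ne'
    cases X
    · refine affineIndependent_iff.mpr fun s w hw hsum i hi => ?_
      have h0 := key (fun i => if i ∈ s then w i else 0) (by
        show ∑ i, (if i ∈ s then w i else 0) = 0
        simpa using hw) (by simpa [ite_smul] using hsum)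
      simpa [hi] using congrFun h0 i
    · exact Fintype.linearIndependent_iff.mpr fun w hw i => congrFun (key w trivial hw) i
    · exact Fintype.linearIndependent_iff.mpr fun w hw i => congrFun (key w trivial hw) i

/-! ### Realization of admissible matrices -/

open Matrix in
/-- Conditions on the matrices `G` and `V` under which a frame exists; the sign of `det G` decides
in which space. Apart from the first three, which are equations, they are open. For `det G ≠ 0` the
matrix `adj G` is, up to the factor `det G`, the Gram matrix of the dual basis of the normals, so
that the last three conditions say that all vertices have squares of the correct sign and lie on the
correct sheet of the hyperboloid. -/
structure Admissible {k : ℕ} (G V : Matrix (Fin (k + 1)) (Fin (k + 1)) ℝ) : Prop where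
  symm : ∀ p q, G p q = G q p
  diag : ∀ p, G p p = 1
  V_diag : ∀ p, V p p = 1
  minor_pos : ∀ x : Fin k → ℝ, x ≠ 0 →
    0 < x ⬝ᵥ (G.submatrix Fin.castSucc Fin.castSucc *ᵥ x)
  adj_pos : ∀ p q, 0 < G.adjugate p q
  adj_V_pos : ∀ p q, 0 < (G.adjugate *ᵥ V p) q
  V_adj_V_pos : ∀ p, 0 < V p ⬝ᵥ (G.adjugate *ᵥ V p)

/-- The sign of the determinant of the Gram matrix of the normals that corresponds to the space. -/
def SpaceForm.DetCondition : SpaceForm → ℝ → Prop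
  | euclidean, d => d = 0
  | spherical, d => 0 < d
  | lobachevsky, d => d < 0

namespace Admissible

open Matrix

variable {k : ℕ} {G V : Matrix (Fin (k + 1)) (Fin (k + 1)) ℝ}

open scoped MatrixOrder Matrix.Norms.L2Operator in
/-- The first `k` normals are realized by the columns of an invertible matrix; the orthogonal
projection of the last one to their span is `B w`, and the square of the remaining part is `det G`
divided by a positive minor. -/
theorem exists_factor (h : Admissible G V) : ∃ (B : Matrix (Fin k) (Fin k) ℝ) (w : Fin k → ℝ),
    IsUnit B.det ∧ (∀ i j, (Bᵀ * B) i j = G (Fin.castSucc i) (Fin.castSucc j)) ∧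
    (∀ i, ((Bᵀ * B) *ᵥ w) i = G (Fin.castSucc i) (Fin.last k)) ∧
    G.adjugate (Fin.last k) (Fin.last k) * (1 - (B *ᵥ w) ⬝ᵥ (B *ᵥ w)) = G.det := by
  have hpd : (G.submatrix Fin.castSucc Fin.castSucc : Matrix (Fin k) (Fin k) ℝ).PosDef := by
    refine Matrix.PosDef.of_dotProduct_mulVec_pos ?_ fun x hx => ?_
    · ext i j
      simp [h.symm (Fin.castSucc j)]
    · simpa using h.minor_pos x hx
  obtain ⟨B, hB⟩ := CStarAlgebra.nonneg_iff_eq_star_mul_self.mp hpd.posSemidef.nonneg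
  rw [star_eq_conjTranspose, Matrix.conjTranspose_eq_transpose_of_trivial] at hB
  have hdet : IsUnit B.det := by
    have h0 := hpd.det_pos
    rw [hB, det_mul, det_transpose] at h0
    exact isUnit_iff_ne_zero.mpr fun h1 => by rw [h1] at h0; simp at h0
  set g : Fin k → ℝ := fun i => G (Fin.castSucc i) (Fin.last k) with hg
  have hunit : IsUnit (Bᵀ * B).det := by
    rw [det_mul, det_transpose]; exact hdet.mul hdet
  set w := (Bᵀ * B)⁻¹ *ᵥ g with hw
  have hw1 : (Bᵀ * B) *ᵥ w = g := by
    rw [hw, mulVec_mulVec, mul_nonsing_inv _ hunit, one_mulVec]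
  have hent : ∀ i j, (Bᵀ * B) i j = G (Fin.castSucc i) (Fin.castSucc j) := fun i j => by
    rw [← hB]; rfl
  refine ⟨B, w, hdet, hent, fun i => congrFun hw1 i, ?_⟩
  have hyy : (B *ᵥ w) ⬝ᵥ (B *ᵥ w) = w ⬝ᵥ g := by
    rw [← hw1, ← mulVec_mulVec, dotProduct_mulVec w, vecMul_transpose]
  rw [hyy]
  -- apply `adj G` to `G (-w, 1) = (0, …, 0, 1 - w ⬝ g)`
  have hG : G *ᵥ (Fin.snoc (-w) 1 : Fin (k + 1) → ℝ) =
      (Fin.snoc (0 : Fin k → ℝ) (1 - w ⬝ᵥ g) : Fin (k + 1) → ℝ) := by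
    ext p
    simp only [mulVec, dotProduct, Fin.sum_univ_castSucc, Fin.snoc_castSucc, Fin.snoc_last,
      mul_one, Pi.neg_apply, mul_neg, Finset.sum_neg_distrib]
    refine Fin.lastCases ?_ (fun i => ?_) p
    · rw [Fin.snoc_last, h.diag, neg_add_eq_sub]
      congr 1
      exact Finset.sum_congr rfl fun i _ => by rw [h.symm, mul_comm]
    · rw [Fin.snoc_castSucc, Pi.zero_apply, neg_add_eq_zero]
      have := congrFun hw1 i
      simpa only [mulVec, dotProduct, hent] using this
  have h1 := congrFun (congrArg (fun v => G.adjugate *ᵥ v) hG) (Fin.last k)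
  simp only [mulVec_mulVec, adjugate_mul, smul_mulVec, one_mulVec, Pi.smul_apply, Fin.snoc_last,
    smul_eq_mul, mul_one] at h1
  rw [h1]
  simp [mulVec, dotProduct, Fin.sum_univ_castSucc]

/-- Normals with Gram matrix `G` for a non-degenerate scalar product with sign `σ` at the last
coordinate `τ`: this coordinate is zero for all normals but the last one. -/
theorem exists_normals (h : Admissible G V) {σ : ℝ} (hσ : σ ^ 2 = 1) (hdet : 0 < σ * G.det) :
    ∃ (v : Fin (k + 1) → Fin k → ℝ) (τ : Fin (k + 1) → ℝ), (∀ i, τ (Fin.castSucc i) = 0) ∧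
      τ (Fin.last k) < 0 ∧ ∀ p q, v p ⬝ᵥ v q + σ * (τ p * τ q) = G p q := by
  obtain ⟨B, w, hB, hBB, hw, hω⟩ := h.exists_factor
  set ω := 1 - (B *ᵥ w) ⬝ᵥ (B *ᵥ w) with hω_def
  have hωpos : 0 < σ * ω := by
    have : 0 < G.adjugate (Fin.last k) (Fin.last k) * (σ * ω) := by
      rw [← hω] at hdet; linarith
    exact pos_of_mul_pos_right this (h.adj_pos _ _).le
  have hsq := Real.sq_sqrt hωpos.le
  refine ⟨Fin.snoc (fun i => B.col i) (B *ᵥ w), Fin.snoc 0 (-Real.sqrt (σ * ω)), fun i => by simp,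
    by simpa using hωpos, fun p q => ?_⟩
  have hcol : ∀ i, B.col i ⬝ᵥ (B *ᵥ w) = G (Fin.castSucc i) (Fin.last k) := by
    intro i
    rw [← hw, ← mulVec_mulVec]
    rfl
  refine Fin.lastCases ?_ (fun i => ?_) p <;> refine Fin.lastCases ?_ (fun j => ?_) q
  · simp only [Fin.snoc_last, h.diag]
    linear_combination σ * hsq + ω * hσ + hω_def
  · simp only [Fin.snoc_last, Fin.snoc_castSucc, Pi.zero_apply, mul_zero, add_zero]
    rw [dotProduct_comm, hcol, h.symm]
  · simp only [Fin.snoc_last, Fin.snoc_castSucc, Pi.zero_apply, mul_zero, add_zero, zero_mul]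
    exact hcol i
  · simp only [Fin.snoc_castSucc, Pi.zero_apply, mul_zero, add_zero]
    rw [← hBB]
    rfl

/-- A vector of the ambient space of `𝕊ᵏ⁺¹` or `Λᵏ⁺¹`: the first coordinate is that in the direction
of the normal `m` of the facet `Δ`, the last one is distinguished by its sign. -/
def hvec {k : ℕ} (c : ℝ) (v : Fin k → ℝ) (τ : ℝ) : EuclideanSpace ℝ (Fin (k + 1 + 1)) :=
  WithLp.toLp 2 (Fin.snoc (Fin.cons c v : Fin (k + 1) → ℝ) τ)

open SpaceForm in
theorem form_spherical_hvec (c c' : ℝ) (v v' : Fin k → ℝ) (τ τ' : ℝ) :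
    form spherical (n := k + 1) (hvec c v τ) (hvec c' v' τ') = c * c' + v ⬝ᵥ v' + 1 * (τ * τ') := by
  have h0 : form spherical (n := k + 1) (hvec c v τ) (hvec c' v' τ') =
      ∑ i : Fin (k + 1 + 1), inner ℝ ((hvec c v τ) i) ((hvec c' v' τ') i) :=
    PiLp.inner_apply (hvec c v τ) (hvec c' v' τ')
  rw [h0, Fin.sum_univ_castSucc]
  simp only [hvec, Fin.snoc_castSucc, Fin.snoc_last, Fin.sum_univ_succ, Fin.cons_zero, Fin.cons_succ,
    RCLike.inner_apply, conj_trivial, dotProduct]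
  rw [Finset.sum_congr rfl fun i _ => mul_comm (v' i) (v i)]
  ring

open SpaceForm in
theorem form_lobachevsky_hvec (c c' : ℝ) (v v' : Fin k → ℝ) (τ τ' : ℝ) :
    form lobachevsky (n := k + 1) (hvec c v τ) (hvec c' v' τ') =
      c * c' + v ⬝ᵥ v' + -1 * (τ * τ') := by
  simp only [form, hvec]
  simp only [Fin.snoc_castSucc, Fin.snoc_last, Fin.sum_univ_succ, Fin.cons_zero, Fin.cons_succ,
    dotProduct]
  ring

open SpaceForm in
/-- The frame in `𝕊ⁿ` or `Λⁿ`, from normals with Gram matrix `G`: the vertices are found from the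
dual basis of the normals, with the lengths that put them into `𝕏ⁿ`. -/
theorem nonempty_frame_of_normals {X : SpaceForm} (hX : X ≠ euclidean) (h : Admissible G V)
    (hk : 1 ≤ k) {σ : ℝ} (hdet : 0 < σ * G.det) (m : X.V (k + 1))
    (nrm : Fin (k + 1) → X.V (k + 1)) (hm : X.form m m = 1) (hmn : ∀ p, X.form m (nrm p) = 0)
    (hnn : ∀ p q, X.form (nrm p) (nrm q) = G p q)
    (hpt : ∀ c : Fin (k + 1) → ℝ, σ * c (Fin.last k) > 0 →
      X.form (∑ r, c r • nrm r) (∑ r, c r • nrm r) = σ → ∑ r, c r • nrm r ∈ X.points (k + 1)) :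
    Nonempty (Frame X G V) := by
  have hd : G.det ≠ 0 := fun h0 => by rw [h0] at hdet; simp at hdet
  set A : Matrix (Fin (k + 1)) (Fin (k + 1)) ℝ := G.det⁻¹ • G.adjugate with hA
  have hGA : G * A = 1 := by
    rw [hA, Matrix.mul_smul, mul_adjugate, smul_smul, inv_mul_cancel₀ hd, one_smul]
  have hAs : ∀ p q, A p q = A q p := by
    have hGt : Gᵀ = G := by ext p q; exact h.symm q p
    intro p q
    have : Aᵀ = A := by rw [hA, transpose_smul, adjugate_transpose, hGt]
    exact congrFun (congrFun this q) p
  -- the dual basis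
  set ê : (Fin (k + 1) → ℝ) → X.V (k + 1) := fun x => ∑ r, (A *ᵥ x) r • nrm r with hê
  have hnê : ∀ x q, X.form (nrm q) (ê x) = x q := by
    intro x q
    simp only [hê, form_sum_right, hnn]
    have : (G *ᵥ (A *ᵥ x)) q = x q := by rw [mulVec_mulVec, hGA, one_mulVec]
    rw [← this]
    simp only [mulVec, dotProduct]
    exact Finset.sum_congr rfl fun r _ => mul_comm _ _
  have hmê : ∀ x, X.form m (ê x) = 0 := by
    intro x; simp only [hê, form_sum_right, hmn, mul_zero, Finset.sum_const_zero]
  have hêê : ∀ x, X.form (ê x) (ê x) = G.det⁻¹ * (x ⬝ᵥ (G.adjugate *ᵥ x)) := by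
    intro x
    have : X.form (ê x) (ê x) = (A *ᵥ x) ⬝ᵥ x := by
      conv_lhs => rw [hê]
      simp only [form_sum_left]
      rw [show (∑ r, (A *ᵥ x) r • nrm r) = ê x from rfl]
      simp only [hnê]; rfl
    rw [this, hA, smul_mulVec, smul_dotProduct, smul_eq_mul, dotProduct_comm]
  have hlin : ∀ c : Fin (k + 1) → ℝ, ê c = ∑ q, c q • ê (Pi.single q 1) := by
    intro c
    simp only [hê, Finset.smul_sum, smul_smul]
    rw [Finset.sum_comm]
    refine Finset.sum_congr rfl fun r _ => ?_
    rw [← Finset.sum_smul]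
    congr 1
    simp only [mulVec, dotProduct]
    refine Finset.sum_congr rfl fun q _ => ?_
    simp [Pi.single_apply, mul_comm]
  have hsmul : ∀ (c : ℝ) (x : Fin (k + 1) → ℝ), c • ê x = ê (c • x) := by
    intro c x
    simp only [hê, mulVec_smul, Pi.smul_apply, Finset.smul_sum, smul_smul, smul_eq_mul]
  have hnrm : ∀ p, nrm p = ê (G p) := by
    intro p
    have : A *ᵥ (G p) = Pi.single p 1 := by
      ext q
      have h1 := congrFun (congrFun hGA p) q
      rw [mul_apply, one_apply] at h1
      calc (∑ r, A q r * G p r) = ∑ r, G p r * A r q :=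
            Finset.sum_congr rfl fun r _ => (mul_comm _ _).trans (by rw [hAs q r])
        _ = _ := by rw [h1]; simp [Pi.single_apply, eq_comm]
    simp only [hê, this]
    simp [Pi.single_apply]
  have hquad : ∀ (c : ℝ) (x : Fin (k + 1) → ℝ), 0 < x ⬝ᵥ (G.adjugate *ᵥ x) →
      c = Real.sqrt (σ * G.det / (x ⬝ᵥ (G.adjugate *ᵥ x))) →
      0 < (G.adjugate *ᵥ x) (Fin.last k) → 0 < c ∧ ê (c • x) ∈ X.points (k + 1) := by
    intro c x hx hc hlast
    have hc2 : c ^ 2 = σ * G.det / (x ⬝ᵥ (G.adjugate *ᵥ x)) := by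
      rw [hc, Real.sq_sqrt (by positivity)]
    have hc0 : 0 < c := by rw [hc]; exact Real.sqrt_pos.mpr (by positivity)
    refine ⟨hc0, hpt _ ?_ ?_⟩
    · rw [hA, mulVec_smul, smul_mulVec]
      simp only [Pi.smul_apply, smul_eq_mul]
      have : σ * (c * (G.det⁻¹ * (G.adjugate *ᵥ x) (Fin.last k))) =
          (σ * G.det) * (c * ((G.det⁻¹) ^ 2 * (G.adjugate *ᵥ x) (Fin.last k))) := by
        field_simp
      rw [this]
      have : 0 < (G.det⁻¹) ^ 2 := by positivity
      positivity
    · have := hêê (c • x)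
      rw [mulVec_smul, smul_dotProduct, dotProduct_smul, smul_eq_mul, smul_eq_mul] at this
      refine this.trans ?_
      have h1 : G.det⁻¹ * (c * (c * (x ⬝ᵥ (G.adjugate *ᵥ x)))) =
        G.det⁻¹ * (c ^ 2 * (x ⬝ᵥ (G.adjugate *ᵥ x))) := by ring
      rw [h1, hc2]
      field_simp
  have hadj : ∀ p q, (G.adjugate *ᵥ Pi.single p (1 : ℝ)) q = G.adjugate q p := by
    intro p q; simp
  have hα := fun p => hquad _ (Pi.single p 1) (by
    rw [single_dotProduct, hadj, one_mul]; exact h.adj_pos p p) rfl (by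
    rw [hadj]; exact h.adj_pos _ _)
  have hh := fun p => hquad _ (V p) (h.V_adj_V_pos p) rfl (h.adj_V_pos p _)
  set α : Fin (k + 1) → ℝ := fun p => Real.sqrt (σ * G.det /
    ((Pi.single p (1 : ℝ)) ⬝ᵥ (G.adjugate *ᵥ (Pi.single p (1 : ℝ))))) with hαdef
  set hgt : Fin (k + 1) → ℝ := fun p => Real.sqrt (σ * G.det /
    ((V p) ⬝ᵥ (G.adjugate *ᵥ (V p)))) with hhdef
  have hbal : ∀ w : Fin (k + 1) → ℝ, X.Balanced w := by
    intro w
    cases X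
    · exact absurd rfl hX
    · trivial
    · trivial
  have hnor : ∀ w : Fin (k + 1) → ℝ, X.Normalized w := by
    intro w
    cases X
    · exact absurd rfl hX
    · trivial
    · trivial
  have hcomb : ∀ c : Fin (k + 1) → ℝ,
      ê c = ∑ q, (c q / α q) • ê (α q • (Pi.single q 1 : Fin (k + 1) → ℝ)) := by
    intro c
    rw [hlin]
    refine Finset.sum_congr rfl fun q _ => ?_
    rw [← hsmul, smul_smul, div_mul_cancel₀ _ (hα q).1.ne']
  refine nonempty_frame_of_vectors (by omega) h.symm h.diag h.V_diag
    (fun p => ê (α p • Pi.single p 1)) nrm (fun p => ê (hgt p • V p)) m α hgt 0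
    (fun p => (hα p).1) (fun p => (hh p).1) (fun _ => rfl) hm hmn hnn (fun p => hmê _)
    (fun p => hmê _) (fun p q => ?_) (fun p q => ?_) (fun p => ?_) (fun p => hbal _)
    (fun p => ?_) (fun p => hnor _) (fun p => (hα p).2) fun p => (hh p).2
  · rw [hnê]
    simp [Pi.single_apply, eq_comm]
  · rw [hnê]
    simp
  · rw [hnrm]; exact hcomb _
  · exact hcomb _

open SpaceForm in
/-- The frame in `𝔼ⁿ`: now `G` is singular, and the positive vector in its kernel gives the linear
relation between the normals. -/
theorem nonempty_frame_euclidean (h : Admissible G V) (hk : 1 ≤ k) (hdet : G.det = 0) :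
    Nonempty (Frame euclidean G V) := by
  obtain ⟨B, w, hB, hBB, hw, hω⟩ := h.exists_factor
  rw [hdet] at hω
  have hyy : (B *ᵥ w) ⬝ᵥ (B *ᵥ w) = 1 := by
    have := (mul_eq_zero.mp hω).resolve_left (h.adj_pos _ _).ne'
    linarith
  -- the kernel vector
  set κ : Fin (k + 1) → ℝ := fun p => G.adjugate p (Fin.last k) with hκ
  have hκpos : ∀ p, 0 < κ p := fun p => h.adj_pos _ _
  have hGκ : ∀ p, ∑ q, G p q * κ q = 0 := by
    intro p
    have h1 := congrFun (congrFun (mul_adjugate G) p) (Fin.last k)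
    rw [hdet, zero_smul, mul_apply] at h1
    exact h1
  have hBBu : IsUnit (Bᵀ * B).det := by
    rw [det_mul, det_transpose]; exact hB.mul hB
  have hκw : ∀ i, κ (Fin.castSucc i) = -(w i * κ (Fin.last k)) := by
    have h1 : (Bᵀ * B) *ᵥ (fun i => κ (Fin.castSucc i) + w i * κ (Fin.last k)) = 0 := by
      ext i
      have h2 := hGκ (Fin.castSucc i)
      rw [Fin.sum_univ_castSucc, ← hw] at h2
      simp only [← hBB] at h2
      rw [Pi.zero_apply, ← h2]
      simp only [mulVec, dotProduct, mul_add, Finset.sum_add_distrib, Finset.sum_mul]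
      congr 1
      exact Finset.sum_congr rfl fun j _ => by ring
    have h3 := eq_zero_of_mulVec_eq_zero hBBu.ne_zero h1
    intro i
    have := congrFun h3 i
    simp only [Pi.zero_apply] at this
    linarith
  -- the first coordinate is that in the direction of `m`; the last vertex of `Δ` is the origin
  set vec : ℝ → (Fin k → ℝ) → euclidean.V (k + 1) := fun c v =>
    (WithLp.toLp 2 (Fin.cons c v : Fin (k + 1) → ℝ) : EuclideanSpace ℝ (Fin (k + 1))) with hvec
  have hform : ∀ c c' v v', euclidean.form (vec c v) (vec c' v') = c * c' + v ⬝ᵥ v' := by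
    intro c c' v v'
    have h0 : euclidean.form (vec c v) (vec c' v') =
        ∑ i : Fin (k + 1), inner ℝ ((vec c v) i) ((vec c' v') i) :=
      PiLp.inner_apply (vec c v) (vec c' v')
    rw [h0]
    simp only [hvec, Fin.sum_univ_succ, Fin.cons_zero, Fin.cons_succ,
      RCLike.inner_apply, conj_trivial, dotProduct]
    rw [mul_comm, Finset.sum_congr rfl fun i _ => mul_comm (v' i) (v i)]
  have hvsmul : ∀ (r : ℝ) v, r • vec 0 v = vec 0 (r • v) := by
    intro r v
    refine PiLp.ext fun i => ?_
    refine Fin.cases ?_ (fun j => ?_) i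
    · exact mul_zero r
    · rfl
  have hvadd : ∀ v v', vec 0 v + vec 0 v' = vec 0 (v + v') := by
    intro v v'
    refine PiLp.ext fun i => ?_
    refine Fin.cases ?_ (fun j => ?_) i
    · exact add_zero (0 : ℝ)
    · rfl
  have hv0 : vec 0 0 = 0 := by
    refine PiLp.ext fun i => ?_
    refine Fin.cases ?_ (fun j => ?_) i <;> rfl
  have hvsum : ∀ {ι : Type} (s : Finset ι) (f : ι → Fin k → ℝ),
      ∑ i ∈ s, vec 0 (f i) = vec 0 (∑ i ∈ s, f i) := by
    intro ι s f
    classical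
    induction s using Finset.induction_on with
    | empty => simp [hv0]
    | insert i s hi ih => rw [Finset.sum_insert hi, Finset.sum_insert hi, ih, hvadd]
  set dual : Fin k → Fin k → ℝ := fun i => (Bᵀ)⁻¹ *ᵥ Pi.single i 1 with hdual
  have hBt : IsUnit (Bᵀ).det := by rw [det_transpose]; exact hB
  have hexp : ∀ x : Fin k → ℝ, x = ∑ i, ((Bᵀ *ᵥ x) i) • dual i := by
    intro x
    have h1 : (Bᵀ)⁻¹ *ᵥ (Bᵀ *ᵥ x) = x := by
      rw [mulVec_mulVec, nonsing_inv_mul _ hBt, one_mulVec]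
    conv_lhs => rw [← h1]
    ext j
    simp [hdual, mulVec, dotProduct, mul_comm]
  have hdualB : ∀ i x, (B *ᵥ x) ⬝ᵥ dual i = x i := by
    intro i x
    rw [hdual, dotProduct_mulVec, ← mulVec_transpose, transpose_nonsing_inv, transpose_transpose,
      mulVec_mulVec, nonsing_inv_mul _ hB, one_mulVec]
    simp
  set nv : Fin (k + 1) → Fin k → ℝ := Fin.snoc (fun i => B *ᵥ Pi.single i 1) (B *ᵥ w) with hnv
  set av : Fin (k + 1) → Fin k → ℝ :=
    Fin.snoc (fun i => (κ (Fin.castSucc i))⁻¹ • dual i) 0 with hav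
  have hnn : ∀ p q, nv p ⬝ᵥ nv q = G p q := by
    have h1 : ∀ x y : Fin k → ℝ, (B *ᵥ x) ⬝ᵥ (B *ᵥ y) = x ⬝ᵥ ((Bᵀ * B) *ᵥ y) := by
      intro x y
      rw [← mulVec_mulVec, dotProduct_mulVec x, vecMul_transpose]
    intro p q
    refine Fin.lastCases ?_ (fun i => ?_) p <;> refine Fin.lastCases ?_ (fun j => ?_) q
    · simp only [hnv, Fin.snoc_last, hyy, h.diag]
    · simp only [hnv, Fin.snoc_last, Fin.snoc_castSucc]
      rw [dotProduct_comm, h1, single_dotProduct, hw, h.symm, one_mul]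
    · simp only [hnv, Fin.snoc_last, Fin.snoc_castSucc]
      rw [h1, single_dotProduct, hw, one_mul]
    · simp only [hnv, Fin.snoc_castSucc]
      rw [h1, single_dotProduct, one_mul, ← hBB]
      simp
  have hna : ∀ p q, nv q ⬝ᵥ av p + (Pi.single (Fin.last k) (κ (Fin.last k))⁻¹ : Fin (k + 1) → ℝ) q =
      if p = q then (κ p)⁻¹ else 0 := by
    intro p q
    refine Fin.lastCases ?_ (fun i => ?_) p <;> refine Fin.lastCases ?_ (fun j => ?_) q
    · simp [hnv, hav]
    · simp [hnv, hav, (Fin.castSucc_lt_last j).ne, (Fin.castSucc_lt_last j).ne']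
    · simp only [hnv, hav, Fin.snoc_last, Fin.snoc_castSucc, dotProduct_smul, hdualB,
        Pi.single_eq_same, (Fin.castSucc_lt_last i).ne, if_false, smul_eq_mul]
      have h1 := (hκpos (Fin.castSucc i)).ne'
      have h2 := (hκpos (Fin.last k)).ne'
      field_simp
      linarith [hκw i]
    · simp only [hnv, hav, Fin.snoc_castSucc, dotProduct_smul, hdualB, smul_eq_mul,
        Fin.castSucc_inj]
      by_cases hij : i = j
      · simp [hij, (Fin.castSucc_lt_last j).ne]
      · simp [hij, (Fin.castSucc_lt_last j).ne]
  have hnexp : ∀ p, nv p = ∑ q, (G p q * κ q) • av q := by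
    intro p
    rw [Fin.sum_univ_castSucc]
    simp only [hav, Fin.snoc_last, Fin.snoc_castSucc, smul_zero, add_zero, smul_smul]
    conv_lhs => rw [hexp (nv p)]
    refine Finset.sum_congr rfl fun i _ => ?_
    rw [mul_inv_cancel_right₀ (hκpos _).ne', h.symm, ← hnn]
    simp only [hnv, Fin.snoc_castSucc]
    congr 1
    rw [mulVec_single_one]
    rfl
  have hVκ : ∀ p, 0 < ∑ q, κ q * V p q := by
    intro p
    have h1 := h.adj_V_pos p (Fin.last k)
    have hGt : Gᵀ = G := by ext p q; exact h.symm q p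
    have h2 : ∀ q, G.adjugate (Fin.last k) q = κ q := by
      intro q
      have : (G.adjugate)ᵀ = G.adjugate := by rw [adjugate_transpose, hGt]
      exact congrFun (congrFun this q) (Fin.last k)
    simpa only [mulVec, dotProduct, h2] using h1
  set hgt : Fin (k + 1) → ℝ := fun p => (∑ q, κ q * V p q)⁻¹ with hhgt
  have hsumb : ∀ p, ∑ q, hgt p * V p q * κ q = 1 := by
    intro p
    have h1 : ∑ q, hgt p * V p q * κ q = hgt p * ∑ q, κ q * V p q := by
      rw [Finset.mul_sum]; exact Finset.sum_congr rfl fun q _ => by ring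
    rw [h1, hhgt, inv_mul_cancel₀ (hVκ p).ne']
  refine nonempty_frame_of_vectors (by omega) h.symm h.diag h.V_diag
    (fun p => vec 0 (av p)) (fun p => vec 0 (nv p))
    (fun p => vec 0 (∑ q, (hgt p * V p q * κ q) • av q)) (vec 1 0) (fun p => (κ p)⁻¹) hgt
    (Pi.single (Fin.last k) (κ (Fin.last k))⁻¹)
    (fun p => inv_pos.mpr (hκpos p)) (fun p => inv_pos.mpr (hVκ p)) (fun h => absurd rfl h)
    (by rw [hform]; simp) (fun p => by rw [hform]; simp) (fun p q => by rw [hform, hnn]; simp)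
    (fun p => by rw [hform]; simp) (fun p => by rw [hform]; simp)
    (fun p q => by rw [hform, zero_mul, zero_add, hna]) (fun p q => ?_) (fun p => ?_) (fun p => ?_)
    (fun p => ?_) (fun p => ?_) (fun p => trivial) fun p => trivial
  · rw [hform, zero_mul, zero_add, dotProduct_sum]
    -- the constant `o_q` is distributed over the vertices since the weights sum up to `1`
    have h1 := hsumb p
    calc _ = ∑ r, (hgt p * V p r * κ r) * (nv q ⬝ᵥ av r +
          (Pi.single (Fin.last k) (κ (Fin.last k))⁻¹ : Fin (k + 1) → ℝ) q) := by
          simp only [mul_add, Finset.sum_add_distrib, ← Finset.sum_mul, h1, one_mul,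
            dotProduct_smul, smul_eq_mul]
      _ = hgt p * V p q := by
          simp only [hna, mul_ite, mul_zero, Finset.sum_ite_eq', Finset.mem_univ, if_true]
          rw [mul_inv_cancel_right₀ (hκpos q).ne']
  · simp only [div_inv_eq_mul, hvsmul, hvsum]
    rw [← hnexp]
  · show ∑ q, G p q / (κ q)⁻¹ = 0
    simpa only [div_inv_eq_mul] using hGκ p
  · simp only [div_inv_eq_mul, hvsmul, hvsum]
  · show ∑ q, hgt p * V p q / (κ q)⁻¹ = 1
    simpa only [div_inv_eq_mul] using hsumb p

open SpaceForm in
/-- An admissible pair of matrices is realized in the space that is determined by the sign of the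
determinant. -/
theorem nonempty_frame (h : Admissible G V) (hk : 1 ≤ k) {X : SpaceForm}
    (hX : X.DetCondition G.det) : Nonempty (Frame X G V) := by
  cases X
  · exact h.nonempty_frame_euclidean hk hX
  · obtain ⟨v, τ, -, -, hv⟩ := h.exists_normals (σ := 1) (by norm_num)
      (by rw [one_mul]; exact hX)
    refine nonempty_frame_of_normals (by simp) h hk (σ := 1)
      (by rw [one_mul]; exact hX) (hvec 1 0 0)
      (fun p => hvec 0 (v p) (τ p)) ?_ ?_ ?_ ?_
    · rw [form_spherical_hvec]; simp
    · intro p; rw [form_spherical_hvec]; simp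
    · intro p q; rw [form_spherical_hvec, zero_mul, zero_add, hv]
    · intro c _ h1
      simp only [form, real_inner_self_eq_norm_sq] at h1
      simp only [points, mem_sphere_zero_iff_norm]
      exact (pow_left_inj₀ (norm_nonneg _) zero_le_one two_ne_zero).mp (by rw [h1, one_pow])
  · obtain ⟨v, τ, hτ, hτl, hv⟩ := h.exists_normals (σ := -1) (by norm_num)
      (by have : G.det < 0 := hX
          linarith)
    refine nonempty_frame_of_normals (by simp) h hk (σ := -1)
      (by have : G.det < 0 := hX
          linarith) (hvec 1 0 0)
      (fun p => hvec 0 (v p) (τ p)) ?_ ?_ ?_ ?_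
    · rw [form_lobachevsky_hvec]; simp
    · intro p; rw [form_lobachevsky_hvec]; simp
    · intro p q; rw [form_lobachevsky_hvec, zero_mul, zero_add, hv]
    · intro c hc h1
      refine ⟨h1, ?_⟩
      have h2 : (∑ r, c r • (hvec 0 (v r) (τ r) : lobachevsky.V (k + 1))) (Fin.last (k + 1)) =
          ∑ r, c r * τ r := by
        have h3 : ∀ (s : Finset (Fin (k + 1))),
            (∑ r ∈ s, c r • (hvec 0 (v r) (τ r) : lobachevsky.V (k + 1))) (Fin.last (k + 1)) =
              ∑ r ∈ s, c r * τ r := by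
          intro s
          induction s using Finset.induction_on with
          | empty => rfl
          | insert i s hi ih =>
            rw [Finset.sum_insert hi, Finset.sum_insert hi, ← ih]
            have : (hvec 0 (v i) (τ i) : EuclideanSpace ℝ (Fin (k + 1 + 1))) (Fin.last (k + 1)) =
              τ i := by simp [hvec]
            calc _ = c i * (hvec 0 (v i) (τ i) : EuclideanSpace ℝ (Fin (k + 1 + 1)))
                    (Fin.last (k + 1)) +
                  (∑ r ∈ s, c r • (hvec 0 (v r) (τ r) : lobachevsky.V (k + 1)))
                    (Fin.last (k + 1)) := rfl
              _ = _ := by rw [this]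
        exact h3 _
      refine lt_of_lt_of_eq ?_ h2.symm
      rw [Fin.sum_univ_castSucc]
      simp only [hτ, mul_zero, Finset.sum_const_zero, zero_add]
      nlinarith

end Admissible

/-! ### The configuration space of a frame -/

/-- The cosine of the dihedral angle `φ` with `tan (φ / 2) = t`. -/
noncomputable def cosOf (t : OnePoint ℝ) : ℝ :=
  1 - 2 * homCoord t 0 ^ 2 / (homCoord t 0 ^ 2 + homCoord t 1 ^ 2)

/-- The sine of the dihedral angle `φ` with `tan (φ / 2) = t`. -/
noncomputable def sinOf (t : OnePoint ℝ) : ℝ :=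
  2 * (homCoord t 0 * homCoord t 1) / (homCoord t 0 ^ 2 + homCoord t 1 ^ 2)

theorem cosOf_sq_add_sinOf_sq (t : OnePoint ℝ) : cosOf t ^ 2 + sinOf t ^ 2 = 1 := by
  have := (homCoord_sq_pos t).ne'
  unfold cosOf sinOf
  field_simp
  ring

namespace Frame

variable {X : SpaceForm} {n : ℕ} {G V : Matrix (Fin n) (Fin n) ℝ} (F : Frame X G V)

/-- The vertices of the butterfly with the given tangents of half the dihedral angles. -/
noncomputable def tuple (t : Fin n → OnePoint ℝ) : VertexTuple X n where
  a := F.a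
  b p := F.b₀ p + (F.h p * (cosOf (t p) - 1)) • F.nrm p + (F.h p * sinOf (t p)) • F.m

/-- A frame as a butterfly with prescribed initial position. -/
noncomputable def butterfly (t₀ : Fin n → OnePoint ℝ) : Butterfly (F.tuple t₀) where
  m := F.m
  nrm := F.nrm
  b₀ := F.b₀
  h := F.h
  m_unit := F.m_unit
  m_orthogonal := F.m_orthogonal
  nrm_inner := F.nrm_inner
  h_pos := F.h_pos
  b₀_mem := F.b₀_mem
  b_eq p := by
    have h1 : ‖(⟨cosOf (t₀ p), sinOf (t₀ p)⟩ : ℂ)‖ = 1 := by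
      rw [← sq_eq_sq₀ (norm_nonneg _) zero_le_one, one_pow, ← Complex.normSq_eq_norm_sq,
        Complex.normSq_mk, ← sq, ← sq, cosOf_sq_add_sinOf_sq]
    have h0 : (⟨cosOf (t₀ p), sinOf (t₀ p)⟩ : ℂ) ≠ 0 := fun h => by rw [h, norm_zero] at h1; simp at h1
    refine ⟨Complex.arg ⟨cosOf (t₀ p), sinOf (t₀ p)⟩, ?_⟩
    rw [Complex.cos_arg h0, Complex.sin_arg, h1, div_one, div_one]
    rfl

theorem position_butterfly (t₀ t : Fin n → OnePoint ℝ) :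
    (F.butterfly t₀).position t = F.tuple t := by
  unfold Butterfly.position tuple
  congr 1
  funext p
  have h1 : F.h p * (cosOf (t p) - 1) = -(2 * F.h p * homCoord (t p) 0 ^ 2 /
      (homCoord (t p) 0 ^ 2 + homCoord (t p) 1 ^ 2)) := by unfold cosOf; ring
  have h2 : F.h p * sinOf (t p) = 2 * F.h p * (homCoord (t p) 0 * homCoord (t p) 1) /
      (homCoord (t p) 0 ^ 2 + homCoord (t p) 1 ^ 2) := by unfold sinOf; ring
  rw [h1, h2, neg_smul, ← sub_eq_add_neg]
  rfl

theorem tuple_b_mem (t : Fin n → OnePoint ℝ) (p : Fin n) : (F.tuple t).b p ∈ X.points n :=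
  F.pos_mem p _ _ (cosOf_sq_add_sinOf_sq _)

theorem vertex_mem (t : Fin n → OnePoint ℝ) (i : Fin n ⊕ Fin n) :
    (F.tuple t).vertex i ∈ X.points n := by
  cases i
  · exact F.a_mem _
  · exact F.tuple_b_mem t _

theorem facet_mem (t : Fin n → OnePoint ℝ) (ε : Fin n → Bool) (p : Fin n) :
    (F.tuple t).facet ε p ∈ X.points n := by
  unfold VertexTuple.facet
  split_ifs
  · exact F.tuple_b_mem t p
  · exact F.a_mem p

end Frame

/-- The Gram matrix of the normals of the faces for which the relations between the dihedral angles
of a frame have the coefficients `m` and `e` in the coordinates `t_p` (if `χ p` is false) or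
`1 / t_p` (if `χ p` is true). -/
def gramOf {n : ℕ} (χ : Fin n → Bool) (m e : Fin n → Fin n → ℝ) : Matrix (Fin n) (Fin n) ℝ :=
  Matrix.of fun p q => if p = q then 1 else if χ p = χ q then m p q + m q p + e p q
    else -(m p q + m q p + e p q)

/-- The matrix of the positions of the vertices `b_p` for which the relations between the dihedral
angles of a frame have the coefficients `m` and `e`. -/
def vertOf {n : ℕ} (χ : Fin n → Bool) (m e : Fin n → Fin n → ℝ) : Matrix (Fin n) (Fin n) ℝ :=
  Matrix.of fun p q => if p = q then 1 else if χ p = χ q then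
    (if χ p then 2 * m q p else 2 * (m p q + e p q))
    else -(if χ p then 2 * m q p else 2 * (m p q + e p q))

/-- The matrix of the signed distances from the vertices of a facet to the faces `F_q`, up to
positive factors of the rows, for the dihedral angles `0` (if `χ p` is true) and `π` (if `χ p` is
false). -/
def limitMatrixOf {n : ℕ} (χ : Fin n → Bool) (G V : Matrix (Fin n) (Fin n) ℝ) (ε : Fin n → Bool) :
    Matrix (Fin n) (Fin n) ℝ := Matrix.of fun p q =>
  if ε p then V p q + (if χ p then 0 else -2) * G p q else (1 : Matrix _ _ ℝ) p q

namespace CurveData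

variable {X : SpaceForm} {n : ℕ} (D : CurveData n)

/-- The Gram matrix of the normals of the faces for a frame with the relations of the curve. -/
def gram : Matrix (Fin n) (Fin n) ℝ := gramOf D.χ D.m D.e

/-- The matrix of the positions of the vertices `b_p` for a frame with the relations of the curve. -/
def vert : Matrix (Fin n) (Fin n) ℝ := vertOf D.χ D.m D.e

/-- The constant by which the bracket of two vertices of a frame differs from the biquadratic
relation, up to factors. -/
def offset (p q : Fin n) : ℝ :=
  if D.χ p then (if D.χ q then 0 else -4 * D.m q p)
  else if D.χ q then -4 * D.m p q else 4 * D.e p q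

theorem e_symm (p q : Fin n) (hpq : p ≠ q) : D.e p q = D.e q p := by
  by_cases h : D.J p = D.J q
  · rw [D.e_within p q hpq h, D.e_within q p hpq.symm h.symm]
  · have h1 := D.e_between p q h
    have h2 := D.e_between q p (Ne.symm h)
    have h3 := D.between_pos p q
    refine mul_right_cancel₀ h3.ne' (h1.trans ?_)
    linear_combination -h2

/-- The edge `[b_p b_q]` of a frame has its prescribed length if and only if the biquadratic relation
holds: this is what the matrices `gramOf` and `vertOf` are chosen for. -/
theorem bracket_tuple (F : Frame X D.gram D.vert) (t : Fin n → OnePoint ℝ) {p q : Fin n}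
    (hpq : p ≠ q) : X.bracket ((F.tuple t).b p) ((F.tuple t).b q) = F.S p q + F.h p * F.h q *
      (4 * D.rel t p q / ((D.x₀ t p ^ 2 + D.x₁ t p ^ 2) * (D.x₀ t q ^ 2 + D.x₁ t q ^ 2))
        - D.offset p q) := by
  refine (F.bracket_pos p q _ _ _ _ hpq (cosOf_sq_add_sinOf_sq _)
    (cosOf_sq_add_sinOf_sq _)).trans ?_
  have hp := (homCoord_sq_pos (t p)).ne'
  have hq := (homCoord_sq_pos (t q)).ne'
  have hp' : homCoord (t p) 1 ^ 2 + homCoord (t p) 0 ^ 2 ≠ 0 := by rwa [add_comm]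
  have hq' : homCoord (t q) 1 ^ 2 + homCoord (t q) 0 ^ 2 ≠ 0 := by rwa [add_comm]
  have he := D.e_symm p q hpq
  congr 2
  unfold rel x₀ x₁ offset cosOf sinOf gram vert gramOf vertOf
  simp only [Matrix.of_apply, hpq, hpq.symm, if_false]
  cases h1 : D.χ p <;> cases h2 : D.χ q <;>
    simp only [xiCoord_false, xiCoord_true_zero, xiCoord_true_one, if_true, if_false,
      Bool.false_eq_true, reduceCtorEq, ← he] <;>
    field_simp <;> ring

/-- The configuration space of a frame is the set of solutions of the biquadratic relations. -/
theorem configSpace_butterfly (F : Frame X D.gram D.vert) {t₀ : Fin n → OnePoint ℝ}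
    (h₀ : t₀ ∈ D.relSet) : (F.butterfly t₀).configSpace = D.relSet := by
  ext t
  unfold Butterfly.configSpace relSet
  simp only [F.position_butterfly, Set.mem_ofPred_eq]
  refine forall_congr' fun p => forall_congr' fun q => forall_congr' fun hpq => ?_
  rw [SpaceForm.distance_eq_iff (F.tuple_b_mem _ _) (F.tuple_b_mem _ _) (F.tuple_b_mem _ _)
    (F.tuple_b_mem _ _), D.bracket_tuple F t hpq, D.bracket_tuple F t₀ hpq, h₀ p q hpq]
  have h1 : ∀ p, D.x₀ t p ^ 2 + D.x₁ t p ^ 2 ≠ 0 := by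
    intro p
    rcases D.x_ne_zero t p with h | h <;> positivity
  have hp := (F.h_pos p).ne'
  have hq := (F.h_pos q).ne'
  have h2 := h1 p
  have h3 := h1 q
  constructor
  · intro h
    have h4 := mul_left_cancel₀ (mul_ne_zero hp hq) (add_left_cancel h)
    simpa [h2, h3] using h4
  · intro h; simp [h]

/-- All edges keep their lengths in the configuration space; only the distances between `a_p` and
`b_p` vary. -/
theorem bracket_vertex (F : Frame X D.gram D.vert) {t t' : Fin n → OnePoint ℝ}
    (h : t ∈ D.relSet) (h' : t' ∈ D.relSet) {i j : Fin n ⊕ Fin n} (hij : j ≠ i.swap) :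
    X.bracket ((F.tuple t).vertex i) ((F.tuple t).vertex j) =
      X.bracket ((F.tuple t').vertex i) ((F.tuple t').vertex j) := by
  by_cases hij' : i = j
  · subst hij'
    exact SpaceForm.bracket_self (F.vertex_mem _ _) (F.vertex_mem _ _)
  have hab : ∀ p q, p ≠ q →
      X.bracket ((F.tuple t).a p) ((F.tuple t).b q) =
        X.bracket ((F.tuple t').a p) ((F.tuple t').b q) := fun p q hpq =>
    (F.bracket_a_pos_ne q p _ _ hpq.symm (cosOf_sq_add_sinOf_sq _)).trans
      (F.bracket_a_pos_ne q p _ _ hpq.symm (cosOf_sq_add_sinOf_sq _)).symm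
  rcases i with p | p <;> rcases j with q | q
  · rfl
  · exact hab p q fun h0 => hij (by rw [h0]; rfl)
  · have := hab q p fun h0 => hij (by rw [h0]; rfl)
    simp only [VertexTuple.vertex, Sum.elim_inl, Sum.elim_inr]
    rw [SpaceForm.bracket_comm, this, SpaceForm.bracket_comm]
  · have hpq : p ≠ q := fun h0 => hij' (by rw [h0])
    have h1 := D.bracket_tuple F t hpq
    have h2 := D.bracket_tuple F t' hpq
    rw [h p q hpq] at h1
    rw [h' p q hpq] at h2
    simp only [VertexTuple.vertex, Sum.elim_inr]
    rw [h1, h2]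
    simp

/-- The vertex of a facet as a member of the family of all vertices. -/
theorem facet_eq_vertex (P : VertexTuple X n) (ε : Fin n → Bool) (p : Fin n) :
    P.facet ε p = P.vertex (if ε p then Sum.inr p else Sum.inl p) := by
  unfold VertexTuple.facet
  split_ifs <;> rfl

theorem bracket_facet (F : Frame X D.gram D.vert) {t t' : Fin n → OnePoint ℝ}
    (h : t ∈ D.relSet) (h' : t' ∈ D.relSet) (ε ε' : Fin n → Bool) {p q : Fin n}
    (hpq : p = q → ε p = ε' p) :
    X.bracket ((F.tuple t).facet ε p) ((F.tuple t).facet ε' q) =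
      X.bracket ((F.tuple t').facet ε p) ((F.tuple t').facet ε' q) := by
  simp only [facet_eq_vertex]
  refine D.bracket_vertex F h h' ?_
  intro h0
  by_cases hpq' : p = q
  · subst hpq'
    rw [hpq rfl] at h0
    split_ifs at h0 <;> simp at h0
  · split_ifs at h0 <;> simp [eq_comm, hpq'] at h0

/-! ### The flex -/

/-- The distance of the cosine of the `p`-th dihedral angle from its limit `±1` for large
parameters. -/
noncomputable def dev (p : Fin n) (s : ℝ) : ℝ := 2 / ((D.u p * s - D.y p / s) ^ 2 + 1)

theorem cosOf_param {s : ℝ} (hs : 0 < s) (p : Fin n) : cosOf (D.param s p) - 1 =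
    (if D.χ p then 0 else -2) + (if D.χ p then -1 else 1) * D.dev p s := by
  obtain ⟨c, hc, h0, h1⟩ := D.exists_param s p
  have h2 : D.u p * s - D.y p / s = D.x₀ (D.param s) p / D.x₁ (D.param s) p := by
    have : D.u p * s - D.y p / s = (D.u p * s ^ 2 - D.y p) / s := by field_simp
    have h3 : c * D.x₀ (D.param s) p / s =
        c * D.x₀ (D.param s) p / (c * D.x₁ (D.param s) p) := by rw [← h1]
    rw [this, h0, h3, mul_div_mul_left _ _ hc]
  have hx₁ : D.x₁ (D.param s) p ≠ 0 := fun h => by rw [h, mul_zero] at h1; exact hs.ne' h1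
  have hp := (homCoord_sq_pos (D.param s p)).ne'
  unfold dev cosOf
  rw [h2]
  unfold x₀ x₁ at *
  cases hχ : D.χ p <;> simp only [hχ, xiCoord_false, xiCoord_true_zero, xiCoord_true_one, if_true,
    if_false, Bool.false_eq_true] at hx₁ ⊢
  · field_simp
    ring
  · have hp' : homCoord (D.param s p) 1 ^ 2 + homCoord (D.param s p) 0 ^ 2 ≠ 0 := by rwa [add_comm]
    field_simp
    ring

theorem sinOf_param (s : ℝ) (p : Fin n) : sinOf (D.param s p) =
    2 * ((D.u p * s ^ 2 - D.y p) * s) / ((D.u p * s ^ 2 - D.y p) ^ 2 + s ^ 2) := by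
  obtain ⟨c, hc, h0, h1⟩ := D.exists_param s p
  rw [h0]
  have h2 := D.x_ne_zero (D.param s) p
  have h3 : D.x₀ (D.param s) p ^ 2 + D.x₁ (D.param s) p ^ 2 ≠ 0 := by
    rcases h2 with h | h <;> positivity
  have hp := (homCoord_sq_pos (D.param s p)).ne'
  have hp' : homCoord (D.param s p) 1 ^ 2 + homCoord (D.param s p) 0 ^ 2 ≠ 0 := by rwa [add_comm]
  have h4 : 2 * (c * D.x₀ (D.param s) p * (c * D.x₁ (D.param s) p)) /
      ((c * D.x₀ (D.param s) p) ^ 2 + (c * D.x₁ (D.param s) p) ^ 2) =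
      2 * (D.x₀ (D.param s) p * D.x₁ (D.param s) p) /
        (D.x₀ (D.param s) p ^ 2 + D.x₁ (D.param s) p ^ 2) := by
    have : (c * D.x₀ (D.param s) p) ^ 2 + (c * D.x₁ (D.param s) p) ^ 2 ≠ 0 := by
      have : (c * D.x₀ (D.param s) p) ^ 2 + (c * D.x₁ (D.param s) p) ^ 2 =
        c ^ 2 * (D.x₀ (D.param s) p ^ 2 + D.x₁ (D.param s) p ^ 2) := by ring
      rw [this]; positivity
    field_simp
  rw [← h1] at h4
  rw [h4]
  unfold sinOf x₀ x₁
  cases hχ : D.χ p <;> simp only [xiCoord_false, xiCoord_true_zero, xiCoord_true_one]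
  rw [add_comm, mul_comm (homCoord _ 0)]

/-- Beyond the parameter for which `ξ_p = 0`, the `p`-th dihedral angle varies monotonically. -/
theorem dev_lt_dev {s s' : ℝ} {p : Fin n} (hs : 0 < s) (hsp : D.y p < D.u p * s ^ 2) (h : s < s') :
    D.dev p s' < D.dev p s := by
  have hu := D.u_pos p
  have hy := D.y_pos p
  have h1 : 0 < D.u p * s - D.y p / s := by
    rw [sub_pos, div_lt_iff₀ hs]; linarith
  have h2 : D.y p / s' < D.y p / s := div_lt_div_of_pos_left hy hs h
  have h3 : D.u p * s - D.y p / s < D.u p * s' - D.y p / s' := by nlinarith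
  unfold dev
  refine div_lt_div_of_pos_left two_pos (by positivity) ?_
  nlinarith

theorem tendsto_dev (p : Fin n) : Filter.Tendsto (D.dev p) Filter.atTop (nhds 0) := by
  have hu := D.u_pos p
  have h1 : Filter.Tendsto (fun s : ℝ => D.u p * s - D.y p / s) Filter.atTop Filter.atTop := by
    have h2 : Filter.Tendsto (fun s : ℝ => D.u p * s) Filter.atTop Filter.atTop :=
      Filter.tendsto_id.const_mul_atTop hu
    have h3 : Filter.Tendsto (fun s : ℝ => -(D.y p / s)) Filter.atTop (nhds (-0)) :=
      (Filter.tendsto_id.const_div_atTop (D.y p)).neg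
    simpa only [sub_eq_add_neg] using h2.atTop_add h3
  exact (Filter.tendsto_atTop_add_const_right _ 1 ((Filter.tendsto_pow_atTop two_ne_zero).comp
    h1)).const_div_atTop 2

theorem continuousOn_dev (p : Fin n) : ContinuousOn (D.dev p) (Set.Ioi 0) := by
  unfold dev
  refine ContinuousOn.div continuousOn_const (ContinuousOn.add (ContinuousOn.pow
    (ContinuousOn.sub (by fun_prop) (continuousOn_const.div continuousOn_id fun s hs => ?_)) 2)
    continuousOn_const) fun s _ => by positivity
  exact (Set.mem_Ioi.mp hs).ne'

/-- The limit of the matrix of the vertices of a facet for large parameters. -/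
def limitMatrix (ε : Fin n → Bool) : Matrix (Fin n) (Fin n) ℝ :=
  limitMatrixOf D.χ D.gram D.vert ε

/-- For large parameters all facets are non-degenerate: otherwise a determinant vanishes that
depends on the dihedral angles through their cosines only and tends to that of `limitMatrix`. -/
theorem eventually_generalPosition (F : Frame X D.gram D.vert)
    (hlim : ∀ ε, (D.limitMatrix ε).det ≠ 0) : ∀ᶠ s in Filter.atTop, ∀ ε,
      X.GeneralPosition ((F.tuple (D.param s)).facet ε) := by
  rw [Filter.eventually_all]
  intro ε
  have h1 : Filter.Tendsto (fun s : ℝ => (Matrix.of fun p q => if ε p then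
      D.vert p q + (cosOf (D.param s p) - 1) * D.gram p q else (1 : Matrix _ _ ℝ) p q).det)
      Filter.atTop (nhds (D.limitMatrix ε).det) := by
    refine ((continuous_id.matrix_det).tendsto _).comp ?_
    refine tendsto_pi_nhds.mpr fun p => tendsto_pi_nhds.mpr fun q => ?_
    simp only [limitMatrixOf, Matrix.of_apply]
    split_ifs with hε
    all_goals first | exact tendsto_const_nhds | skip
    all_goals
      refine tendsto_const_nhds.add (Filter.Tendsto.mul_const _ ?_)
      have h2 := ((D.tendsto_dev p).const_mul (if D.χ p then -1 else 1)).const_add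
        (if D.χ p then (0 : ℝ) else -2)
      rw [mul_zero, add_zero] at h2
      refine Filter.Tendsto.congr' ?_ (by simpa [*] using h2)
      filter_upwards [Filter.eventually_gt_atTop 0] with s hs
      rw [D.cosOf_param hs]
      simp [*]
  filter_upwards [h1.eventually_ne (hlim ε)] with s hs
  exact F.generalPosition ε _ (fun p => sinOf (D.param s p)) hs

/-- The cosine of a dihedral angle is a non-constant affine function of the bracket of the two
vertices opposite to the common face: the coefficients of the normals in the vertices do not vary in
the configuration space. -/
theorem exists_isDihedralAngle (hn : 2 ≤ n) (F : Frame X D.gram D.vert) {t₀ : Fin n → OnePoint ℝ}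
    (h₀ : t₀ ∈ D.relSet) (hgp : ∀ ε, X.GeneralPosition ((F.tuple t₀).facet ε)) (ε : Fin n → Bool)
    (p : Fin n) : ∃ K c : ℝ, c ≠ 0 ∧ ∀ t ∈ D.relSet, ∃ θ, (F.tuple t).IsDihedralAngle ε p θ ∧
      (θ = 0 ∨ θ = Real.pi → K + c * X.bracket ((F.tuple t).a p) ((F.tuple t).b p) = 1 ∨
        K + c * X.bracket ((F.tuple t).a p) ((F.tuple t).b p) = -1) := by
  obtain ⟨r₀, hr₀⟩ : ∃ r : Fin n, r ≠ p := by
    have : Nontrivial (Fin n) := Fin.nontrivial_iff_two_le.mpr hn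
    exact exists_ne p
  set ε' := Function.update ε p (!ε p) with hε'
  have hεq : ∀ q, q ≠ p → ε' q = ε q := fun q hq => Function.update_of_ne hq _ _
  have hfac : ∀ t q, q ≠ p → (F.tuple t).facet ε' q = (F.tuple t).facet ε q := fun t q hq => by
    unfold VertexTuple.facet; rw [hεq q hq]
  obtain ⟨w, hw⟩ := SpaceForm.exists_isNormalWeight hr₀ (F.facet_mem t₀ ε) (hgp ε)
  obtain ⟨w', hw'⟩ := SpaceForm.exists_isNormalWeight hr₀ (F.facet_mem t₀ ε') (hgp ε')
  set g : (Fin n → OnePoint ℝ) → Fin n → Fin n → ℝ := fun t i j =>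
    w i * w' j * X.bracket ((F.tuple t).facet ε i) ((F.tuple t).facet ε' j) with hg
  refine ⟨∑ i, ∑ j, (if i = p ∧ j = p then 0 else g t₀ i j), w p * w' p,
    mul_ne_zero hw.pos.ne' hw'.pos.ne', fun t ht => ?_⟩
  have hwt : X.IsNormalWeight ((F.tuple t).facet ε) p w :=
    hw.congr fun i j => D.bracket_facet F h₀ ht ε ε fun h => by rw [h]
  have hwt' : X.IsNormalWeight ((F.tuple t).facet ε') p w' :=
    hw'.congr fun i j => D.bracket_facet F h₀ ht ε' ε' fun h => by rw [h]
  have hμ := hwt.isInnerNormal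
  have hν := hwt'.isInnerNormal
  set μ := ∑ i, w i • (F.tuple t).facet ε i with hμdef
  set ν := ∑ i, w' i • (F.tuple t).facet ε' i with hνdef
  have hfeq : (fun q : {q : Fin n // q ≠ p} => (F.tuple t).facet ε' q) =
      fun q : {q : Fin n // q ≠ p} => (F.tuple t).facet ε q := funext fun q => hfac t q q.2
  rw [hfeq] at hν
  refine ⟨Real.arccos (X.form μ ν), ⟨μ, ν, hμ, hν, rfl⟩, fun hθ => ?_⟩
  have hpp : X.bracket ((F.tuple t).facet ε p) ((F.tuple t).facet ε' p) =
      X.bracket ((F.tuple t).a p) ((F.tuple t).b p) := by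
    unfold VertexTuple.facet
    rw [hε', Function.update_self]
    cases ε p
    · rfl
    · exact SpaceForm.bracket_comm _ _
  have hform : X.form μ ν = (∑ i, ∑ j, (if i = p ∧ j = p then 0 else g t₀ i j)) +
      w p * w' p * X.bracket ((F.tuple t).a p) ((F.tuple t).b p) := by
    rw [hμdef, hνdef, SpaceForm.form_sum_smul_sum_smul hwt.balanced hwt'.balanced]
    have h1 : ∀ i j, w i * w' j * X.bracket ((F.tuple t).facet ε i) ((F.tuple t).facet ε' j) =
        (if i = p ∧ j = p then 0 else g t₀ i j) + if i = p ∧ j = p then g t p p else 0 := by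
      intro i j
      by_cases hij : i = p ∧ j = p
      · rw [if_pos hij, if_pos hij, zero_add, hij.1, hij.2]
      · rw [if_neg hij, if_neg hij, add_zero, hg]
        dsimp only
        rw [D.bracket_facet F ht h₀ ε ε' fun h => ?_]
        rw [hεq]
        rintro rfl
        exact hij ⟨rfl, h.symm⟩
    simp only [h1, Finset.sum_add_distrib]
    congr 1
    rw [Finset.sum_eq_single p, Finset.sum_eq_single p]
    · rw [if_pos ⟨rfl, rfl⟩, hg]; dsimp only; rw [hpp]
    · intro j _ hj; rw [if_neg fun h => hj h.2]
    · simp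
    · intro i _ hi
      exact Finset.sum_eq_zero fun j _ => if_neg fun h => hi h.1
    · simp
  have hle : |X.form μ ν| ≤ 1 := by
    have horth : ∀ {v : X.V n}, X.Orthogonal
        (fun q : {q : Fin n // q ≠ p} => (F.tuple t).facet ε q) v →
        X = SpaceForm.lobachevsky → X.form ((F.tuple t).facet ε r₀) v = 0 := by
      intro v hv hX
      subst hX
      exact hv ⟨r₀, hr₀⟩
    exact SpaceForm.abs_form_le_one (F.facet_mem t ε r₀) hμ.1 hν.1 (horth hμ.2.1) (horth hν.2.1)
  rw [← hform]
  rw [abs_le] at hle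
  rcases hθ with h | h
  · exact Or.inl (le_antisymm hle.2 (Real.arccos_eq_zero.mp h))
  · exact Or.inr (le_antisymm (Real.arccos_eq_pi.mp h) hle.1)

/-- The only distances that vary along the curve, in terms of brackets. -/
theorem bracket_a_b (F : Frame X D.gram D.vert) {s : ℝ} (hs : 0 < s) (p : Fin n) :
    X.bracket ((F.tuple (D.param s)).a p) ((F.tuple (D.param s)).b p) =
      (F.S p p + F.H p * F.h p * (if D.χ p then 0 else -2)) +
        F.H p * F.h p * (if D.χ p then -1 else 1) * D.dev p s := by
  refine (F.bracket_a_pos p _ _ (cosOf_sq_add_sinOf_sq _)).trans ?_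
  rw [D.cosOf_param hs]
  ring

/-- A congruence of figures permutes the pairs of opposite vertices. -/
theorem exists_perm_of_figureCongruent {P Q : VertexTuple X n}
    (hP : ∀ i, P.vertex i ∈ X.points n) (hQ : ∀ i, Q.vertex i ∈ X.points n)
    (h : P.FigureCongruent Q) : ∃ ρ : Equiv.Perm (Fin n), ∀ p,
      X.bracket (P.a p) (P.b p) = X.bracket (Q.a (ρ p)) (Q.b (ρ p)) := by
  obtain ⟨σ, hσ, hc⟩ := h
  set r : Fin n → Fin n := fun p => (σ (Sum.inl p)).elim id id with hr
  have hswap : ∀ p, σ (Sum.inr p) = (σ (Sum.inl p)).swap := fun p => hσ (Sum.inl p)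
  have hinj : Function.Injective r := by
    intro p q hpq
    have h1 : σ (Sum.inl p) = σ (Sum.inl q) ∨ σ (Sum.inl p) = (σ (Sum.inl q)).swap := by
      simp only [hr] at hpq
      revert hpq
      rcases σ (Sum.inl p) with x | x <;> rcases σ (Sum.inl q) with y | y <;> simp
    rcases h1 with h1 | h1
    · simpa using σ.injective h1
    · rw [← hswap] at h1
      simpa using σ.injective h1
  refine ⟨Equiv.ofBijective r hinj.bijective_of_finite, fun p => ?_⟩
  have h1 := (SpaceForm.distance_eq_iff (hP _) (hP _) (hQ _) (hQ _)).mp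
    (hc (Sum.inl p) (Sum.inr p))
  refine h1.trans ?_
  rw [hswap]
  show _ = X.bracket (Q.a (r p)) (Q.b (r p))
  simp only [hr]
  rcases σ (Sum.inl p) with x | x
  · rfl
  · exact SpaceForm.bracket_comm _ _

/-- Two positions for large parameters are not congruent: their distances between opposite vertices
tend monotonically to limits, and the limits that are distinct are far from each other. -/
theorem eventually_not_figureCongruent (hn : 0 < n) (F : Frame X D.gram D.vert) :
    ∃ s₀ > 0, ∀ s s', s₀ ≤ s → s₀ ≤ s' →
      (F.tuple (D.param s)).FigureCongruent (F.tuple (D.param s')) → s = s' := by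
  set A : Fin n → ℝ := fun p => F.S p p + F.H p * F.h p * (if D.χ p then 0 else -2) with hA
  set B : Fin n → ℝ := fun p => F.H p * F.h p * (if D.χ p then -1 else 1) with hB
  have hB0 : ∀ p, 0 < |B p| := by
    intro p
    have h1 := F.H_pos p
    have h2 := F.h_pos p
    rw [abs_pos, hB]
    dsimp only
    split_ifs <;> simp [h1.ne', h2.ne']
  have hgap : ∀ᶠ s in Filter.atTop, ∀ p q, A p ≠ A q → |B p * D.dev p s| < |A p - A q| / 2 ∧
      |B q * D.dev q s| < |A p - A q| / 2 := by
    simp only [Filter.eventually_all]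
    intro p q hpq
    have h1 : 0 < |A p - A q| / 2 := half_pos (abs_pos.mpr (sub_ne_zero.mpr hpq))
    have h2 : ∀ r, ∀ᶠ s in Filter.atTop, |B r * D.dev r s| < |A p - A q| / 2 := by
      intro r
      have h3 := ((D.tendsto_dev r).const_mul (B r)).abs
      rw [mul_zero, abs_zero] at h3
      exact h3.eventually_lt_const h1
    exact (h2 p).and (h2 q)
  have hlarge : ∀ᶠ s in Filter.atTop, ∀ p, D.y p < D.u p * s ^ 2 := by
    rw [Filter.eventually_all]
    intro p
    exact ((Filter.tendsto_pow_atTop two_ne_zero).const_mul_atTop (D.u_pos p)).eventually_gt_atTop _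
  obtain ⟨s₀, hs₀⟩ := Filter.eventually_atTop.mp
    ((hgap.and hlarge).and (Filter.eventually_gt_atTop 0))
  refine ⟨s₀, (hs₀ s₀ le_rfl).2, fun s s' hs hs' hcong => ?_⟩
  have hsp := (hs₀ s hs).2
  have hsp' := (hs₀ s' hs').2
  obtain ⟨ρ, hρ⟩ := exists_perm_of_figureCongruent (F.vertex_mem _) (F.vertex_mem _) hcong
  have hρ' : ∀ p, A p + B p * D.dev p s = A (ρ p) + B (ρ p) * D.dev (ρ p) s' := by
    intro p
    have := hρ p
    rwa [D.bracket_a_b F hsp, D.bracket_a_b F hsp'] at this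
  have hAρ : ∀ p, A p = A (ρ p) := by
    intro p
    by_contra hne
    have h1 := ((hs₀ s hs).1.1 p (ρ p) hne).1
    have h2 := ((hs₀ s' hs').1.1 p (ρ p) hne).2
    have h3 : A p - A (ρ p) = B (ρ p) * D.dev (ρ p) s' - B p * D.dev p s := by
      linear_combination hρ' p
    have h4 := abs_sub (B (ρ p) * D.dev (ρ p) s') (B p * D.dev p s)
    rw [← h3] at h4
    linarith
  have hdev : ∀ p s, 0 < D.dev p s := fun p s => by unfold dev; positivity
  have hsum : ∑ p, |B p| * D.dev p s = ∑ p, |B p| * D.dev p s' := by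
    rw [← Equiv.sum_comp ρ (fun p => |B p| * D.dev p s')]
    refine Finset.sum_congr rfl fun p _ => ?_
    have h1 : B p * D.dev p s = B (ρ p) * D.dev (ρ p) s' := by
      linear_combination hρ' p - hAρ p
    rw [← abs_of_pos (hdev p s), ← abs_of_pos (hdev (ρ p) s'), ← abs_mul, ← abs_mul, h1]
  have hanti : ∀ {s s' : ℝ}, s₀ ≤ s → s < s' →
      ∑ p, |B p| * D.dev p s' < ∑ p, |B p| * D.dev p s := by
    intro s s' hs h
    refine Finset.sum_lt_sum_of_nonempty ⟨⟨0, hn⟩, Finset.mem_univ _⟩ fun p _ => ?_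
    exact mul_lt_mul_of_pos_left (D.dev_lt_dev (hs₀ s hs).2 ((hs₀ s hs).1.2 p) h) (hB0 p)
  rcases lt_trichotomy s s' with h | h | h
  · exact absurd hsum (hanti hs h).ne'
  · exact h
  · exact absurd hsum (hanti hs' h).ne

theorem continuousOn_vertex (F : Frame X D.gram D.vert) (i : Fin n ⊕ Fin n) :
    ContinuousOn (fun s => (F.tuple (D.param s)).vertex i) (Set.Ioi 0) := by
  rcases i with p | p
  · exact continuousOn_const
  · have hcos : ContinuousOn (fun s => cosOf (D.param s p) - 1) (Set.Ioi 0) := by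
      refine ContinuousOn.congr ?_ fun s hs => D.cosOf_param hs p
      exact continuousOn_const.add (continuousOn_const.mul (D.continuousOn_dev p))
    have hsin : ContinuousOn (fun s => sinOf (D.param s p)) (Set.Ioi 0) := by
      simp only [sinOf_param]
      refine ContinuousOn.div (by fun_prop) (by fun_prop) fun s hs => ?_
      have : 0 < s := hs
      positivity
    exact (continuousOn_const.add ((continuousOn_const.mul hcos).smul continuousOn_const)).add
      ((continuousOn_const.mul hsin).smul continuousOn_const)

/-- The position of a frame for a large parameter `s₀` of the curve is a flexible cross-polytope;
the flex is given by the parameters in `[s₀, s₀ + 1]`. -/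
theorem exists_isFlexibleOfType (hn : 2 ≤ n) (F : Frame X D.gram D.vert)
    (hlim : ∀ ε, (D.limitMatrix ε).det ≠ 0) {π : n.Partition} (hπ : HasType D.curve π) :
    ∃ P : VertexTuple X n, IsFlexibleOfType P π := by
  have hn0 : 0 < n := by omega
  obtain ⟨s₁, hs₁, hcong⟩ := D.eventually_not_figureCongruent hn0 F
  obtain ⟨s₂, hs₂⟩ := Filter.eventually_atTop.mp (D.eventually_generalPosition F hlim)
  have hlarge : ∀ᶠ s in Filter.atTop, ∀ p, D.y p < D.u p * s ^ 2 := by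
    rw [Filter.eventually_all]
    intro p
    exact ((Filter.tendsto_pow_atTop two_ne_zero).const_mul_atTop (D.u_pos p)).eventually_gt_atTop _
  obtain ⟨s₃, hs₃⟩ := Filter.eventually_atTop.mp hlarge
  set s₀ := max s₁ (max s₂ s₃) with hs₀
  have hs₀1 : s₁ ≤ s₀ := le_max_left _ _
  have hs₀2 : s₂ ≤ s₀ := (le_max_left _ _).trans (le_max_right _ _)
  have hs₀3 : s₃ ≤ s₀ := (le_max_right _ _).trans (le_max_right _ _)
  have hrel : ∀ s, D.param s ∈ D.relSet := fun s => D.curve_subset_relSet ⟨s, rfl⟩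
  set s : unitInterval → ℝ := fun u => s₀ + u with hs
  have hsge : ∀ u, s₀ ≤ s u := fun u => le_add_of_nonneg_right u.2.1
  have hspos : ∀ u, 0 < s u := fun u => hs₁.trans_le (hs₀1.trans (hsge u))
  have hsinj : Function.Injective s := fun u v h => Subtype.ext (add_left_cancel h)
  have hcross : ∀ u, (F.tuple (D.param (s u))).IsCrossPolytope := fun u =>
    ⟨F.vertex_mem _, hs₂ _ (hs₀2.trans (hsge u))⟩
  have hconf := D.configSpace_butterfly F (hrel (s 0))
  refine ⟨F.tuple (D.param (s 0)), hcross 0, F.butterfly (D.param (s 0)), D.curve, ?_, ?_,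
    D.isEssentialSubset_curve, hπ, fun u => D.param (s u), fun u => ⟨_, rfl⟩,
    F.position_butterfly _ _, ?_⟩
  · rw [hconf]; exact D.isIrreducibleComponent_curve hn0
  · exact algebraicDim_eq_one (D.isAlgebraicSubset_curve hn0) (D.curve_infinite hn0)
      fun Z hZ => D.curve_subset_or_finite hZ
  simp only [F.position_butterfly]
  refine ⟨⟨hcross, fun i => ?_, fun u v ε p q => ?_, 1, one_pos, fun u v huv _ h => ?_⟩, ?_⟩
  · exact (D.continuousOn_vertex F i).comp_continuous (by fun_prop) fun u => hspos u
  · rw [SpaceForm.distance_eq_iff (F.facet_mem _ _ _) (F.facet_mem _ _ _) (F.facet_mem _ _ _)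
      (F.facet_mem _ _ _)]
    exact D.bracket_facet F (hrel _) (hrel _) ε ε fun h => by rw [h]
  · exact huv (hsinj (hcong _ _ (hs₀1.trans (hsge u)) (hs₀1.trans (hsge v)) h))
  · -- each dihedral angle is `0` or `π` for at most two parameters
    have hfin : ∀ ε p, {u : unitInterval | ¬ ∃ θ, (F.tuple (D.param (s u))).IsDihedralAngle ε p θ ∧
        θ ≠ 0 ∧ θ ≠ Real.pi}.Finite := by
      intro ε p
      obtain ⟨K, c, hc, h⟩ := D.exists_isDihedralAngle hn F (hrel (s 0)) (hcross 0).2 ε p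
      have hsub : ∀ z : ℝ, {u : unitInterval | K + c * X.bracket ((F.tuple (D.param (s u))).a p)
          ((F.tuple (D.param (s u))).b p) = z}.Subsingleton := by
        intro z u hu v hv
        have h1 := hu.trans hv.symm
        have h2 := mul_left_cancel₀ hc (add_left_cancel h1)
        rw [D.bracket_a_b F (hspos u), D.bracket_a_b F (hspos v)] at h2
        have h3 : F.H p * F.h p * (if D.χ p then -1 else 1) ≠ 0 := by
          have h1 := (F.H_pos p).ne'
          have h2 := (F.h_pos p).ne'
          split_ifs <;> simp [h1, h2]
        have h4 := mul_left_cancel₀ h3 (add_left_cancel h2)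
        rcases lt_trichotomy (s u) (s v) with hlt | heq | hlt
        · exact absurd h4 (D.dev_lt_dev (hspos u) (hs₃ _ (hs₀3.trans (hsge u)) p) hlt).ne'
        · exact hsinj heq
        · exact absurd h4 (D.dev_lt_dev (hspos v) (hs₃ _ (hs₀3.trans (hsge v)) p) hlt).ne
      refine ((hsub 1).finite.union (hsub (-1)).finite).subset fun u hu => ?_
      obtain ⟨θ, hθ, hθ'⟩ := h _ (hrel (s u))
      refine hθ' ?_
      by_contra! hne
      exact hu ⟨θ, hθ, hne⟩
    refine (Set.finite_iUnion fun ε => Set.finite_iUnion (hfin ε)).subset fun u hu => ?_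
    unfold VertexTuple.IsEssential at hu
    simp only [Set.mem_ofPred_eq, not_forall] at hu
    obtain ⟨ε, p, hu⟩ := hu
    exact Set.mem_iUnion.mpr ⟨ε, Set.mem_iUnion.mpr ⟨p, hu⟩⟩

end CurveData

/-! ### Admissibility near the degenerate matrices -/

section Admissible

open Matrix Filter Topology

/-- Positive definiteness is an open condition. -/
theorem eventually_forall_dotProduct_mulVec_pos {k : ℕ} {A₀ : Matrix (Fin k) (Fin k) ℝ}
    (h : ∀ x : Fin k → ℝ, x ≠ 0 → 0 < x ⬝ᵥ (A₀ *ᵥ x)) :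
    ∀ᶠ A in 𝓝 A₀, ∀ x : Fin k → ℝ, x ≠ 0 → 0 < x ⬝ᵥ (A *ᵥ x) := by
  have h1 : ∀ᶠ A in 𝓝 A₀, ∀ x ∈ Metric.sphere (0 : Fin k → ℝ) 1, 0 < x ⬝ᵥ (A *ᵥ x) := by
    refine (isCompact_sphere (0 : Fin k → ℝ) 1).eventually_forall_of_forall_eventually ?_
    intro x hx
    have hx0 : x ≠ 0 := by rintro rfl; simp at hx
    have hc : Continuous fun z : Matrix (Fin k) (Fin k) ℝ × (Fin k → ℝ) =>
        z.2 ⬝ᵥ (z.1 *ᵥ z.2) :=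
      continuous_snd.dotProduct (continuous_fst.matrix_mulVec continuous_snd)
    exact (hc.tendsto (A₀, x)).eventually_const_lt (h x hx0)
  filter_upwards [h1] with A hA x hx
  have hx' : 0 < ‖x‖ := norm_pos_iff.mpr hx
  have h2 := hA (‖x‖⁻¹ • x) (by simp [norm_smul, hx'.ne'])
  rw [mulVec_smul, smul_dotProduct, dotProduct_smul, smul_eq_mul, smul_eq_mul] at h2
  have h3 : 0 < ‖x‖⁻¹ := inv_pos.mpr hx'
  exact pos_of_mul_pos_right (pos_of_mul_pos_right h2 h3.le) h3.le

/-- Admissibility is an open condition for pairs of matrices that are subject to the three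
equations. -/
theorem Admissible.eventually {k : ℕ} {G₀ V₀ : Matrix (Fin (k + 1)) (Fin (k + 1)) ℝ}
    (h : Admissible G₀ V₀) : ∀ᶠ z in 𝓝 (G₀, V₀), (∀ p q, z.1 p q = z.1 q p) → (∀ p, z.1 p p = 1) →
      (∀ p, z.2 p p = 1) → Admissible z.1 z.2 := by
  have hG : Continuous fun z : Matrix (Fin (k + 1)) (Fin (k + 1)) ℝ ×
      Matrix (Fin (k + 1)) (Fin (k + 1)) ℝ => z.1.adjugate := continuous_fst.matrix_adjugate
  have hV : ∀ p, Continuous fun z : Matrix (Fin (k + 1)) (Fin (k + 1)) ℝ ×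
      Matrix (Fin (k + 1)) (Fin (k + 1)) ℝ => z.2 p := fun p =>
    (continuous_apply p).comp continuous_snd
  have hGV : ∀ p, Continuous fun z : Matrix (Fin (k + 1)) (Fin (k + 1)) ℝ ×
      Matrix (Fin (k + 1)) (Fin (k + 1)) ℝ => z.1.adjugate *ᵥ z.2 p := fun p =>
    hG.matrix_mulVec (hV p)
  have h1 : ∀ᶠ z in 𝓝 (G₀, V₀), ∀ x : Fin k → ℝ, x ≠ 0 →
      0 < x ⬝ᵥ (z.1.submatrix Fin.castSucc Fin.castSucc *ᵥ x) :=
    ((continuous_fst.matrix_submatrix Fin.castSucc Fin.castSucc).tendsto (G₀, V₀)).eventually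
      (eventually_forall_dotProduct_mulVec_pos h.minor_pos)
  have h2 : ∀ᶠ z in 𝓝 (G₀, V₀), ∀ p q, 0 < z.1.adjugate p q := by
    simp only [eventually_all]
    exact fun p q => ((hG.matrix_elem p q).tendsto (G₀, V₀)).eventually_const_lt (h.adj_pos p q)
  have h3 : ∀ᶠ z in 𝓝 (G₀, V₀), ∀ p q, 0 < (z.1.adjugate *ᵥ z.2 p) q := by
    simp only [eventually_all]
    exact fun p q => (((continuous_apply q).comp (hGV p)).tendsto (G₀, V₀)).eventually_const_lt
      (h.adj_V_pos p q)
  have h4 : ∀ᶠ z in 𝓝 (G₀, V₀), ∀ p, 0 < z.2 p ⬝ᵥ (z.1.adjugate *ᵥ z.2 p) := by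
    simp only [eventually_all]
    exact fun p => (((hV p).dotProduct (hGV p)).tendsto (G₀, V₀)).eventually_const_lt
      (h.V_adj_V_pos p)
  filter_upwards [h1, h2, h3, h4] with z hz1 hz2 hz3 hz4 hs hd hv
  exact ⟨hs, hd, hv, hz1, hz2, hz3, hz4⟩

theorem eventually_limitMatrixOf_det_ne_zero {n : ℕ} {χ : Fin n → Bool}
    {G₀ V₀ : Matrix (Fin n) (Fin n) ℝ} {ε : Fin n → Bool} (h : (limitMatrixOf χ G₀ V₀ ε).det ≠ 0) :
    ∀ᶠ z in 𝓝 (G₀, V₀), (limitMatrixOf χ z.1 z.2 ε).det ≠ 0 := by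
  have hc : Continuous fun z : Matrix (Fin n) (Fin n) ℝ × Matrix (Fin n) (Fin n) ℝ =>
      (limitMatrixOf χ z.1 z.2 ε).det := by
    refine Continuous.matrix_det (continuous_pi fun p => continuous_pi fun q => ?_)
    simp only [limitMatrixOf, Matrix.of_apply]
    have h1 : Continuous fun z : Matrix (Fin n) (Fin n) ℝ × Matrix (Fin n) (Fin n) ℝ => z.1 p q :=
      continuous_fst.matrix_elem p q
    have h2 : Continuous fun z : Matrix (Fin n) (Fin n) ℝ × Matrix (Fin n) (Fin n) ℝ => z.2 p q :=
      continuous_snd.matrix_elem p q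
    split_ifs
    · exact h2.add (continuous_const.mul h1)
    · exact h2.add (continuous_const.mul h1)
    · exact continuous_const
  exact hc.continuousAt.eventually_ne h

/-- A normalized weight matrix of a connected graph: symmetric, non-negative, with a positive
eigenvector `κ` for the eigenvalue `1`. Connectedness is stated for functions: a function that is
constant along the edges is constant. -/
structure IsNormalizedWeight {n : ℕ} (N : Matrix (Fin n) (Fin n) ℝ) (κ : Fin n → ℝ) : Prop where
  symm : ∀ p q, N p q = N q p
  diag : ∀ p, N p p = 0
  nonneg : ∀ p q, 0 ≤ N p q
  pos : ∀ p, 0 < κ p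
  eigen : ∀ p, ∑ q, N p q * κ q = κ p
  connected : ∀ f : Fin n → ℝ, (∀ p q, N p q ≠ 0 → f p = f q) → ∀ p q, f p = f q

namespace IsNormalizedWeight

variable {n : ℕ} {N : Matrix (Fin n) (Fin n) ℝ} {κ : Fin n → ℝ}

/-- The quadratic form of `1 - N` is the Dirichlet form of the graph. -/
theorem two_mul_dotProduct (h : IsNormalizedWeight N κ) (x : Fin n → ℝ) : 2 * (x ⬝ᵥ ((1 - N) *ᵥ x)) =
    ∑ p, ∑ q, N p q * κ p * κ q * (x p / κ p - x q / κ q) ^ 2 := by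
  have h0 : ∀ p q, N p q * κ p * κ q * (x p / κ p - x q / κ q) ^ 2 =
      (N p q * κ q) * (x p ^ 2 / κ p) + (N q p * κ p) * (x q ^ 2 / κ q) -
        2 * (x p * (N p q * x q)) := by
    intro p q
    have hp := (h.pos p).ne'
    have hq := (h.pos q).ne'
    rw [h.symm q p]
    field_simp
    ring
  simp only [h0, Finset.sum_sub_distrib, Finset.sum_add_distrib]
  rw [Finset.sum_comm (f := fun p q => (N q p * κ p) * (x q ^ 2 / κ q))]
  simp only [← Finset.sum_mul, h.eigen]
  have h1 : ∀ p, κ p * (x p ^ 2 / κ p) = x p * x p := fun p => by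
    have hp := (h.pos p).ne'
    field_simp
  simp only [h1]
  rw [sub_mulVec, one_mulVec, dotProduct_sub]
  simp only [dotProduct, mulVec, ← Finset.mul_sum]
  ring

/-- The quadratic form of `1 - N` is non-negative and vanishes only on the multiples of `κ`. -/
theorem eq_smul_of_dotProduct_nonpos (h : IsNormalizedWeight N κ) {x : Fin n → ℝ}
    (hx : x ⬝ᵥ ((1 - N) *ᵥ x) ≤ 0) (p q : Fin n) : x p / κ p = x q / κ q := by
  have h0 := h.two_mul_dotProduct x
  have hnn : ∀ p q, 0 ≤ N p q * κ p * κ q * (x p / κ p - x q / κ q) ^ 2 := fun p q => by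
    have := h.nonneg p q; have := h.pos p; have := h.pos q; positivity
  have hz : ∑ p, ∑ q, N p q * κ p * κ q * (x p / κ p - x q / κ q) ^ 2 = 0 :=
    le_antisymm (by linarith) (Finset.sum_nonneg fun p _ => Finset.sum_nonneg fun q _ => hnn p q)
  refine h.connected (fun p => x p / κ p) (fun p q hpq => ?_) p q
  have h1 := (Finset.sum_eq_zero_iff_of_nonneg fun p _ =>
    Finset.sum_nonneg fun q _ => hnn p q).mp hz p (Finset.mem_univ _)
  have h2 := (Finset.sum_eq_zero_iff_of_nonneg fun q _ => hnn p q).mp h1 q (Finset.mem_univ _)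
  have hne : N p q * κ p * κ q ≠ 0 :=
    mul_ne_zero (mul_ne_zero hpq (h.pos p).ne') (h.pos q).ne'
  exact sub_eq_zero.mp (pow_eq_zero_iff two_ne_zero |>.mp ((mul_eq_zero.mp h2).resolve_left hne))

theorem one_sub_smul_mulVec (h : IsNormalizedWeight N κ) (θ : ℝ) :
    (1 - θ • N) *ᵥ κ = (1 - θ) • κ := by
  have hN : N *ᵥ κ = κ := funext fun p => h.eigen p
  rw [sub_mulVec, one_mulVec, smul_mulVec, hN, sub_smul, one_smul]

/-- If the adjugate matrix is positive, then `det (1 - θ N)` has the sign of `1 - θ`. -/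
theorem det_mul_eq (h : IsNormalizedWeight N κ) (θ : ℝ) (p : Fin n) : (1 - θ • N).det * κ p =
    (1 - θ) * ((1 - θ • N).adjugate *ᵥ κ) p := by
  have h1 := congrArg (fun v => (1 - θ • N).adjugate *ᵥ v) (h.one_sub_smul_mulVec θ)
  simp only [mulVec_mulVec, adjugate_mul, smul_mulVec, one_mulVec, mulVec_smul] at h1
  exact congrFun h1 p

/-- For `θ = 1` the degenerate pair of matrices is admissible: `1 - N` is singular and positive
semidefinite, and its adjugate matrix is a positive multiple of `κ κᵀ`. -/
theorem admissible_one_sub {k : ℕ} {N : Matrix (Fin (k + 1)) (Fin (k + 1)) ℝ}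
    {κ : Fin (k + 1) → ℝ} (h : IsNormalizedWeight N κ) : Admissible (1 - N) 1 := by
  have hsymm : ∀ p q, (1 - N) p q = (1 - N) q p := fun p q => by
    simp only [Matrix.sub_apply, h.symm p q, one_apply, eq_comm]
  have hminor : ∀ x : Fin k → ℝ, x ≠ 0 →
      0 < x ⬝ᵥ ((1 - N).submatrix Fin.castSucc Fin.castSucc *ᵥ x) := by
    intro x hx
    by_contra! hle
    refine hx (funext fun i => ?_)
    have h1 : (Fin.snoc x 0 : Fin (k + 1) → ℝ) ⬝ᵥ ((1 - N) *ᵥ (Fin.snoc x 0 : Fin (k + 1) → ℝ)) =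
        x ⬝ᵥ ((1 - N).submatrix Fin.castSucc Fin.castSucc *ᵥ x) := by
      simp [dotProduct, mulVec, Fin.sum_univ_castSucc]
    have h2 := h.eq_smul_of_dotProduct_nonpos (h1.le.trans hle) (Fin.castSucc i) (Fin.last k)
    rw [Fin.snoc_last, Fin.snoc_castSucc, zero_div, div_eq_zero_iff] at h2
    exact h2.resolve_right (h.pos _).ne'
  have hdet : (1 - N).det = 0 := by
    have h1 := h.det_mul_eq 1 0
    rw [one_smul, sub_self, zero_mul] at h1
    exact (mul_eq_zero.mp h1).resolve_right (h.pos _).ne'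
  -- the columns of the adjugate matrix are multiples of `κ`
  have hcol : ∀ p q r, (1 - N).adjugate p r / κ p = (1 - N).adjugate q r / κ q := by
    intro p q r
    refine h.eq_smul_of_dotProduct_nonpos (x := fun p => (1 - N).adjugate p r) (le_of_eq ?_) p q
    have h1 : (1 - N) *ᵥ (fun p => (1 - N).adjugate p r) = 0 := by
      have := mul_adjugate (1 - N)
      rw [hdet, zero_smul] at this
      exact funext fun p => congrFun (congrFun this p) r
    rw [h1, dotProduct_zero]
  have hadjs : ∀ p q, (1 - N).adjugate p q = (1 - N).adjugate q p := by
    intro p q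
    have h1 : (1 - N)ᵀ = 1 - N := by ext p q; exact hsymm q p
    have h2 : (1 - N).adjugateᵀ = (1 - N).adjugate := by rw [adjugate_transpose, h1]
    exact congrFun (congrFun h2 q) p
  have hlast : 0 < (1 - N).adjugate (Fin.last k) (Fin.last k) := by
    have h1 : (1 - N).adjugate (Fin.last k) (Fin.last k) =
        ((1 - N).submatrix Fin.castSucc Fin.castSucc).det := by
      rw [adjugate_fin_succ_eq_det_submatrix, ← two_mul, pow_mul]
      simp [Fin.succAbove_last]
    rw [h1]
    refine (Matrix.PosDef.of_dotProduct_mulVec_pos ?_ fun x hx => ?_ :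
      ((1 - N).submatrix Fin.castSucc Fin.castSucc).PosDef).det_pos
    · ext i j
      simpa using hsymm (Fin.castSucc j) (Fin.castSucc i)
    · simpa using hminor x hx
  have hadj : ∀ p q, 0 < (1 - N).adjugate p q := by
    have h1 : ∀ p, 0 < (1 - N).adjugate p (Fin.last k) := by
      intro p
      have h2 := hcol p (Fin.last k) (Fin.last k)
      have h3 : 0 < (1 - N).adjugate p (Fin.last k) / κ p := by
        rw [h2]; exact div_pos hlast (h.pos _)
      exact (div_pos_iff_of_pos_right (h.pos p)).mp h3
    intro p q
    have h2 := hcol p (Fin.last k) q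
    have h3 : 0 < (1 - N).adjugate p q / κ p := by
      rw [h2, hadjs]; exact div_pos (h1 q) (h.pos _)
    exact (div_pos_iff_of_pos_right (h.pos p)).mp h3
  have hone : ∀ p q, ((1 - N).adjugate *ᵥ (1 : Matrix _ _ ℝ) p) q = (1 - N).adjugate q p := by
    intro p q
    have : (1 : Matrix (Fin (k + 1)) (Fin (k + 1)) ℝ) p = Pi.single p 1 := by
      ext q; simp [one_apply, Pi.single_apply, eq_comm]
    rw [this]; simp
  refine ⟨hsymm, fun p => by simp [h.diag], fun p => by simp, hminor, hadj,
    fun p q => by rw [hone]; exact hadj _ _, fun p => ?_⟩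
  have : (1 : Matrix (Fin (k + 1)) (Fin (k + 1)) ℝ) p = Pi.single p 1 := by
    ext q; simp [one_apply, Pi.single_apply, eq_comm]
  rw [this, single_dotProduct, one_mul, ← this, hone]
  exact hadj _ _

end IsNormalizedWeight

/-- If the graph is bipartite, then for the degenerate pair of matrices the limit matrix of each
facet is an involution: it agrees with `2 N - 1` in the rows of the vertices `b_p` with `χ p` false,
and with `1` in the other rows. -/
theorem limitMatrixOf_det_ne_zero {n : ℕ} {N : Matrix (Fin n) (Fin n) ℝ} {χ : Fin n → Bool}
    (hχ : ∀ p q, N p q ≠ 0 → χ p ≠ χ q) (ε : Fin n → Bool) : (limitMatrixOf χ (1 - N) 1 ε).det ≠ 0 := by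
  have h1 : limitMatrixOf χ (1 - N) 1 ε * limitMatrixOf χ (1 - N) 1 ε = 1 := by
    ext p r
    rw [mul_apply]
    set S : Fin n → Bool := fun p => ε p && !χ p with hS
    have hM : ∀ p q, limitMatrixOf χ (1 - N) 1 ε p q = if S p then
        -(1 : Matrix _ _ ℝ) p q + 2 * N p q else (1 : Matrix _ _ ℝ) p q := by
      intro p q
      simp only [limitMatrixOf, of_apply, Matrix.sub_apply, hS]
      cases ε p <;> cases χ p <;> simp
      ring
    by_cases hp : S p
    · have h2 : ∀ q, limitMatrixOf χ (1 - N) 1 ε p q * limitMatrixOf χ (1 - N) 1 ε q r =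
          -(1 : Matrix _ _ ℝ) p q * limitMatrixOf χ (1 - N) 1 ε q r +
            2 * N p q * (1 : Matrix _ _ ℝ) q r := by
        intro q
        rw [hM p q, if_pos hp, add_mul]
        congr 1
        by_cases hN : N p q = 0
        · rw [hN]; ring
        · have hq : ¬ S q = true := by
            have := hχ p q hN
            simp only [hS, Bool.and_eq_true, Bool.not_eq_true'] at hp ⊢
            rw [hp.2] at this
            rintro ⟨-, h⟩
            exact this h.symm
          rw [hM q r, if_neg hq]
      simp only [h2, Finset.sum_add_distrib, one_apply, neg_mul, ite_mul, one_mul, zero_mul,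
        Finset.sum_neg_distrib, Finset.sum_ite_eq, Finset.mem_univ, if_true, mul_ite, mul_one,
        mul_zero, Finset.sum_ite_eq']
      rw [hM p r, if_pos hp, one_apply]
      ring
    · simp only [hM p, if_neg hp, one_apply, ite_mul, one_mul, zero_mul, Finset.sum_ite_eq,
        Finset.mem_univ, if_true]
  intro h0
  have h2 := congrArg det h1
  rw [det_mul, h0, det_one, mul_zero] at h2
  exact zero_ne_one h2

end Admissible

/-! ### A tree with prescribed blocks -/

/-- The vertices of a tree in the form of pairs `(J, K)`: the vertices with the same `J` form a
block, the one with `K = 0` is the centre of its block, and the blocks are numbered without gaps. -/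
structure BlockIndexing (n : ℕ) where
  J : Fin n → ℕ
  K : Fin n → ℕ
  inj : ∀ p q, J p = J q → K p = K q → p = q
  centre : ∀ p, K p ≠ 0 → ∃ r, J r = J p ∧ K r = 0
  prev : ∀ p, J p ≠ 0 → ∃ r, J r + 1 = J p ∧ K r = 0

namespace BlockIndexing

variable {n : ℕ} (T : BlockIndexing n)

/-- The centres of consecutive blocks are joined by an edge, and so are the centre of a block and
any other vertex of the block. -/
def Adj (p q : Fin n) : Prop :=
  (T.K p = 0 ∧ T.K q = 0 ∧ (T.J q = T.J p + 1 ∨ T.J p = T.J q + 1)) ∨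
    (T.J p = T.J q ∧ ((T.K p = 0 ∧ T.K q ≠ 0) ∨ (T.K q = 0 ∧ T.K p ≠ 0)))

/-- The bipartition of the tree; true for centres of blocks with odd numbers and for the other
members of blocks with even numbers. -/
def χ (p : Fin n) : Bool := decide ((T.J p + if T.K p = 0 then 0 else 1) % 2 = 1)

theorem Adj.symm {p q : Fin n} (h : T.Adj p q) : T.Adj q p := by
  unfold Adj at *; omega

theorem Adj.χ_ne {p q : Fin n} (h : T.Adj p q) : T.χ p ≠ T.χ q := by
  unfold Adj at h
  unfold χ
  rw [Ne, decide_eq_decide]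
  split_ifs <;> omega

theorem not_adj_self (p : Fin n) : ¬ T.Adj p p := fun h => h.χ_ne T rfl

/-- The tree is connected. -/
theorem eq_of_forall_adj (f : Fin n → ℝ) (hf : ∀ p q, T.Adj p q → f p = f q) (p q : Fin n) :
    f p = f q := by
  have key : ∀ N, ∀ p, 2 * T.J p + (if T.K p = 0 then 0 else 1) = N →
      ∃ r, T.J r = 0 ∧ T.K r = 0 ∧ f p = f r := by
    intro N
    induction N using Nat.strong_induction_on with
    | _ N ih =>
      intro p hp
      by_cases hK : T.K p = 0
      · by_cases hJ : T.J p = 0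
        · exact ⟨p, hJ, hK, rfl⟩
        · obtain ⟨r, hr, hrK⟩ := T.prev p hJ
          obtain ⟨r', h1, h2, h3⟩ := ih (2 * T.J r + if T.K r = 0 then 0 else 1)
            (by rw [if_pos hrK]; rw [if_pos hK] at hp; omega) r rfl
          exact ⟨r', h1, h2, (hf p r (Or.inl ⟨hK, hrK, Or.inr hr.symm⟩)).trans h3⟩
      · obtain ⟨r, hr, hrK⟩ := T.centre p hK
        obtain ⟨r', h1, h2, h3⟩ := ih (2 * T.J r + if T.K r = 0 then 0 else 1)
          (by rw [if_pos hrK]; rw [if_neg hK] at hp; omega) r rfl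
        exact ⟨r', h1, h2, (hf p r (Or.inr ⟨hr.symm, Or.inr ⟨hrK, hK⟩⟩)).trans h3⟩
  obtain ⟨r, h1, h2, h3⟩ := key _ p rfl
  obtain ⟨r', h1', h2', h3'⟩ := key _ q rfl
  rw [h3, h3', T.inj r r' (h1.trans h1'.symm) (h2.trans h2'.symm)]

open Classical in
/-- The square roots of the degrees form the eigenvector of the normalized adjacency matrix. -/
noncomputable def κ (p : Fin n) : ℝ := Real.sqrt (Finset.card {q | T.Adj p q})

open Classical in
/-- The normalized adjacency matrix of the tree. -/
noncomputable def N : Matrix (Fin n) (Fin n) ℝ :=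
  Matrix.of fun p q => if T.Adj p q then (T.κ p * T.κ q)⁻¹ else 0

theorem adj_of_N_ne_zero {p q : Fin n} (h : T.N p q ≠ 0) : T.Adj p q := by
  by_contra h0
  exact h (if_neg h0)

theorem κ_pos (hn : 2 ≤ n) (p : Fin n) : 0 < T.κ p := by
  classical
  rw [κ, Real.sqrt_pos, Nat.cast_pos, Finset.card_pos]
  by_contra h
  rw [Finset.not_nonempty_iff_eq_empty, Finset.filter_eq_empty_iff] at h
  have : Nontrivial (Fin n) := Fin.nontrivial_iff_two_le.mpr hn
  obtain ⟨q, hq⟩ := exists_ne p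
  have h1 := T.eq_of_forall_adj (Pi.single p 1) (fun a b hab => ?_) p q
  · simp [hq] at h1
  · have ha : a ≠ p := by rintro rfl; exact h (Finset.mem_univ b) hab
    have hb : b ≠ p := by rintro rfl; exact h (Finset.mem_univ a) (hab.symm T)
    simp [ha, hb]

theorem isNormalizedWeight (hn : 2 ≤ n) : IsNormalizedWeight T.N T.κ := by
  classical
  have hκ := T.κ_pos hn
  refine ⟨fun p q => ?_, fun p => if_neg (T.not_adj_self p), fun p q => ?_, hκ, fun p => ?_,
    fun f hf => T.eq_of_forall_adj f fun p q hpq => hf p q ?_⟩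
  · have : T.Adj p q ↔ T.Adj q p := ⟨fun h => h.symm T, fun h => h.symm T⟩
    simp only [N, Matrix.of_apply, this, mul_comm]
  · have := hκ p; have := hκ q
    simp only [N, Matrix.of_apply]
    split_ifs <;> positivity
  · have h1 : ∀ q, T.N p q * T.κ q = if T.Adj p q then (T.κ p)⁻¹ else 0 := fun q => by
      have := (hκ q).ne'
      simp only [N, Matrix.of_apply]
      split_ifs
      · field_simp
      · rw [zero_mul]
    simp only [h1]
    rw [← Finset.sum_filter, Finset.sum_const, nsmul_eq_mul]
    have h2 : T.κ p ^ 2 = (Finset.card {q | T.Adj p q} : ℝ) := Real.sq_sqrt (Nat.cast_nonneg _)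
    rw [← h2]
    have := (hκ p).ne'
    field_simp
  · have h1 := (hκ p).ne'
    have h2 := (hκ q).ne'
    simp [N, hpq, h1, h2]

/-! ### The degenerating family of curves -/

/-- A bound for the numbers `J` and `K`. -/
def b : ℕ := ∑ p, (T.J p + T.K p) + 1

theorem lt_b (p : Fin n) : T.J p < T.b ∧ T.K p < T.b := by
  have := Finset.single_le_sum (f := fun p => T.J p + T.K p) (fun _ _ => Nat.zero_le _)
    (Finset.mem_univ p)
  unfold b
  omega

/-- The part of the exponents that distinguishes the members of a block. It is less than `2 b`; its
value is `b` for the centre, at most `b` in blocks with even numbers, and at least `b` in the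
others. -/
def shift (p : Fin n) : ℕ := if T.J p % 2 = 0 then T.b - T.K p else T.b + T.K p

/-- The exponents of the numbers `u`, which are monomials in `ε` up to coefficients, and likewise `eb`
for the numbers `y`. They are chosen such that
* `ea - eb` is constant on each block, so that `u_p / y_p` is constant there;
* `ea` increases and `eb` decreases with the number of the block, except that the centres of the
  blocks `2 i` and `2 i + 1` have the same `ea`, and the centres of the blocks `2 i + 1` and
  `2 i + 2` have the same `eb`. Hence, for `ε = 0`, the quotients `u_q / u_p` and `y_p / y_q`, where
  `q` belongs to the later block, vanish unless `p` and `q` are the centres of consecutive blocks;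
  then one of them does not. -/
def ea (p : Fin n) : ℕ := 2 * T.b * (T.J p / 2) + T.shift p

/-- The exponents of the numbers `y`. -/
def eb (p : Fin n) : ℕ := 2 * T.b * (T.b - (T.J p + 1) / 2) + T.shift p

theorem shift_pos (p : Fin n) : 0 < T.shift p := by
  have := T.lt_b p
  unfold shift
  split_ifs <;> omega

/-- The exponents `ea` of two blocks coincide only for the centres of the blocks `2 i` and
`2 i + 1`. -/
theorem ea_lt_or {p q : Fin n} (h : T.J p < T.J q) : T.ea p < T.ea q ∨
    (T.ea p = T.ea q ∧ T.J p % 2 = 0 ∧ T.J q = T.J p + 1 ∧ T.K p = 0 ∧ T.K q = 0) := by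
  have hp := T.lt_b p
  have hq := T.lt_b q
  unfold ea shift
  rcases (Nat.div_le_div_right h.le : T.J p / 2 ≤ T.J q / 2).lt_or_eq with h1 | h1
  · obtain ⟨d, hd⟩ := Nat.exists_eq_add_of_lt h1
    rw [hd, mul_add, mul_add, mul_one]
    left
    have := Nat.zero_le (2 * T.b * d)
    split_ifs <;> omega
  · rw [h1]
    split_ifs <;> omega

/-- The exponents `eb` of two blocks coincide only for the centres of the blocks `2 i + 1` and
`2 i + 2`. -/
theorem eb_lt_or {p q : Fin n} (h : T.J p < T.J q) : T.eb q < T.eb p ∨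
    (T.eb p = T.eb q ∧ T.J p % 2 = 1 ∧ T.J q = T.J p + 1 ∧ T.K p = 0 ∧ T.K q = 0) := by
  have hp := T.lt_b p
  have hq := T.lt_b q
  unfold eb shift
  rcases (Nat.div_le_div_right (by omega) : (T.J p + 1) / 2 ≤ (T.J q + 1) / 2).lt_or_eq with h1 | h1
  · obtain ⟨d, hd⟩ := Nat.exists_eq_add_of_lt h1
    have h2 : T.b - (T.J p + 1) / 2 = (T.b - (T.J q + 1) / 2) + d + 1 := by omega
    rw [h2, mul_add, mul_add, mul_one]
    left
    have := Nat.zero_le (2 * T.b * d)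
    split_ifs <;> omega
  · rw [h1]
    split_ifs <;> omega

theorem ea_add_eb {p q : Fin n} (h : T.J p = T.J q) : T.ea p + T.eb q = T.ea q + T.eb p := by
  unfold ea eb
  rw [h]
  ring

theorem ea_lt_iff {p q : Fin n} (h : T.J p = T.J q) : T.ea q < T.ea p ↔
    if T.J p % 2 = 0 then T.K p < T.K q else T.K q < T.K p := by
  have hp := T.lt_b p
  have hq := T.lt_b q
  unfold ea shift
  rw [h]
  split_ifs <;> omega

theorem ea_ne {p q : Fin n} (h : T.J p = T.J q) (hpq : p ≠ q) : T.ea p ≠ T.ea q := by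
  intro h0
  have hp := T.lt_b p
  have hq := T.lt_b q
  refine hpq (T.inj p q h ?_)
  unfold ea shift at h0
  rw [h] at h0
  split_ifs at h0 <;> omega

/-- The value of `κ` at the centre of the block with the number `j`, and `1` if there is no such
block. -/
noncomputable def κJ (j : ℕ) : ℝ := ∏ p with T.J p = j ∧ T.K p = 0, T.κ p

theorem κJ_pos (hn : 2 ≤ n) (j : ℕ) : 0 < T.κJ j := Finset.prod_pos fun p _ => T.κ_pos hn p

theorem κJ_eq {p : Fin n} (hK : T.K p = 0) : T.κJ (T.J p) = T.κ p := by
  unfold κJ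
  have : Finset.univ.filter (fun q => T.J q = T.J p ∧ T.K q = 0) = {p} := by
    ext q
    simp only [Finset.mem_filter, Finset.mem_univ, true_and, Finset.mem_singleton]
    constructor
    · rintro ⟨h1, h2⟩; exact T.inj q p h1 (h2.trans hK.symm)
    · rintro rfl; exact ⟨rfl, hK⟩
  rw [this, Finset.prod_singleton]

/-- The coefficients of the numbers `u`; the quotient for the blocks `2 i + 1` and `2 i` is
`θ N_pq`, where `p` and `q` are their centres. -/
noncomputable def U (θ : ℝ) (j : ℕ) : ℝ := if j % 2 = 1 then θ * (T.κJ (j - 1) * T.κJ j)⁻¹ else 1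

/-- The coefficients of the numbers `y`; the quotient for the blocks `2 i + 1` and `2 i + 2` is
`θ N_pq`, where `p` and `q` are their centres. -/
noncomputable def Y (θ : ℝ) (j : ℕ) : ℝ := if j % 2 = 1 then θ * (T.κJ j * T.κJ (j + 1))⁻¹ else 1

theorem U_pos (hn : 2 ≤ n) {θ : ℝ} (hθ : 0 < θ) (j : ℕ) : 0 < T.U θ j := by
  have h1 := T.κJ_pos hn j
  have h2 := T.κJ_pos hn (j - 1)
  unfold U
  split_ifs <;> positivity

theorem Y_pos (hn : 2 ≤ n) {θ : ℝ} (hθ : 0 < θ) (j : ℕ) : 0 < T.Y θ j := by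
  have h1 := T.κJ_pos hn j
  have h2 := T.κJ_pos hn (j + 1)
  unfold Y
  split_ifs <;> positivity

/-- The numbers `u` of the family with the parameter `z = (ε, θ)`. -/
noncomputable def u (z : ℝ × ℝ) (p : Fin n) : ℝ := T.U z.2 (T.J p) * z.1 ^ T.ea p

/-- The numbers `y` of the family. -/
noncomputable def y (z : ℝ × ℝ) (p : Fin n) : ℝ := T.Y z.2 (T.J p) * z.1 ^ T.eb p

/-- The quotient `u_q / u_p`, for `J p < J q`, in a form that makes sense for `ε = 0`. -/
noncomputable def R₁ (z : ℝ × ℝ) (p q : Fin n) : ℝ :=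
  T.U z.2 (T.J q) / T.U z.2 (T.J p) * z.1 ^ (T.ea q - T.ea p)

/-- The quotient `y_p / y_q`, for `J p < J q`, in a form that makes sense for `ε = 0`. -/
noncomputable def R₂ (z : ℝ × ℝ) (p q : Fin n) : ℝ :=
  T.Y z.2 (T.J p) / T.Y z.2 (T.J q) * z.1 ^ (T.eb p - T.eb q)

/-- The coefficients `m` of the family. Between blocks they are `u_p y_p / (u_p y_q + u_q y_p)`,
with numerator and denominator divided by one of the two products. Within a block, one of `m_pq` and
`m_qp` is set to `θ N_pq`, and the other one, which tends to zero with `ε`, is found from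
`m_within`. -/
noncomputable def m (z : ℝ × ℝ) (p q : Fin n) : ℝ :=
  if T.J p < T.J q then T.R₂ z p q / (1 + T.R₁ z p q * T.R₂ z p q)
  else if T.J q < T.J p then T.R₁ z q p / (1 + T.R₁ z q p * T.R₂ z q p)
  else if T.ea q < T.ea p then
    z.1 ^ (T.ea p - T.ea q) - z.2 * T.N p q * (z.1 ^ (T.ea p - T.ea q)) ^ 2
  else z.2 * T.N p q

/-- The coefficients `e` of the family, with the same normalization. -/
noncomputable def e (z : ℝ × ℝ) (p q : Fin n) : ℝ :=
  if T.J p < T.J q then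
    T.u z p * T.y z q * (1 - T.R₁ z p q * T.R₂ z p q) ^ 2 / (1 + T.R₁ z p q * T.R₂ z p q)
  else if T.J q < T.J p then
    T.u z q * T.y z p * (1 - T.R₁ z q p * T.R₂ z q p) ^ 2 / (1 + T.R₁ z q p * T.R₂ z q p)
  else 0

/-- The range of the parameters `(ε, θ)`, including the degenerate value `ε = 0`. -/
def domain : Set (ℝ × ℝ) := Set.Ici 0 ×ˢ Set.Ioi 0

theorem u_eq_R₁_mul (hn : 2 ≤ n) {z : ℝ × ℝ} (hz : 0 < z.2) {p q : Fin n} (h : T.J p < T.J q) :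
    T.u z q = T.R₁ z p q * T.u z p := by
  have hU := (T.U_pos hn hz (T.J p)).ne'
  have hle : T.ea p ≤ T.ea q := by
    rcases T.ea_lt_or h with h | h
    exacts [h.le, h.1.le]
  unfold u R₁
  rw [← pow_sub_mul_pow z.1 hle]
  field_simp

theorem y_eq_R₂_mul (hn : 2 ≤ n) {z : ℝ × ℝ} (hz : 0 < z.2) {p q : Fin n} (h : T.J p < T.J q) :
    T.y z p = T.R₂ z p q * T.y z q := by
  have hY := (T.Y_pos hn hz (T.J q)).ne'
  have hle : T.eb q ≤ T.eb p := by
    rcases T.eb_lt_or h with h | h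
    exacts [h.le, h.1.ge]
  unfold y R₂
  rw [← pow_sub_mul_pow z.1 hle]
  field_simp

theorem u_eq_pow_mul {z : ℝ × ℝ} {p q : Fin n} (h : T.J p = T.J q) (hlt : T.ea q < T.ea p) :
    T.u z p = z.1 ^ (T.ea p - T.ea q) * T.u z q := by
  unfold u
  rw [← pow_sub_mul_pow z.1 hlt.le, h]
  ring

theorem R_nonneg (hn : 2 ≤ n) {z : ℝ × ℝ} (hz : z ∈ domain) (p q : Fin n) :
    0 ≤ T.R₁ z p q * T.R₂ z p q := by
  have h1 : 0 ≤ z.1 := hz.1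
  have h2 : 0 < z.2 := hz.2
  have := T.U_pos hn h2 (T.J p)
  have := T.U_pos hn h2 (T.J q)
  have := T.Y_pos hn h2 (T.J p)
  have := T.Y_pos hn h2 (T.J q)
  unfold R₁ R₂
  positivity

/-- The member of the family for `ε > 0`. The first of the last two hypotheses says that the curve
separates the blocks, the second one that the linear factors of a relation within a block are
distinct. -/
noncomputable def curveData (hn : 2 ≤ n) (z : ℝ × ℝ) (hz₁ : 0 < z.1) (hz₂ : 0 < z.2)
    (h₁ : ∀ p q, T.J p < T.J q → T.R₁ z p q * T.R₂ z p q < 1)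
    (h₂ : ∀ p q, T.ea q < T.ea p → 2 * (z.2 * T.N p q * z.1 ^ (T.ea p - T.ea q)) < 1) :
    CurveData n :=
  have hu : ∀ p, 0 < T.u z p := fun p => mul_pos (T.U_pos hn hz₂ _) (pow_pos hz₁ _)
  have hy : ∀ p, 0 < T.y z p := fun p => mul_pos (T.Y_pos hn hz₂ _) (pow_pos hz₁ _)
  have hR : ∀ p q, 0 ≤ T.R₁ z p q * T.R₂ z p q := T.R_nonneg hn ⟨hz₁.le, hz₂⟩
  have hR' : ∀ p q, 1 + T.R₁ z p q * T.R₂ z p q ≠ 0 := fun p q => by linarith [hR p q]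
  have hlt : ∀ p q, T.J p < T.J q → T.u z q * T.y z p < T.u z p * T.y z q := fun p q h => by
    rw [T.u_eq_R₁_mul hn hz₂ h, T.y_eq_R₂_mul hn hz₂ h]
    have := mul_lt_mul_of_pos_right (h₁ p q h) (mul_pos (hu p) (hy q))
    linarith
  have hblock : ∀ p q, p ≠ q → T.J p = T.J q →
      T.m z q p * T.u z p ^ 2 + T.m z p q * T.u z q ^ 2 = T.u z p * T.u z q ∧
        T.m z p q * T.u z q ^ 2 ≠ T.m z q p * T.u z p ^ 2 := by
    have key : ∀ p q, T.J p = T.J q → T.ea q < T.ea p →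
        T.m z q p * T.u z p ^ 2 + T.m z p q * T.u z q ^ 2 = T.u z p * T.u z q ∧
          T.m z p q * T.u z q ^ 2 ≠ T.m z q p * T.u z p ^ 2 := fun p q h hlt => by
      have h3 : T.N q p = T.N p q := (T.isNormalizedWeight hn).symm q p
      simp only [m, h, lt_irrefl, if_false, hlt, hlt.not_gt, if_true, T.u_eq_pow_mul h hlt, h3]
      have h4 := h₂ p q hlt
      have h5 : 0 < z.1 ^ (T.ea p - T.ea q) := pow_pos hz₁ _
      refine ⟨by ring, fun h0 => ?_⟩
      have h6 : z.1 ^ (T.ea p - T.ea q) * T.u z q ^ 2 *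
          (1 - 2 * (z.2 * T.N p q * z.1 ^ (T.ea p - T.ea q))) = 0 := by linear_combination h0
      have h7 : 0 < z.1 ^ (T.ea p - T.ea q) * T.u z q ^ 2 :=
        mul_pos h5 (pow_pos (hu q) 2)
      rcases mul_eq_zero.mp h6 with h8 | h8
      · exact h7.ne' h8
      · linarith
    intro p q hpq h
    rcases lt_or_gt_of_ne (T.ea_ne h hpq) with h1 | h1
    · obtain ⟨h2, h3⟩ := key q p h.symm h1
      exact ⟨by linarith, h3.symm⟩
    · exact key p q h h1
  { J := T.J
    χ := T.χ
    u := T.u z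
    y := T.y z
    m := T.m z
    e := T.e z
    u_pos := hu
    y_pos := hy
    J_eq_iff := fun p q => by
      constructor
      · intro h
        have h1 := T.ea_add_eb h
        unfold u y
        rw [h]
        have h2 : z.1 ^ T.ea p * z.1 ^ T.eb q = z.1 ^ T.ea q * z.1 ^ T.eb p := by
          rw [← pow_add, ← pow_add, h1]
        linear_combination T.U z.2 (T.J q) * T.Y z.2 (T.J q) * h2
      · intro h
        rcases lt_trichotomy (T.J p) (T.J q) with h1 | h1 | h1
        · exact absurd h (hlt p q h1).ne'
        · exact h1
        · exact absurd h (hlt q p h1).ne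
    m_between := fun p q h => by
      rcases lt_or_gt_of_ne h with h1 | h1
      · simp only [m, h1, if_true]
        have h2 := hR' p q
        rw [T.u_eq_R₁_mul hn hz₂ h1, T.y_eq_R₂_mul hn hz₂ h1]
        rw [div_mul_eq_mul_div, div_eq_iff h2]
        ring
      · simp only [m, h1, h1.not_gt, if_true, if_false]
        have h2 := hR' q p
        rw [T.u_eq_R₁_mul hn hz₂ h1, T.y_eq_R₂_mul hn hz₂ h1]
        rw [div_mul_eq_mul_div, div_eq_iff h2]
        ring
    e_between := fun p q h => by
      rcases lt_or_gt_of_ne h with h1 | h1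
      · simp only [e, h1, if_true]
        have h2 := hR' p q
        rw [T.u_eq_R₁_mul hn hz₂ h1, T.y_eq_R₂_mul hn hz₂ h1]
        rw [div_mul_eq_mul_div, div_eq_iff h2]
        ring
      · simp only [e, h1, h1.not_gt, if_true, if_false]
        have h2 := hR' q p
        rw [T.u_eq_R₁_mul hn hz₂ h1, T.y_eq_R₂_mul hn hz₂ h1]
        rw [div_mul_eq_mul_div, div_eq_iff h2]
        ring
    m_within := fun p q hpq h => (hblock p q hpq h).1
    m_within_ne := fun p q hpq h => (hblock p q hpq h).2
    e_within := fun p q _ h => by simp [e, h] }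

/-! ### The limit of the family and the sign of the determinant -/

theorem continuous_U (j : ℕ) : Continuous fun z : ℝ × ℝ => T.U z.2 j := by
  unfold U
  split_ifs <;> fun_prop

theorem continuous_Y (j : ℕ) : Continuous fun z : ℝ × ℝ => T.Y z.2 j := by
  unfold Y
  split_ifs <;> fun_prop

theorem continuousOn_R₁ (hn : 2 ≤ n) (p q : Fin n) :
    ContinuousOn (fun z => T.R₁ z p q) domain :=
  ((T.continuous_U _).continuousOn.div (T.continuous_U _).continuousOn
    fun _ hz => (T.U_pos hn hz.2 _).ne').mul (by fun_prop)

theorem continuousOn_R₂ (hn : 2 ≤ n) (p q : Fin n) :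
    ContinuousOn (fun z => T.R₂ z p q) domain :=
  ((T.continuous_Y _).continuousOn.div (T.continuous_Y _).continuousOn
    fun _ hz => (T.Y_pos hn hz.2 _).ne').mul (by fun_prop)

theorem continuousOn_R (hn : 2 ≤ n) (p q : Fin n) :
    ContinuousOn (fun z => T.R₁ z p q * T.R₂ z p q) domain :=
  (T.continuousOn_R₁ hn p q).mul (T.continuousOn_R₂ hn p q)

theorem continuousOn_m (hn : 2 ≤ n) (p q : Fin n) : ContinuousOn (fun z => T.m z p q) domain := by
  have h1 : ∀ p q, ∀ z ∈ domain, 1 + T.R₁ z p q * T.R₂ z p q ≠ 0 := fun p q z hz => by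
    linarith [T.R_nonneg hn hz p q]
  unfold m
  split_ifs
  · exact (T.continuousOn_R₂ hn p q).div (continuousOn_const.add (T.continuousOn_R hn p q)) (h1 p q)
  · exact (T.continuousOn_R₁ hn q p).div (continuousOn_const.add (T.continuousOn_R hn q p)) (h1 q p)
  · fun_prop
  · fun_prop

theorem continuousOn_e (hn : 2 ≤ n) (p q : Fin n) : ContinuousOn (fun z => T.e z p q) domain := by
  have h1 : ∀ p q, ∀ z ∈ domain, 1 + T.R₁ z p q * T.R₂ z p q ≠ 0 := fun p q z hz => by
    linarith [T.R_nonneg hn hz p q]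
  have h2 : ∀ p q, ContinuousOn (fun z => T.u z p * T.y z q * (1 - T.R₁ z p q * T.R₂ z p q) ^ 2 /
      (1 + T.R₁ z p q * T.R₂ z p q)) domain := by
    intro p q
    have hu : Continuous fun z => T.u z p := (T.continuous_U _).mul (by fun_prop)
    have hy : Continuous fun z => T.y z q := (T.continuous_Y _).mul (by fun_prop)
    exact ((hu.mul hy).continuousOn.mul ((continuousOn_const.sub (T.continuousOn_R hn p q)).pow
      2)).div (continuousOn_const.add (T.continuousOn_R hn p q)) (h1 p q)
  unfold e
  split_ifs
  · exact h2 p q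
  · exact h2 q p
  · exact continuousOn_const

theorem Adj.of_lt {p q : Fin n} (hadj : T.Adj p q) (h : T.J p < T.J q) :
    T.J q = T.J p + 1 ∧ T.K p = 0 ∧ T.K q = 0 := by
  unfold Adj at hadj; omega

theorem ea_eq {p q : Fin n} (h : T.J q = T.J p + 1) (h' : T.J p % 2 = 0) (hp : T.K p = 0)
    (hq : T.K q = 0) : T.ea p = T.ea q := by
  have h1 : (T.J p + 1) / 2 = T.J p / 2 := by omega
  unfold ea shift
  rw [h, h1, hp, hq]
  simp

theorem eb_eq {p q : Fin n} (h : T.J q = T.J p + 1) (h' : T.J p % 2 = 1) (hp : T.K p = 0)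
    (hq : T.K q = 0) : T.eb p = T.eb q := by
  have h1 : (T.J p + 1 + 1) / 2 = (T.J p + 1) / 2 := by omega
  unfold eb shift
  rw [h, h1, hp, hq]
  simp

theorem χ_eq {p : Fin n} (hp : T.K p = 0) : T.χ p = decide (T.J p % 2 = 1) := by
  simp [χ, hp]

/-- For `ε = 0` the quotient `u_q / u_p` is non-zero only for an edge between a block with an even
number and the next one. -/
theorem R₁_zero {θ : ℝ} {p q : Fin n} (h : T.J p < T.J q) :
    T.R₁ (0, θ) p q = if T.χ q = true ∧ T.χ p = false then θ * T.N q p else 0 := by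
  rcases T.ea_lt_or h with h1 | ⟨h1, h2, h3, h4, h5⟩
  · have h2 : T.R₁ (0, θ) p q = 0 := by
      simp [R₁, (Nat.sub_pos_of_lt h1).ne']
    rw [h2]
    split_ifs with h3
    · by_contra h0
      have hadj := T.adj_of_N_ne_zero (right_ne_zero_of_mul (Ne.symm h0))
      obtain ⟨h4, h5, h6⟩ := (hadj.symm T).of_lt T h
      rw [T.χ_eq h5, decide_eq_false_iff_not] at h3
      exact h1.ne (T.ea_eq h4 (by omega) h5 h6)
    · rfl
  · have hχ : T.χ q = true ∧ T.χ p = false := by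
      rw [T.χ_eq h4, T.χ_eq h5, decide_eq_true_eq, decide_eq_false_iff_not]
      omega
    have hadj : T.Adj q p := Or.inl ⟨h5, h4, Or.inr h3⟩
    have h6 : (T.J p + 1) % 2 = 1 := by omega
    have h7 : ¬ T.J p % 2 = 1 := by omega
    rw [if_pos hχ]
    simp only [R₁, h1, Nat.sub_self, pow_zero, mul_one, N, Matrix.of_apply, hadj, if_true]
    rw [h3, U, U, if_pos h6, if_neg h7, div_one, Nat.add_sub_cancel, ← h3, T.κJ_eq h4, T.κJ_eq h5,
      mul_comm (T.κ p)]

/-- For `ε = 0` the quotient `y_p / y_q` is non-zero only for an edge between a block with an odd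
number and the next one. -/
theorem R₂_zero {θ : ℝ} {p q : Fin n} (h : T.J p < T.J q) :
    T.R₂ (0, θ) p q = if T.χ p = true ∧ T.χ q = false then θ * T.N p q else 0 := by
  rcases T.eb_lt_or h with h1 | ⟨h1, h2, h3, h4, h5⟩
  · have h2 : T.R₂ (0, θ) p q = 0 := by
      simp [R₂, (Nat.sub_pos_of_lt h1).ne']
    rw [h2]
    split_ifs with h3
    · by_contra h0
      have hadj := T.adj_of_N_ne_zero (right_ne_zero_of_mul (Ne.symm h0))
      obtain ⟨h4, h5, h6⟩ := hadj.of_lt T h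
      rw [T.χ_eq h5, decide_eq_true_eq] at h3
      exact h1.ne' (T.eb_eq h4 h3.1 h5 h6)
    · rfl
  · have hχ : T.χ p = true ∧ T.χ q = false := by
      rw [T.χ_eq h4, T.χ_eq h5, decide_eq_true_eq, decide_eq_false_iff_not]
      omega
    have hadj : T.Adj p q := Or.inl ⟨h4, h5, Or.inl h3⟩
    have h7 : ¬ (T.J p + 1) % 2 = 1 := by omega
    rw [if_pos hχ]
    simp only [R₂, h1, Nat.sub_self, pow_zero, mul_one, N, Matrix.of_apply, hadj, if_true]
    rw [h3, Y, Y, if_pos h2, if_neg h7, div_one, ← h3, T.κJ_eq h4, T.κJ_eq h5]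

theorem R_zero {θ : ℝ} {p q : Fin n} (h : T.J p < T.J q) :
    T.R₁ (0, θ) p q * T.R₂ (0, θ) p q = 0 := by
  rw [T.R₁_zero h, T.R₂_zero h]
  cases T.χ p <;> cases T.χ q <;> simp

/-- For `ε = 0` the coefficient `m_pq` vanishes unless `p` and `q` are joined by an edge of the tree
and `χ` is true for `p` and false for `q`. -/
theorem m_zero (θ : ℝ) (p q : Fin n) :
    T.m (0, θ) p q = if T.χ p = true ∧ T.χ q = false then θ * T.N p q else 0 := by
  rcases lt_trichotomy (T.J p) (T.J q) with h | h | h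
  · simp only [m, h, if_true, T.R_zero h, add_zero, div_one]
    exact T.R₂_zero h
  · have hN : T.N p q ≠ 0 → (T.K p = 0 ∧ T.K q ≠ 0) ∨ (T.K q = 0 ∧ T.K p ≠ 0) := by
      intro h0
      have := T.adj_of_N_ne_zero h0
      unfold Adj at this
      omega
    have hlt := T.ea_lt_iff h
    by_cases h1 : T.ea q < T.ea p
    · have h3 : T.ea p - T.ea q ≠ 0 := by omega
      simp only [m, h, lt_irrefl, if_false, h1, if_true, zero_pow h3, zero_pow two_ne_zero, mul_zero,
        sub_zero]
      split_ifs with h2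
      · by_contra h0
        have h4 := hN (right_ne_zero_of_mul (Ne.symm h0))
        have h5 := hlt.mp h1
        unfold χ at h2
        rw [decide_eq_true_eq, decide_eq_false_iff_not] at h2
        split_ifs at h2 h5 <;> omega
      · rfl
    · simp only [m, h, lt_irrefl, if_false, h1]
      split_ifs with h2
      · rfl
      · by_contra h0
        have h4 := hN (right_ne_zero_of_mul h0)
        have h5 := mt hlt.mpr h1
        unfold χ at h2
        rw [decide_eq_true_eq, decide_eq_false_iff_not] at h2
        split_ifs at h2 h5 <;> omega
  · simp only [m, h, h.not_gt, if_true, if_false, T.R_zero h, add_zero, div_one]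
    exact T.R₁_zero h

theorem e_zero (θ : ℝ) (p q : Fin n) : T.e (0, θ) p q = 0 := by
  have hu : ∀ p, T.u (0, θ) p = 0 := fun p => by
    have : T.ea p ≠ 0 := by
      have := T.shift_pos p
      unfold ea
      omega
    simp [u, this]
  simp [e, hu]

theorem N_eq_zero {p q : Fin n} (h : T.χ p = T.χ q) : T.N p q = 0 := by
  by_contra h0
  exact (T.adj_of_N_ne_zero h0).χ_ne T h

theorem gramOf_zero (hn : 2 ≤ n) (θ : ℝ) :
    gramOf T.χ (T.m (0, θ)) (T.e (0, θ)) = 1 - θ • T.N := by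
  ext p q
  simp only [gramOf, Matrix.of_apply, Matrix.sub_apply, Matrix.smul_apply, smul_eq_mul,
    Matrix.one_apply, T.e_zero]
  by_cases hpq : p = q
  · subst hpq
    simp [T.N_eq_zero rfl]
  · have hN := (T.isNormalizedWeight hn).symm p q
    simp only [hpq, if_false, T.m_zero]
    by_cases hχ : T.χ p = T.χ q
    · simp [hχ, T.N_eq_zero hχ]
    · rw [if_neg hχ, hN]
      revert hχ
      cases T.χ p <;> cases T.χ q <;> simp

theorem vertOf_zero (θ : ℝ) : vertOf T.χ (T.m (0, θ)) (T.e (0, θ)) = 1 := by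
  ext p q
  simp only [vertOf, Matrix.of_apply, Matrix.one_apply, T.e_zero]
  by_cases hpq : p = q
  · simp [hpq]
  · simp only [hpq, if_false, T.m_zero]
    cases T.χ p <;> simp

theorem continuousOn_gramOf (hn : 2 ≤ n) :
    ContinuousOn (fun z => gramOf T.χ (T.m z) (T.e z)) domain := by
  have hm := T.continuousOn_m hn
  have he := T.continuousOn_e hn
  refine continuousOn_pi.mpr fun p => continuousOn_pi.mpr fun q => ?_
  simp only [gramOf, Matrix.of_apply]
  split_ifs
  · exact continuousOn_const
  · exact ((hm p q).add (hm q p)).add (he p q)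
  · exact (((hm p q).add (hm q p)).add (he p q)).neg

theorem continuousOn_vertOf (hn : 2 ≤ n) :
    ContinuousOn (fun z => vertOf T.χ (T.m z) (T.e z)) domain := by
  have hm := T.continuousOn_m hn
  have he := T.continuousOn_e hn
  refine continuousOn_pi.mpr fun p => continuousOn_pi.mpr fun q => ?_
  simp only [vertOf, Matrix.of_apply]
  split_ifs
  · exact continuousOn_const
  · exact continuousOn_const.mul (hm q p)
  · exact continuousOn_const.mul ((hm p q).add (he p q))
  · exact (continuousOn_const.mul (hm q p)).neg
  · exact (continuousOn_const.mul ((hm p q).add (he p q))).neg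

theorem e_symm (z : ℝ × ℝ) (p q : Fin n) : T.e z p q = T.e z q p := by
  rcases lt_trichotomy (T.J p) (T.J q) with h | h | h
  · simp [e, h, h.not_gt]
  · simp [e, h]
  · simp [e, h, h.not_gt]

theorem gramOf_symm (z : ℝ × ℝ) (p q : Fin n) :
    gramOf T.χ (T.m z) (T.e z) p q = gramOf T.χ (T.m z) (T.e z) q p := by
  simp only [gramOf, Matrix.of_apply, T.e_symm z q p, add_comm (T.m z q p), eq_comm]

/-- The conditions under which a member of the family gives rise to a flexible cross-polytope in one
of the three spaces. -/
structure IsGood {k : ℕ} (T : BlockIndexing (k + 1)) (z : ℝ × ℝ) : Prop where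
  admissible : Admissible (gramOf T.χ (T.m z) (T.e z)) (vertOf T.χ (T.m z) (T.e z))
  limit_ne : ∀ ε, (limitMatrixOf T.χ (gramOf T.χ (T.m z) (T.e z))
    (vertOf T.χ (T.m z) (T.e z)) ε).det ≠ 0
  between : ∀ p q, T.J p < T.J q → T.R₁ z p q * T.R₂ z p q < 1
  within : ∀ p q, T.ea q < T.ea p → 2 * (z.2 * T.N p q * z.1 ^ (T.ea p - T.ea q)) < 1

open Filter Topology

/-- All conditions are open and hold for `ε = 0` and `θ = 1`. -/
theorem eventually_isGood {k : ℕ} (T : BlockIndexing (k + 1)) (hk : 1 ≤ k) :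
    ∀ᶠ z in 𝓝[domain] ((0 : ℝ), (1 : ℝ)), T.IsGood z := by
  have hn : 2 ≤ k + 1 := by omega
  have hw := T.isNormalizedWeight hn
  have hz₀ : ((0 : ℝ), (1 : ℝ)) ∈ domain :=
    ⟨Set.mem_Ici.mpr le_rfl, Set.mem_Ioi.mpr one_pos⟩
  have hG := T.continuousOn_gramOf hn _ hz₀
  have hV := T.continuousOn_vertOf hn _ hz₀
  unfold ContinuousWithinAt at hG hV
  dsimp only at hG hV
  rw [T.gramOf_zero hn, one_smul] at hG
  rw [T.vertOf_zero] at hV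
  have hadm := (hG.prodMk_nhds hV).eventually hw.admissible_one_sub.eventually
  have hlim : ∀ᶠ z in 𝓝[domain] ((0 : ℝ), (1 : ℝ)), ∀ ε,
      (limitMatrixOf T.χ (gramOf T.χ (T.m z) (T.e z)) (vertOf T.χ (T.m z) (T.e z)) ε).det ≠ 0 := by
    rw [eventually_all]
    intro ε
    have hne := limitMatrixOf_det_ne_zero (N := T.N) (χ := T.χ)
      (fun p q h => (T.adj_of_N_ne_zero h).χ_ne T) ε
    exact (hG.prodMk_nhds hV).eventually (eventually_limitMatrixOf_det_ne_zero hne)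
  have hbetween : ∀ᶠ z in 𝓝[domain] ((0 : ℝ), (1 : ℝ)), ∀ p q, T.J p < T.J q →
      T.R₁ z p q * T.R₂ z p q < 1 := by
    simp only [eventually_all]
    intro p q h
    have h1 := T.continuousOn_R hn p q _ hz₀
    unfold ContinuousWithinAt at h1
    dsimp only at h1
    rw [T.R_zero h] at h1
    exact h1.eventually_lt_const one_pos
  have hwithin : ∀ᶠ z in 𝓝[domain] ((0 : ℝ), (1 : ℝ)), ∀ p q, T.ea q < T.ea p →
      2 * (z.2 * T.N p q * z.1 ^ (T.ea p - T.ea q)) < 1 := by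
    simp only [eventually_all]
    intro p q h
    have h1 : Continuous fun z : ℝ × ℝ => 2 * (z.2 * T.N p q * z.1 ^ (T.ea p - T.ea q)) := by
      fun_prop
    refine (h1.continuousWithinAt (x := ((0 : ℝ), (1 : ℝ)))).eventually_lt_const ?_
    simp [(Nat.sub_pos_of_lt h).ne']
  filter_upwards [hadm, hlim, hbetween, hwithin] with z h1 h2 h3 h4
  exact ⟨h1 (T.gramOf_symm z) (fun p => by simp [gramOf]) (fun p => by simp [vertOf]), h2, h3, h4⟩

/-- All three signs of the determinant of the Gram matrix occur: for `ε = 0` it changes its sign at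
`θ = 1`. -/
theorem exists_isGood {k : ℕ} (T : BlockIndexing (k + 1)) (hk : 1 ≤ k) (X : SpaceForm) :
    ∃ z : ℝ × ℝ, 0 < z.1 ∧ 0 < z.2 ∧ T.IsGood z ∧
      X.DetCondition (gramOf T.χ (T.m z) (T.e z)).det := by
  have hn : 2 ≤ k + 1 := by omega
  have hw := T.isNormalizedWeight hn
  obtain ⟨δ, hδ, hgood⟩ := Metric.mem_nhdsWithin_iff.mp (T.eventually_isGood hk)
  have hgood' : ∀ ε θ : ℝ, 0 ≤ ε → 0 < θ → ε < δ → |θ - 1| < δ → T.IsGood (ε, θ) := by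
    intro ε θ hε hθ hε' hθ'
    refine hgood ⟨?_, hε, hθ⟩
    rw [Metric.mem_ball, Prod.dist_eq, max_lt_iff, Real.dist_eq, Real.dist_eq, sub_zero,
      abs_of_nonneg hε]
    exact ⟨hε', hθ'⟩
  set d : ℝ × ℝ → ℝ := fun z => (gramOf T.χ (T.m z) (T.e z)).det with hd
  have hdc : ContinuousOn d domain :=
    (continuous_id.matrix_det).comp_continuousOn (T.continuousOn_gramOf hn)
  have hd0 : ∀ θ, 0 < θ → |θ - 1| < δ → ∃ c, 0 < c ∧ d (0, θ) = (1 - θ) * c := by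
    intro θ hθ hθ'
    have h1 := (hgood' 0 θ le_rfl hθ hδ hθ').admissible.adj_pos
    rw [T.gramOf_zero hn] at h1
    have h2 := hw.det_mul_eq θ 0
    have h3 := hw.pos 0
    refine ⟨((1 - θ • T.N).adjugate.mulVec T.κ) 0 / T.κ 0, div_pos ?_ h3, ?_⟩
    · exact Finset.sum_pos (fun q _ => mul_pos (h1 0 q) (hw.pos q)) ⟨0, Finset.mem_univ _⟩
    · rw [hd]
      dsimp only
      rw [T.gramOf_zero hn, ← mul_div_assoc, eq_div_iff h3.ne', h2]
  set η := min (δ / 2) (1 / 2) with hη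
  have hη0 : 0 < η := by positivity
  have hηδ : η < δ := (min_le_left _ _).trans_lt (half_lt_self hδ)
  have hη1 : η ≤ 1 / 2 := min_le_right _ _
  have htend : ∀ θ : ℝ, 0 < θ → Tendsto (fun ε : ℝ => d (ε, θ)) (𝓝[>] 0) (𝓝 (d (0, θ))) := by
    intro θ hθ
    have h0 : Tendsto d (𝓝[domain] (0, θ)) (𝓝 (d (0, θ))) := hdc (0, θ) ⟨Set.mem_Ici.mpr le_rfl, hθ⟩
    refine h0.comp (tendsto_nhdsWithin_iff.mpr ⟨?_, ?_⟩)
    · exact ((by fun_prop : Continuous fun ε : ℝ => (ε, θ)).tendsto 0).mono_left nhdsWithin_le_nhds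
    · filter_upwards [self_mem_nhdsWithin] with ε hε
      exact ⟨Set.mem_Ici.mpr (le_of_lt hε), hθ⟩
  have hpos : ∀ᶠ ε in 𝓝[>] (0 : ℝ), 0 < d (ε, 1 - η) := by
    obtain ⟨c, hc, h⟩ := hd0 (1 - η) (by linarith) (by
      rw [sub_sub_cancel_left, abs_neg, abs_of_pos hη0]; exact hηδ)
    refine (htend (1 - η) (by linarith)).eventually_const_lt ?_
    rw [h, sub_sub_cancel]; positivity
  have hneg : ∀ᶠ ε in 𝓝[>] (0 : ℝ), d (ε, 1 + η) < 0 := by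
    obtain ⟨c, hc, h⟩ := hd0 (1 + η) (by linarith) (by
      rw [add_sub_cancel_left, abs_of_pos hη0]; exact hηδ)
    refine (htend (1 + η) (by linarith)).eventually_lt_const ?_
    rw [h]
    have := mul_pos hη0 hc
    linarith
  obtain ⟨ε, ⟨⟨h1, h2⟩, h3⟩, hε⟩ := (((hpos.and hneg).and
    (eventually_nhdsWithin_of_eventually_nhds (eventually_lt_nhds hδ))).and
      self_mem_nhdsWithin).exists
  have hε0 : 0 < ε := hε
  obtain ⟨θ, hθ, hθX⟩ : ∃ θ ∈ Set.Icc (1 - η) (1 + η), X.DetCondition (d (ε, θ)) := by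
    cases X
    · have hc : ContinuousOn (fun θ => d (ε, θ)) (Set.Icc (1 - η) (1 + η)) := by
        refine hdc.comp (by fun_prop) fun θ hθ => ⟨hε0.le, ?_⟩
        have := hθ.1
        show 0 < θ
        linarith
      obtain ⟨θ, hθ, h⟩ := intermediate_value_Icc' (by linarith) hc ⟨h2.le, h1.le⟩
      exact ⟨θ, hθ, h⟩
    · exact ⟨1 - η, ⟨le_rfl, by linarith⟩, h1⟩
    · exact ⟨1 + η, ⟨by linarith, le_rfl⟩, h2⟩
  have hθ0 : 0 < θ := by linarith [hθ.1]
  refine ⟨(ε, θ), hε0, hθ0, hgood' ε θ hε0.le hθ0 h3 ?_, hθX⟩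
  rw [abs_lt]
  constructor <;> linarith [hθ.1, hθ.2]

/-- For every tree of blocks and every space there is a curve with these blocks that is realized by
a frame. -/
theorem exists_curveData {k : ℕ} (T : BlockIndexing (k + 1)) (hk : 1 ≤ k) (X : SpaceForm) :
    ∃ D : CurveData (k + 1), D.J = T.J ∧ Nonempty (Frame X D.gram D.vert) ∧
      ∀ ε, (D.limitMatrix ε).det ≠ 0 := by
  obtain ⟨z, hz₁, hz₂, h, hX⟩ := T.exists_isGood hk X
  exact ⟨T.curveData (by omega) z hz₁ hz₂ h.between h.within, rfl, h.admissible.nonempty_frame hk hX,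
    h.limit_ne⟩

end BlockIndexing

/-! ### Existence of flexible cross-polytopes of every type -/

/-- A tree whose blocks have the sizes prescribed by a partition: its parts are numbered, and so are
the members of each part. -/
theorem exists_blockIndexing {n : ℕ} (π : n.Partition) : ∃ (T : BlockIndexing n)
    (I : Finpartition (Finset.univ : Finset (Fin n))),
    (∀ p q, T.J p = T.J q ↔ ∃ B ∈ I.parts, p ∈ B ∧ q ∈ B) ∧
      Multiset.map Finset.card I.parts.val = π.parts := by
  classical
  set L := π.parts.toList with hL
  have hsum : ∑ i : Fin L.length, L[i.1] = n := by
    rw [Fin.sum_univ_getElem, hL, Multiset.sum_toList, π.parts_sum]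
  have hpos : ∀ i : Fin L.length, 0 < L[i.1] := fun i =>
    π.parts_pos (Multiset.mem_toList.mp (List.getElem_mem _))
  let E : ((i : Fin L.length) × Fin L[i.1]) ≃ Fin n := finSigmaFinEquiv.trans (finCongr hsum)
  have hE : ∀ i, E.symm (E ⟨i, ⟨0, hpos i⟩⟩) = ⟨i, ⟨0, hpos i⟩⟩ := fun i => E.symm_apply_apply _
  let T : BlockIndexing n :=
    { J := fun p => (E.symm p).1
      K := fun p => (E.symm p).2
      inj := fun p q h h' => by
        apply E.symm.injective
        revert h h'
        generalize E.symm p = x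
        generalize E.symm q = y
        rcases x with ⟨i, k⟩
        rcases y with ⟨j, l⟩
        intro h h'
        obtain rfl : i = j := Fin.ext h
        obtain rfl : k = l := Fin.ext h'
        rfl
      centre := fun p _ => ⟨E ⟨(E.symm p).1, ⟨0, hpos _⟩⟩, by rw [hE]; exact ⟨rfl, rfl⟩⟩
      prev := fun p h => ⟨E ⟨⟨(E.symm p).1 - 1, by have := (E.symm p).1.2; omega⟩, ⟨0, hpos _⟩⟩, by
        rw [hE]
        exact ⟨Nat.sub_add_cancel (Nat.pos_of_ne_zero h), rfl⟩⟩ }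
  let block : Fin L.length → Finset (Fin n) := fun i => Finset.univ.filter fun p => (E.symm p).1 = i
  have hmem : ∀ i p, p ∈ block i ↔ (E.symm p).1 = i := fun i p => by simp [block]
  have hcard : ∀ i, (block i).card = L[i.1] := by
    intro i
    have h1 : block i = Finset.univ.map
        ((Function.Embedding.sigmaMk (β := fun i : Fin L.length => Fin L[i.1]) i).trans
          E.toEmbedding) := by
      ext p
      rw [hmem]
      simp only [Finset.mem_map, Finset.mem_univ, true_and, Function.Embedding.trans_apply,
        Function.Embedding.sigmaMk_apply, Equiv.coe_toEmbedding]
      constructor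
      · rintro rfl
        exact ⟨(E.symm p).2, E.apply_symm_apply p⟩
      · rintro ⟨k, rfl⟩
        rw [Equiv.symm_apply_apply]
    rw [h1, Finset.card_map, Finset.card_univ, Fintype.card_fin]
  have hinj : Function.Injective block := by
    intro i j h
    have h1 : E ⟨i, ⟨0, hpos i⟩⟩ ∈ block i := by rw [hmem, Equiv.symm_apply_apply]
    rw [h, hmem, Equiv.symm_apply_apply] at h1
    exact h1
  let I : Finpartition (Finset.univ : Finset (Fin n)) :=
    Finpartition.ofExistsUnique (Finset.univ.image block) (fun _ _ => Finset.subset_univ _)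
      (fun p _ => ⟨block (E.symm p).1, ⟨Finset.mem_image_of_mem _ (Finset.mem_univ _),
        (hmem _ _).mpr rfl⟩, by
          rintro B ⟨hB, hp⟩
          obtain ⟨i, -, rfl⟩ := Finset.mem_image.mp hB
          rw [(hmem _ _).mp hp]⟩)
      (by
        intro h
        obtain ⟨i, -, hi⟩ := Finset.mem_image.mp h
        have h1 := hcard i
        rw [hi, Finset.card_empty] at h1
        exact (hpos i).ne h1)
  refine ⟨T, I, fun p q => ?_, ?_⟩
  · constructor
    · intro h
      exact ⟨block (E.symm p).1, Finset.mem_image_of_mem _ (Finset.mem_univ _), (hmem _ _).mpr rfl,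
        (hmem _ _).mpr (Fin.ext h).symm⟩
    · rintro ⟨B, hB, hp, hq⟩
      obtain ⟨i, -, rfl⟩ := Finset.mem_image.mp hB
      exact congrArg Fin.val (((hmem _ _).mp hp).trans ((hmem _ _).mp hq).symm)
  · have h1 : I.parts.val = (Finset.univ : Finset (Fin L.length)).val.map block :=
      Finset.image_val_of_injOn hinj.injOn
    rw [h1, Multiset.map_map]
    have h2 : (Finset.univ : Finset (Fin L.length)).val.map (Finset.card ∘ block) =
        (Finset.univ : Finset (Fin L.length)).val.map fun i => L[i.1] :=
      Multiset.map_congr rfl fun i _ => hcard i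
    rw [h2, Fin.univ_val_map, List.ofFn_getElem]
    exact Multiset.coe_toList π.parts

theorem mainTheorem6 :
    (∀ (n : ℕ), 3 ≤ n → ∀ (π : n.Partition) (X : SpaceForm),
      ∃ P : VertexTuple X n, IsFlexibleOfType P π) ∧
    (∀ (n : ℕ), 5 ≤ n → ∀ X : SpaceForm,
      ∃ P : unitInterval → VertexTuple X n, VertexTuple.IsEssentialFlex P) := by
  have main : ∀ (n : ℕ), 3 ≤ n → ∀ (π : n.Partition) (X : SpaceForm),
      ∃ P : VertexTuple X n, IsFlexibleOfType P π := by
    intro n hn π X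
    obtain ⟨T, I, hI, hπ⟩ := exists_blockIndexing π
    obtain ⟨k, rfl⟩ : ∃ k, n = k + 1 := ⟨n - 1, by omega⟩
    obtain ⟨D, hJ, ⟨F⟩, hlim⟩ := T.exists_curveData (by omega) X
    refine D.exists_isFlexibleOfType (by omega) F hlim ⟨I, fun p q => ?_, hπ⟩
    rw [D.coordProportional_curve_iff, hJ, hI]
  refine ⟨main, fun n hn X => ?_⟩
  obtain ⟨P, -, B, C, -, -, -, -, t, -, -, ht⟩ :=
    main n (by omega) (Nat.Partition.indiscrete n) X
  exact ⟨_, ht⟩
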